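/- Let $N\ge 1$ and $m\ge 2$ be integers and let $\Omega\subset\mathbb R^N$ be a bounded domain (nonempty, open and connected), with Lipschitz boundary if $N\ge 2$. For $u\in L^2(\Omega)$, extended by $0$ outside $\Omega$, put $\hat u(\xi)=\int_{\mathbb R^N}e^{-ix\cdot\xi}u(x)\,dx$. Let $\mathbb H_{m,0}(\Omega)\subset L^2(\Omega)$ be the closure of $C_c^\infty(\Omega)$ for the norm $\|u\|_m=\big(\int_{\mathbb R^N}(\log(e+|\xi|))^m|\hat u(\xi)|^2\,d\xi\big)^{1/2}$, and for $u,v\in\mathbb H_{m,0}(\Omega)$ let $$(u,v)_m=\frac1{(2\pi)^N}\int_{\mathbb R^N}(2\log|\xi|)^m\,\hat u(\xi)\,\overline{\hat v(\xi)}\,d\xi .$$ A real number $\mu$ is a Dirichlet eigenvalue in $\Omega$ of the $m$-order logarithmic Laplacian $\mathcal L_m$ (the operator with Fourier symbol $(2\log|\xi|)^m$) if there is $u\in\mathbb H_{m,0}(\Omega)\setminus\{0\}$ with $(u,v)_m=\mu\int_\Omega u\,\overline v\,dx$ for all $v\in\mathbb H_{m,0}(\Omega)$; its multiplicity is the dimension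 of the space of such $u$ (together with $0$). Then the Dirichlet eigenvalues, repeated according to multiplicity, form a sequence $\lambda_{m,1}\le\lambda_{m,2}\le\cdots\to+\infty$, and, with $\mathcal N_m(\lambda)=\#\{k:\lambda_{m,k}<\lambda\}$, $a_+=\max\{0,a\}$ and $T_N=\omega_N/(2\pi)^N$, where $\omega_N$ is the surface measure of the unit sphere in $\mathbb R^N$, $$\lim_{\lambda\to+\infty}e^{-\frac N2\lambda^{1/m}}\,\mathcal N_m(\lambda)=\frac{T_N|\Omega|}{N}$$ and $$\lim_{\lambda\to+\infty}\lambda^{-\frac{m-1}m}\,e^{-\frac N2\lambda^{1/m}}\sum_k(\lambda-\lambda_{m,k})_+=\frac{2m}{N^2}\,T_N|\Omega| .$$ -/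

import Mathlib

namespace LogLaplacian

open MeasureTheory Filter Topology
open scoped ContDiff ENNReal ComplexConjugate

noncomputable section

/-- `Ω` lies, near each of its boundary points, on one side of the graph of a Lipschitz function:
there are a unit vector `e` (the vertical direction) and a Lipschitz function `g` on the
hyperplane orthogonal to `e` such that, near the point, `Ω` is the region strictly above the
graph of `g`. -/
def HasLipschitzBoundary {N : ℕ} (Ω : Set (EuclideanSpace ℝ (Fin N))) : Prop :=
  ∀ z ∈ frontier Ω, ∃ e : EuclideanSpace ℝ (Fin N), ‖e‖ = 1 ∧
    ∃ (K : NNReal) (g : (Submodule.span ℝ {e})ᗮ → ℝ), LipschitzWith K g ∧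
      ∃ r : ℝ, 0 < r ∧ ∀ x ∈ Metric.ball z r,
        (x ∈ Ω ↔ g ((Submodule.span ℝ {e})ᗮ.orthogonalProjectionOnto x) < inner ℝ e x)

/-- The complex Hilbert space `L²(Ω)`; its elements are thought of as extended by `0` outside
of `Ω`. -/
abbrev L2 {N : ℕ} (Ω : Set (EuclideanSpace ℝ (Fin N))) : Type :=
  Lp ℂ 2 (volume.restrict Ω)

/-- The Fourier transform `û(ξ) = ∫ e^{-i x·ξ} u(x) dx` of the extension by `0` of a function on
`Ω`. For bounded `Ω` and `u ∈ L²(Ω)` the integrand is integrable. -/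
def fourier {N : ℕ} (Ω : Set (EuclideanSpace ℝ (Fin N))) (u : EuclideanSpace ℝ (Fin N) → ℂ)
    (ξ : EuclideanSpace ℝ (Fin N)) : ℂ :=
  ∫ x in Ω, Complex.exp (-(Complex.I * ((inner ℝ x ξ : ℝ) : ℂ))) * u x

/-- The square of the norm `‖u‖_m`, that is `∫ (log (e + |ξ|))^m |û(ξ)|² dξ ∈ [0, ∞]`. -/
def normSq {N : ℕ} (m : ℕ) (Ω : Set (EuclideanSpace ℝ (Fin N)))
    (u : EuclideanSpace ℝ (Fin N) → ℂ) : ℝ≥0∞ :=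
  ∫⁻ ξ : EuclideanSpace ℝ (Fin N),
    ENNReal.ofReal (Real.log (Real.exp 1 + ‖ξ‖) ^ m * ‖fourier Ω u ξ‖ ^ 2)

/-- `φ ∈ C_c^∞(Ω)`. -/
def IsTestFunction {N : ℕ} (Ω : Set (EuclideanSpace ℝ (Fin N)))
    (φ : EuclideanSpace ℝ (Fin N) → ℂ) : Prop :=
  ContDiff ℝ ∞ φ ∧ HasCompactSupport φ ∧ tsupport φ ⊆ Ω

/-- The form domain `ℍ_{m,0}(Ω)`: the closure of `C_c^∞(Ω)` for the norm `‖·‖_m`. This norm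
dominates a multiple of the `L²`-norm, so the closure is taken inside `L²(Ω)`. -/
def formDomain {N : ℕ} (m : ℕ) (Ω : Set (EuclideanSpace ℝ (Fin N))) : Set (L2 Ω) :=
  {u | ∀ ε : ℝ≥0∞, 0 < ε → ∃ φ : EuclideanSpace ℝ (Fin N) → ℂ,
    IsTestFunction Ω φ ∧ normSq m Ω (fun x => u x - φ x) < ε}

/-- The form of the `m`-order logarithmic Laplacian,
`(u, v)_m = (2π)^{-N} ∫ (2 log |ξ|)^m û(ξ) conj(v̂(ξ)) dξ`. For bounded `Ω` the integrand is
integrable for all `u` and `v` in the form domain. -/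
def form {N : ℕ} (m : ℕ) (Ω : Set (EuclideanSpace ℝ (Fin N))) (u v : L2 Ω) : ℂ :=
  (((2 * Real.pi) ^ N)⁻¹ : ℝ) *
    ∫ ξ : EuclideanSpace ℝ (Fin N),
      (((2 * Real.log ‖ξ‖) ^ m : ℝ) : ℂ) * fourier Ω u ξ * conj (fourier Ω v ξ)

/-- The weak solutions `u` of `L_m u = μ u` in `Ω`, `u = 0` outside of `Ω`: those `u` in the form
domain with `(u, v)_m = μ ∫_Ω u conj(v) dx` for all `v` in the form domain. -/
def eigenfunctions {N : ℕ} (m : ℕ) (Ω : Set (EuclideanSpace ℝ (Fin N))) (μ : ℝ) : Set (L2 Ω) :=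
  {u | u ∈ formDomain m Ω ∧ ∀ v ∈ formDomain m Ω,
    form m Ω u v = (μ : ℂ) * ∫ x in Ω, u x * conj (v x)}

/-- The multiplicity of `μ` as a Dirichlet eigenvalue, i.e. the maximal number of linearly
independent eigenfunctions; it is `0` if and only if `μ` is not an eigenvalue. -/
def multiplicity {N : ℕ} (m : ℕ) (Ω : Set (EuclideanSpace ℝ (Fin N))) (μ : ℝ) : Cardinal :=
  Module.rank ℂ (Submodule.span ℂ (eigenfunctions m Ω μ))

/-- `lam 0 ≤ lam 1 ≤ …` lists the Dirichlet eigenvalues of the `m`-order logarithmic Laplacian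
in `Ω`, all of them, each repeated according to its multiplicity; `lam k` is the `(k+1)`-st
eigenvalue. -/
def IsEigenvalueSequence {N : ℕ} (m : ℕ) (Ω : Set (EuclideanSpace ℝ (Fin N)))
    (lam : ℕ → ℝ) : Prop :=
  Monotone lam ∧ ∀ μ : ℝ, Cardinal.mk {k : ℕ // lam k = μ} = multiplicity m Ω μ

/-- The number of terms of the sequence below `t` (finite if the sequence tends to `∞`). -/
def countingFunction (lam : ℕ → ℝ) (t : ℝ) : ℕ :=
  Set.ncard {k : ℕ | lam k < t}

/-- The Riesz mean `∑_k (t - lam k)_+` (a finite sum if the sequence tends to `∞`). -/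
def rieszMean (lam : ℕ → ℝ) (t : ℝ) : ℝ :=
  ∑' k : ℕ, max 0 (t - lam k)

/-- `ω_N`, the surface measure of the unit sphere of `ℝ^N`. -/
def sphereArea (N : ℕ) : ℝ :=
  ((volume : Measure (EuclideanSpace ℝ (Fin N))).toSphere).real Set.univ

/-- `T_N = ω_N / (2π)^N`. -/
def T (N : ℕ) : ℝ :=
  sphereArea N / (2 * Real.pi) ^ N

end

end LogLaplacian

/-! Everything follows from the asymptotics of the Riesz mean R(t) = ∑ (t - λ_k)_+ along t = s^m,
which is squeezed between two phase space integrals.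

Spectrum. The symbol (2 log|ξ|)^m is split into `posSymbol` ≥ 0 and `remSymbol`, which is integrable
and vanishes for |ξ| ≥ 1. Since û(ξ) is the inner product of u with a plane wave of norm |Ω|^(1/2),
the remainder defines a bounded form on L²(Ω). Hence the form is coercive after adding a constant
multiple of the L² inner product. The form domain embeds compactly in L²(Ω) because the weight tends
to infinity. The solution operator is therefore compact and self-adjoint, which gives an orthonormal
basis of eigenfunctions (`exists_hilbertBasis_eigenfunctions`).

Upper bound (`sum_sub_le`). By Plancherel, t - λ_k is the average of t - symbol against |ê_k|²;
replacing it by its positive part and using Bessel's inequality for plane waves gives R(t) ≤ |Ω|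
(2π)^(-N) ∫ (t - symbol)_+.

Lower bound (`setIntegral_le_sum_sub`). The variational principle is tested with φ(x) e^(ix·ξ), φ a
cutoff with ∫ φ² close to |Ω|, and integrated over ξ. The energy of such a wave exceeds (2 log|ξ|)^m
∫ φ² only by lower order terms, because the symbol varies slowly.

In polar coordinates both integrals have leading term (2m/N²) T_N s^(m-1) e^(Ns/2), up to the factor
|Ω| or ∫ φ². This is the second limit. For the first, the counting function is the slope of the
convex function R, and since R(s^m) grows exponentially in s, difference quotients with a small
fixed increment of s recover it (`tendsto_ncard_of_tendsto_tsum`). The constant is multiplied by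
(N/2)/m, giving T_N|Ω|/N. -/

open MeasureTheory Filter Topology Module
open scoped ContDiff ENNReal ComplexConjugate InnerProductSpace

namespace LogLaplacian

/-! ### Spectral theory of a coercive form with compact embedding. -/

section Spectral

variable {V H : Type} [NormedAddCommGroup V] [InnerProductSpace ℂ V] [CompleteSpace V]
  [NormedAddCommGroup H] [InnerProductSpace ℂ H] [CompleteSpace H]

/-- The solutions `J g` of the weak eigenvalue equation `⟪P g, h⟫ = a ⟪J g, J h⟫` for all `h`. -/
def weakEigenvectors (J : V →L[ℂ] H) (P : V →L[ℂ] V) (a : ℝ) : Set H :=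
  {u | ∃ g, J g = u ∧ ∀ h, ⟪P g, h⟫_ℂ = (a : ℂ) * ⟪J g, J h⟫_ℂ}

-- Coercivity makes `P` invertible (Lax–Milgram), and the operator is J P⁻¹ J*. It turns the weak
-- eigenvalue equation into an eigenvalue equation for one compact self-adjoint operator. If it
-- kills f, then the energy of P⁻¹ J* f vanishes, so f is orthogonal to the range of `J`.
open ContinuousLinearMap in
theorem exists_solutionOperator (J : V →L[ℂ] H) (P : V →L[ℂ] V) (hJ : IsCompactOperator J)
    (hker : ∀ f : H, (∀ g, ⟪J g, f⟫_ℂ = 0) → f = 0)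
    (hsymm : ∀ g h, ⟪P g, h⟫_ℂ = ⟪g, P h⟫_ℂ) (hpos : ∀ g, ‖g‖ ^ 2 ≤ (⟪P g, g⟫_ℂ).re) :
    ∃ T : H →L[ℂ] H, IsCompactOperator T ∧ T.IsSymmetric ∧
      (∀ f, ∃ g, J g = T f ∧ ∀ h, ⟪P g, h⟫_ℂ = ⟪f, J h⟫_ℂ) ∧
      (∀ f, 0 ≤ (⟪f, T f⟫_ℂ).re ∧ (T f = 0 → f = 0)) := by
  have hP : IsUnit P := by
    refine isUnit_of_forall_le_norm_inner_map P (c := 1) one_pos fun x => ?_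
    simpa using (hpos x).trans ((Complex.re_le_norm _))
  obtain ⟨U, hU⟩ := hP
  have hUinv : ∀ x, P ((↑U⁻¹ : V →L[ℂ] V) x) = x := fun x => by
    rw [← hU, ← mul_apply_eq_comp, Units.mul_inv]; rfl
  set S : V →L[ℂ] V := (↑U⁻¹ : V →L[ℂ] V)
  have key : ∀ f h, ⟪P (S (adjoint J f)), h⟫_ℂ = ⟪f, J h⟫_ℂ := fun f h => by
    rw [hUinv, adjoint_inner_left]
  refine ⟨J ∘L S ∘L adjoint J, hJ.comp_clm _, fun f f' => ?_, fun f => ⟨S (adjoint J f), rfl, key f⟩,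
    fun f => ?_⟩
  · change ⟪J (S (adjoint J f)), f'⟫_ℂ = ⟪f, J (S (adjoint J f'))⟫_ℂ
    rw [← key f, hsymm, ← inner_conj_symm, ← key f', inner_conj_symm]
  · change 0 ≤ (⟪f, J (S (adjoint J f))⟫_ℂ).re ∧ (J (S (adjoint J f)) = 0 → f = 0)
    rw [← key f]
    refine ⟨(sq_nonneg _).trans (hpos _), fun h0 => ?_⟩
    have h1 := hpos (S (adjoint J f))
    rw [key f, h0, inner_zero_right, Complex.zero_re] at h1
    have h2 : S (adjoint J f) = 0 := by
      rw [← norm_eq_zero]; exact pow_eq_zero_iff two_ne_zero |>.1 (le_antisymm h1 (sq_nonneg _))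
    refine hker f fun g => ?_
    rw [← inner_conj_symm, ← key f, h2]; simp

/-- Weak eigenvalues are the reciprocals of the eigenvalues of the solution operator T. As T is
positive and injective, all its eigenvalues are positive reals, so the spectral theorem for compact
operators leaves nothing uncovered. -/
theorem exists_hilbertBasis_weakEigenvectors (J : V →L[ℂ] H) (P : V →L[ℂ] V)
    (hJ : IsCompactOperator J) (hker : ∀ f : H, (∀ g, ⟪J g, f⟫_ℂ = 0) → f = 0)
    (hsymm : ∀ g h, ⟪P g, h⟫_ℂ = ⟪g, P h⟫_ℂ) (hpos : ∀ g, ‖g‖ ^ 2 ≤ (⟪P g, g⟫_ℂ).re) :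
    ∃ (ι : Type) (e : HilbertBasis ι ℂ H) (a : ι → ℝ),
      (∀ i, e i ∈ weakEigenvectors J P (a i)) ∧
      ∀ t : ℝ, Cardinal.mk {i // a i = t} =
        Module.rank ℂ (Submodule.span ℂ (weakEigenvectors J P t)) := by
  obtain ⟨T, hTc, hTs, hsol, hTpos⟩ := exists_solutionOperator J P hJ hker hsymm hpos
  have hT0 : ∀ a : ℝ, 0 < a → ∀ f, f ∈ End.eigenspace (T : End ℂ H) ((a⁻¹ : ℝ) : ℂ) ↔
      f ∈ weakEigenvectors J P a := by
    intro a ha f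
    have hac : (a : ℂ) ≠ 0 := by exact_mod_cast ha.ne'
    rw [End.mem_eigenspace_iff]
    constructor
    · intro hf
      obtain ⟨g, hg, hg'⟩ := hsol f
      have hJ : J ((a : ℂ) • g) = f := by
        rw [map_smul, hg]
        change (a : ℂ) • (T : End ℂ H) f = f
        rw [hf, smul_smul]; simp [hac]
      refine ⟨(a : ℂ) • g, hJ, fun h => ?_⟩
      rw [hJ, map_smul, inner_smul_left, hg']; simp
    · rintro ⟨g, rfl, hg⟩
      obtain ⟨g', hg1, hg2⟩ := hsol (J g)
      -- Uniqueness of weak solutions: the difference has zero energy, so coercivity kills it.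
      have : g - (a : ℂ) • g' = 0 := by
        have h1 := hpos (g - (a : ℂ) • g')
        have h2 : ⟪P (g - (a : ℂ) • g'), g - (a : ℂ) • g'⟫_ℂ = 0 := by
          rw [map_sub, inner_sub_left, hg, map_smul, inner_smul_left, hg2]; simp
        rw [h2, Complex.zero_re] at h1
        rw [← norm_eq_zero]; exact pow_eq_zero_iff two_ne_zero |>.1 (le_antisymm h1 (sq_nonneg _))
      rw [sub_eq_zero] at this
      change T (J g) = _
      rw [← hg1, this, map_smul, smul_smul]; simp [hac]
  have hTneg : ∀ a : ℝ, a ≤ 0 → ∀ f, f ∈ weakEigenvectors J P a → f = 0 := by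
    rintro a ha f ⟨g, rfl, hg⟩
    have h1 := hpos g
    rw [hg g, inner_self_eq_norm_sq_to_K] at h1
    have h3 : ‖g‖ ^ 2 ≤ a * ‖J g‖ ^ 2 := by
      refine h1.trans_eq ?_
      simp [← Complex.ofReal_pow]
    have h2 : g = 0 := by
      rw [← norm_eq_zero]
      refine pow_eq_zero_iff two_ne_zero |>.1 (le_antisymm (h3.trans ?_) (sq_nonneg _))
      exact mul_nonpos_of_nonpos_of_nonneg ha (sq_nonneg _)
    simp [h2]
  have hfin : ∀ a : {a : ℝ // 0 < a},
      FiniteDimensional ℂ (End.eigenspace (T : End ℂ H) (((a : ℝ)⁻¹ : ℝ) : ℂ)) := fun a =>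
    ContinuousLinearMap.finite_dimensional_eigenspace hTc _ (by simp [a.2.ne'])
  -- Every positive a is allowed; when a⁻¹ is not an eigenvalue the fibre is `Fin 0`. Thus the fibre
  -- over a has exactly the multiplicity as its cardinality.
  let ι := Σ a : {a : ℝ // 0 < a},
    Fin (finrank ℂ (End.eigenspace (T : End ℂ H) (((a : ℝ)⁻¹ : ℝ) : ℂ)))
  let v : ι → H := fun i => (stdOrthonormalBasis ℂ
    (End.eigenspace (T : End ℂ H) (((i.1 : ℝ)⁻¹ : ℝ) : ℂ)) i.2 : H)
  have hv : Orthonormal ℂ v := by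
    have h1 := (LinearMap.IsSymmetric.orthogonalFamily_eigenspaces hTs).comp
      (f := fun a : {a : ℝ // 0 < a} => (((a : ℝ)⁻¹ : ℝ) : ℂ))
      (fun a b hab => Subtype.ext (inv_injective (Complex.ofReal_injective hab)))
    exact h1.orthonormal_sigma_orthonormal
      (v_family := fun a => stdOrthonormalBasis ℂ _) fun a => (stdOrthonormalBasis ℂ _).orthonormal
  have hcomplete : (Submodule.span ℂ (Set.range v))ᗮ = ⊥ := by
    rw [eq_bot_iff, ← ContinuousLinearMap.orthogonalComplement_iSup_eigenspaces_eq_bot hTc hTs]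
    refine Submodule.orthogonal_le (iSup_le fun κ => ?_)
    by_cases hκ : ∃ a : {a : ℝ // 0 < a}, κ = (((a : ℝ)⁻¹ : ℝ) : ℂ)
    · obtain ⟨a, rfl⟩ := hκ
      intro f hf
      have h1 := (stdOrthonormalBasis ℂ
        (End.eigenspace (T : End ℂ H) (((a : ℝ)⁻¹ : ℝ) : ℂ))).sum_repr ⟨f, hf⟩
      have h2 : _ = f := congrArg Subtype.val h1
      rw [← h2, Submodule.coe_sum]
      refine Submodule.sum_mem _ fun i _ => ?_
      exact Submodule.smul_mem _ _ (Submodule.subset_span ⟨⟨a, i⟩, rfl⟩)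
    · intro f hf
      rw [End.mem_eigenspace_iff] at hf
      have hf' : T f = κ • f := hf
      by_cases hf0 : f = 0
      · simp [hf0]
      exfalso
      have hev : End.HasEigenvalue (T : End ℂ H) κ :=
        End.hasEigenvalue_of_hasEigenvector ⟨End.mem_eigenspace_iff.2 hf, hf0⟩
      have hreal := LinearMap.IsSymmetric.conj_eigenvalue_eq_self hTs hev
      obtain ⟨r, rfl⟩ := Complex.conj_eq_iff_real.1 hreal
      have h1 := (hTpos f).1
      rw [hf', inner_smul_right, inner_self_eq_norm_sq_to_K] at h1
      have h2 : 0 ≤ r * ‖f‖ ^ 2 := by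
        refine h1.trans_eq ?_
        simp [← Complex.ofReal_pow]
      have h3 : 0 ≤ r := nonneg_of_mul_nonneg_left h2 (by positivity)
      have h4 : r ≠ 0 := by
        rintro rfl
        exact hf0 ((hTpos f).2 (by rw [hf']; simp))
      exact hκ ⟨⟨r⁻¹, inv_pos.2 (lt_of_le_of_ne h3 h4.symm)⟩, by simp⟩
  refine ⟨ι, HilbertBasis.mkOfOrthogonalEqBot hv hcomplete, fun i => i.1, fun i => ?_, fun t => ?_⟩
  · rw [HilbertBasis.coe_mkOfOrthogonalEqBot]
    exact (hT0 _ i.1.2 _).1 (Submodule.coe_mem _)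
  · by_cases ht : 0 < t
    · have h1 : weakEigenvectors J P t =
          (End.eigenspace (T : End ℂ H) (((t : ℝ)⁻¹ : ℝ) : ℂ) : Set H) := by
        ext f; exact (hT0 t ht f).symm
      rw [h1, Submodule.span_eq]
      have := hfin ⟨t, ht⟩
      rw [← finrank_eq_rank]
      let eq : {i : ι // (i.1 : ℝ) = t} ≃
          Fin (finrank ℂ (End.eigenspace (T : End ℂ H) (((t : ℝ)⁻¹ : ℝ) : ℂ))) :=
        (Equiv.subtypeEquivRight fun i : ι => (Subtype.ext_iff (a1 := i.1) (a2 := ⟨t, ht⟩)).symm).trans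
          (Equiv.sigmaSubtype (⟨t, ht⟩ : {a : ℝ // 0 < a}))
      rw [Cardinal.mk_congr eq, Cardinal.mk_fin]
    · have h1 : Submodule.span ℂ (weakEigenvectors J P t) = ⊥ := by
        rw [Submodule.span_eq_bot]; exact hTneg t (not_lt.1 ht)
      rw [h1, rank_bot, Cardinal.mk_eq_zero_iff]
      exact ⟨fun i => ht (i.2 ▸ i.1.1.2)⟩

end Spectral
end LogLaplacian

open MeasureTheory Filter Topology Module
open scoped ContDiff ENNReal NNReal ComplexConjugate InnerProductSpace SchwartzMap FourierTransform

namespace LogLaplacian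

/-! ### Square norms as integrals. -/

section LpTwo

variable {α : Type*} [MeasurableSpace α] {μ : Measure α}

theorem lintegral_enorm_sq_eq_eLpNorm_sq (f : α → ℂ) :
    ∫⁻ x, ‖f x‖ₑ ^ 2 ∂μ = eLpNorm f 2 μ ^ 2 := by
  rw [eLpNorm_eq_lintegral_rpow_enorm_toReal two_ne_zero ENNReal.ofNat_ne_top, ← ENNReal.rpow_natCast,
    ← ENNReal.rpow_mul]
  simp

theorem integral_norm_sq_eq_eLpNorm_sq {f : α → ℂ} (hf : AEStronglyMeasurable f μ) :
    ∫ x, ‖f x‖ ^ 2 ∂μ = (eLpNorm f 2 μ).toReal ^ 2 := by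
  rw [integral_eq_lintegral_of_nonneg_ae (f := fun x => ‖f x‖ ^ 2) (ae_of_all _ fun x => by positivity)
    (hf.norm.pow 2), ← ENNReal.toReal_pow, ← lintegral_enorm_sq_eq_eLpNorm_sq]
  congr 1
  refine lintegral_congr fun x => ?_
  rw [ENNReal.ofReal_pow (norm_nonneg _), ofReal_norm]

theorem norm_sq_eq_integral (f : Lp ℂ 2 μ) : ‖f‖ ^ 2 = ∫ x, ‖f x‖ ^ 2 ∂μ := by
  rw [integral_norm_sq_eq_eLpNorm_sq (Lp.aestronglyMeasurable f), Lp.norm_def]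

end LpTwo

/-- The Euclidean space `ℝ^N`. -/
abbrev Space (N : ℕ) : Type := EuclideanSpace ℝ (Fin N)

noncomputable section

/-! ### Plane waves and pointwise control of the Fourier transform. -/

section PlaneWaves

variable {N : ℕ} (Ω : Set (Space N))

theorem continuous_cexp_inner (ξ : Space N) :
    Continuous fun x : Space N => Complex.exp (Complex.I * ((inner ℝ x ξ : ℝ) : ℂ)) := by
  fun_prop

theorem norm_cexp_I_mul_ofReal (r : ℝ) : ‖Complex.exp (Complex.I * (r : ℂ))‖ = 1 := by
  rw [mul_comm]; exact Complex.norm_exp_ofReal_mul_I r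

theorem memLp_planeWave [IsFiniteMeasure (volume.restrict Ω)] (ξ : Space N) :
    MemLp (fun x : Space N => Complex.exp (Complex.I * ((inner ℝ x ξ : ℝ) : ℂ))) 2
      (volume.restrict Ω) :=
  MemLp.of_bound (continuous_cexp_inner ξ).aestronglyMeasurable 1
    (ae_of_all _ fun _ => (norm_cexp_I_mul_ofReal _).le)

/-- The plane wave `x ↦ e^{i x·ξ}` as an element of `L²(Ω)`. -/
def planeWave [IsFiniteMeasure (volume.restrict Ω)] (ξ : Space N) : L2 Ω :=
  (memLp_planeWave Ω ξ).toLp _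

variable {Ω}

theorem fourier_congr {u v : Space N → ℂ} (h : u =ᵐ[volume.restrict Ω] v) (ξ : Space N) :
    fourier Ω u ξ = fourier Ω v ξ :=
  integral_congr_ae (h.mono fun x hx => by simp only [hx])

variable [IsFiniteMeasure (volume.restrict Ω)]

/-- Point evaluation of û is a bounded functional on L²(Ω). Linearity, the uniform bound on û, its
continuity and the later use of Bessel's inequality all come from this. -/
theorem fourier_eq_inner (u : L2 Ω) (ξ : Space N) :
    fourier Ω u ξ = ⟪planeWave Ω ξ, u⟫_ℂ := by
  rw [L2.inner_def]
  refine integral_congr_ae ?_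
  filter_upwards [(memLp_planeWave Ω ξ).coeFn_toLp] with x hx
  rw [planeWave, hx, RCLike.inner_apply, ← Complex.exp_conj]
  simp [mul_comm]

theorem norm_planeWave_sq (ξ : Space N) : ‖planeWave Ω ξ‖ ^ 2 = volume.real Ω := by
  rw [norm_sq_eq_integral]
  have : ∀ᵐ x ∂(volume.restrict Ω), ‖planeWave Ω ξ x‖ ^ 2 = 1 := by
    filter_upwards [(memLp_planeWave Ω ξ).coeFn_toLp] with x hx
    rw [planeWave, hx, norm_cexp_I_mul_ofReal, one_pow]
  rw [integral_congr_ae this]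
  simp

theorem norm_fourier_sq_le (u : L2 Ω) (ξ : Space N) :
    ‖fourier Ω u ξ‖ ^ 2 ≤ volume.real Ω * ‖u‖ ^ 2 := by
  rw [fourier_eq_inner, ← norm_planeWave_sq ξ, ← mul_pow]
  gcongr
  exact norm_inner_le_norm _ _

theorem fourier_add (u v : L2 Ω) (ξ : Space N) :
    fourier Ω (u + v : L2 Ω) ξ = fourier Ω u ξ + fourier Ω v ξ := by
  simp only [fourier_eq_inner, inner_add_right]

theorem fourier_sub (u v : L2 Ω) (ξ : Space N) :
    fourier Ω (u - v : L2 Ω) ξ = fourier Ω u ξ - fourier Ω v ξ := by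
  simp only [fourier_eq_inner, inner_sub_right]

theorem fourier_smul (c : ℂ) (u : L2 Ω) (ξ : Space N) :
    fourier Ω (c • u : L2 Ω) ξ = c * fourier Ω u ξ := by
  simp only [fourier_eq_inner, inner_smul_right]

theorem norm_cexp_sub_le (a b : ℝ) :
    ‖Complex.exp (Complex.I * a) - Complex.exp (Complex.I * b)‖ ≤ |a - b| := by
  have h : Complex.exp (Complex.I * a) - Complex.exp (Complex.I * b) =
      Complex.exp (Complex.I * b) * (Complex.exp (Complex.I * ((a - b : ℝ) : ℂ)) - 1) := by
    rw [mul_sub, ← Complex.exp_add, mul_one]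
    congr 2
    push_cast; ring
  rw [h, norm_mul, norm_cexp_I_mul_ofReal, one_mul]
  exact Real.norm_exp_I_mul_ofReal_sub_one_le

/-- On a bounded set |x| ≤ R, so the phase x·ξ is R-Lipschitz in ξ. Besides continuity of û, this
equicontinuity is what makes the embedding of the form domain compact. -/
theorem exists_norm_planeWave_sub_le (hm : MeasurableSet Ω) (hb : Bornology.IsBounded Ω) :
    ∃ K : ℝ, 0 ≤ K ∧ ∀ ξ η : Space N, ‖planeWave Ω ξ - planeWave Ω η‖ ≤ K * ‖ξ - η‖ := by
  obtain ⟨R, hR0, hR⟩ := hb.exists_pos_norm_le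
  refine ⟨R * Real.sqrt (volume.real Ω), by positivity, fun ξ η => ?_⟩
  refine le_of_sq_le_sq ?_ (by positivity)
  rw [norm_sq_eq_integral]
  have h1 : ∀ᵐ x ∂(volume.restrict Ω),
      ‖(planeWave Ω ξ - planeWave Ω η : L2 Ω) x‖ ^ 2 ≤ (R * ‖ξ - η‖) ^ 2 := by
    filter_upwards [(memLp_planeWave Ω ξ).coeFn_toLp, (memLp_planeWave Ω η).coeFn_toLp,
      Lp.coeFn_sub (planeWave Ω ξ) (planeWave Ω η), ae_restrict_mem hm] with x h1 h2 h3 hx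
    rw [h3, Pi.sub_apply, planeWave, planeWave, h1, h2]
    gcongr
    refine (norm_cexp_sub_le _ _).trans ?_
    rw [← inner_sub_right]
    refine (abs_real_inner_le_norm _ _).trans ?_
    gcongr
    exact hR x hx
  have hi : Integrable (fun x => ‖(planeWave Ω ξ - planeWave Ω η : L2 Ω) x‖ ^ 2)
      (volume.restrict Ω) :=
    (memLp_two_iff_integrable_sq_norm (Lp.aestronglyMeasurable _)).1 (Lp.memLp _)
  calc _ ≤ ∫ _ in Ω, (R * ‖ξ - η‖) ^ 2 := integral_mono_ae hi (integrable_const _) h1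
    _ = _ := by
      rw [integral_const, mul_pow, mul_pow, mul_pow, Real.sq_sqrt (by positivity)]
      simp; ring

theorem continuous_planeWave (hm : MeasurableSet Ω) (hb : Bornology.IsBounded Ω) :
    Continuous (planeWave Ω) := by
  obtain ⟨K, hK0, hK⟩ := exists_norm_planeWave_sub_le hm hb
  refine (LipschitzWith.of_dist_le_mul (K := ⟨K, hK0⟩) fun ξ η => ?_).continuous
  rw [dist_eq_norm, dist_eq_norm]; exact hK ξ η

theorem continuous_fourier (hm : MeasurableSet Ω) (hb : Bornology.IsBounded Ω) (u : L2 Ω) :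
    Continuous (fourier Ω u) := by
  have : fourier Ω u = fun ξ => ⟪planeWave Ω ξ, u⟫_ℂ := funext (fourier_eq_inner u)
  rw [this]
  exact (continuous_planeWave hm hb).inner continuous_const

end PlaneWaves

/-! ### The normalized measure on frequency space. -/

section FrequencyMeasure

/-- The measure `(2π)^{-N} dξ` on frequency space. -/
def freqMeasure (N : ℕ) : Measure (Space N) :=
  ENNReal.ofReal (((2 * Real.pi) ^ N)⁻¹) • volume

instance (N : ℕ) : (freqMeasure N).IsAddHaarMeasure :=
  Measure.IsAddHaarMeasure.smul _ (by simp; positivity) ENNReal.ofReal_ne_top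

theorem integral_freqMeasure {N : ℕ} {F : Type*} [NormedAddCommGroup F] [NormedSpace ℝ F]
    (f : Space N → F) :
    ∫ ξ, f ξ ∂freqMeasure N = ((2 * Real.pi) ^ N)⁻¹ • ∫ ξ, f ξ := by
  rw [freqMeasure, integral_smul_measure, ENNReal.toReal_ofReal (by positivity)]

theorem form_eq {N m : ℕ} {Ω : Set (Space N)} (u v : L2 Ω) :
    form m Ω u v = ∫ ξ, (((2 * Real.log ‖ξ‖) ^ m : ℝ) : ℂ) * fourier Ω u ξ *
      conj (fourier Ω v ξ) ∂freqMeasure N := by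
  rw [integral_freqMeasure, form, Complex.real_smul]

end FrequencyMeasure

/-! ### Test functions: Plancherel and density. -/

section TestFunctions

variable {N : ℕ} {Ω : Set (Space N)}

theorem IsTestFunction.eq_zero {φ : Space N → ℂ} (hφ : IsTestFunction Ω φ) {x : Space N}
    (hx : x ∉ Ω) : φ x = 0 :=
  image_eq_zero_of_notMem_tsupport fun h => hx (hφ.2.2 h)

theorem IsTestFunction.memLp {φ : Space N → ℂ} (hφ : IsTestFunction Ω φ) (μ : Measure (Space N))
    [IsFiniteMeasureOnCompacts μ] : MemLp φ 2 μ :=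
  hφ.1.continuous.memLp_of_hasCompactSupport hφ.2.1

/-- The Fourier transform of a test function is a Schwartz function, and Plancherel's identity
holds for it. -/
theorem IsTestFunction.exists_schwartz {φ : Space N → ℂ} (hφ : IsTestFunction Ω φ) :
    ∃ g : 𝓢(Space N, ℂ), (∀ ξ, fourier Ω φ ξ = g ξ) ∧
      ∫ ξ, ‖g ξ‖ ^ 2 ∂freqMeasure N = ∫ x, ‖φ x‖ ^ 2 := by
  have hpi : (2 * Real.pi)⁻¹ ≠ 0 := by positivity
  let f : 𝓢(Space N, ℂ) := hφ.2.1.toSchwartzMap hφ.1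
  -- Mathlib's transform has kernel e^(-2πi x·ξ); the dilation by 1/(2π) gives e^(-i x·ξ), and its
  -- Jacobian cancels the factor in `freqMeasure`.
  let g : 𝓢(Space N, ℂ) := SchwartzMap.compCLMOfContinuousLinearEquiv ℝ
    (ContinuousLinearEquiv.smulLeft (Units.mk0 _ hpi)) (𝓕 f)
  have hg : ∀ ξ, g ξ = 𝓕 f ((2 * Real.pi)⁻¹ • ξ) := fun ξ => rfl
  refine ⟨g, fun ξ => ?_, ?_⟩
  · rw [hg, SchwartzMap.fourier_coe, Real.fourier_eq', fourier,
      setIntegral_eq_integral_of_forall_compl_eq_zero fun x hx => by rw [hφ.eq_zero hx, mul_zero]]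
    refine integral_congr_ae (ae_of_all _ fun x => ?_)
    simp only [smul_eq_mul, real_inner_smul_right]
    change _ = _ * φ x
    congr 2
    push_cast
    field_simp
  · simp_rw [hg]
    rw [integral_freqMeasure, Measure.integral_comp_smul volume (fun ξ => ‖𝓕 f ξ‖ ^ 2),
      SchwartzMap.integral_norm_sq_fourier, smul_smul]
    change _ • ∫ x, ‖φ x‖ ^ 2 = _
    rw [finrank_euclideanSpace, Fintype.card_fin, inv_pow, inv_inv, abs_of_pos (by positivity),
      inv_mul_cancel₀ (by positivity), one_smul]

/-- The subspace of `L²(Ω)` given by the test functions. -/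
def testSubmodule (Ω : Set (Space N)) : Submodule ℂ (L2 Ω) where
  carrier := {u | ∃ φ, IsTestFunction Ω φ ∧ u =ᵐ[volume.restrict Ω] φ}
  add_mem' := by
    rintro u v ⟨φ, hφ, hu⟩ ⟨ψ, hψ, hv⟩
    refine ⟨φ + ψ, ⟨hφ.1.add hψ.1, hφ.2.1.add hψ.2.1, ?_⟩, (Lp.coeFn_add u v).trans (hu.add hv)⟩
    exact (tsupport_add φ ψ).trans (Set.union_subset hφ.2.2 hψ.2.2)
  zero_mem' := ⟨0, ⟨contDiff_const, HasCompactSupport.zero, by simp [tsupport]⟩, Lp.coeFn_zero _ _ _⟩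
  smul_mem' := by
    rintro c u ⟨φ, hφ, hu⟩
    refine ⟨c • φ, ⟨hφ.1.const_smul c, hφ.2.1.mono' ?_, ?_⟩,
      (Lp.coeFn_smul c u).trans (hu.const_smul c)⟩
    · exact (Function.support_const_smul_subset c φ).trans (subset_tsupport φ)
    · exact (closure_mono (Function.support_const_smul_subset c φ)).trans hφ.2.2

theorem IsTestFunction.toLp_mem {φ : Space N → ℂ} (hφ : IsTestFunction Ω φ) :
    (hφ.memLp (volume.restrict Ω)).toLp φ ∈ testSubmodule Ω :=
  ⟨φ, hφ, MemLp.coeFn_toLp _⟩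

/-- The fundamental lemma of the calculus of variations, applied with real test functions.
Equivalently, test functions are dense in L²(Ω). -/
theorem eq_zero_of_forall_inner_testSubmodule (hΩ : IsOpen Ω)
    (f : L2 Ω) (h : ∀ u ∈ testSubmodule Ω, ⟪u, f⟫_ℂ = 0) : f = 0 := by
  have hloc : LocallyIntegrableOn (f : Space N → ℂ) Ω volume := by
    intro x hx
    obtain ⟨r, hr, hrΩ⟩ := Metric.isOpen_iff.1 hΩ x hx
    refine ⟨Metric.ball x r, mem_nhdsWithin_of_mem_nhds (Metric.ball_mem_nhds x hr), ?_⟩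
    have : MemLp f 2 (volume.restrict (Metric.ball x r)) :=
      (Lp.memLp f).mono_measure (Measure.restrict_mono hrΩ le_rfl)
    have hfin : IsFiniteMeasure (volume.restrict (Metric.ball x r)) :=
      ⟨by simpa using measure_ball_lt_top⟩
    exact this.integrable one_le_two
  have h0 := hΩ.ae_eq_zero_of_integral_contDiff_smul_eq_zero hloc fun g hg hgc hgs => by
    have hφ : IsTestFunction Ω (fun x => (g x : ℂ)) :=
      ⟨Complex.ofRealCLM.contDiff.comp hg, hgc.comp_left Complex.ofReal_zero,
        (closure_mono (Function.support_comp_subset Complex.ofReal_zero g)).trans hgs⟩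
    have h1 := h _ hφ.toLp_mem
    rw [L2.inner_def] at h1
    rw [← setIntegral_eq_integral_of_forall_compl_eq_zero (s := Ω), ← h1]
    · refine integral_congr_ae ?_
      filter_upwards [(hφ.memLp (volume.restrict Ω)).coeFn_toLp] with x hx
      rw [hx, RCLike.inner_apply]
      simp [mul_comm]
    · intro x hx
      have := hφ.eq_zero hx
      simp only [Complex.ofReal_eq_zero] at this
      simp [this]
  rw [Lp.eq_zero_iff_ae_eq_zero]
  exact (ae_restrict_iff' hΩ.measurableSet).2 h0

theorem testSubmodule_topologicalClosure (hΩ : IsOpen Ω) :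
    (testSubmodule Ω).topologicalClosure = ⊤ := by
  rw [Submodule.topologicalClosure_eq_top_iff, Submodule.eq_bot_iff]
  exact fun f hf => eq_zero_of_forall_inner_testSubmodule hΩ f hf

end TestFunctions

end

end LogLaplacian

open MeasureTheory Filter Topology Module
open scoped ContDiff ENNReal NNReal ComplexConjugate InnerProductSpace SchwartzMap FourierTransform

namespace LogLaplacian

/-! ### The variational principle. -/

section Variational

variable {V H : Type} [NormedAddCommGroup V] [InnerProductSpace ℂ V]
  [NormedAddCommGroup H] [InnerProductSpace ℂ H]

/-- The energy of a vector dominates the energy of its components along weak eigenvectors. -/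
theorem sum_weakEigenvalue_mul_le {ι : Type} {e : ι → H} (he : Orthonormal ℂ e) {a : ι → ℝ}
    {J : V →L[ℂ] H} {P : V →L[ℂ] V} (hea : ∀ i, e i ∈ weakEigenvectors J P (a i))
    (hsymm : ∀ g h, ⟪P g, h⟫_ℂ = ⟪g, P h⟫_ℂ) (hpos : ∀ g, 0 ≤ (⟪P g, g⟫_ℂ).re)
    (g : V) (s : Finset ι) :
    ∑ i ∈ s, a i * ‖⟪e i, J g⟫_ℂ‖ ^ 2 ≤ (⟪P g, g⟫_ℂ).re := by
  classical
  choose G hG hGa using hea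
  set c : ι → ℂ := fun i => ⟪e i, J g⟫_ℂ
  -- A lift to the form domain of the projection of `J g` onto the span of the chosen eigenvectors.
  set y : V := ∑ i ∈ s, c i • G i with hy
  have hPy : ∀ h, ⟪P y, h⟫_ℂ = ∑ i ∈ s, conj (c i) * (a i * ⟪e i, J h⟫_ℂ) := fun h => by
    rw [hy, map_sum, sum_inner]
    refine Finset.sum_congr rfl fun i _ => ?_
    rw [map_smul, inner_smul_left, hGa, hG]
  have hterm : ∀ i, conj (c i) * (a i * c i) = ((a i * ‖c i‖ ^ 2 : ℝ) : ℂ) := fun i => by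
    rw [mul_left_comm, Complex.conj_mul']; push_cast; ring
  have h1 : ⟪P y, g⟫_ℂ = ((∑ i ∈ s, a i * ‖c i‖ ^ 2 : ℝ) : ℂ) := by
    rw [hPy, Complex.ofReal_sum]
    exact Finset.sum_congr rfl fun i _ => hterm i
  have hJy : ∀ i ∈ s, ⟪e i, J y⟫_ℂ = c i := fun i hi => by
    rw [hy, map_sum]
    simp_rw [map_smul, hG]
    exact he.inner_right_sum c hi
  have h2 : ⟪P y, y⟫_ℂ = ((∑ i ∈ s, a i * ‖c i‖ ^ 2 : ℝ) : ℂ) := by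
    rw [hPy, Complex.ofReal_sum]
    exact Finset.sum_congr rfl fun i hi => by rw [hJy i hi, hterm i]
  have h3 : ⟪P g, y⟫_ℂ = ((∑ i ∈ s, a i * ‖c i‖ ^ 2 : ℝ) : ℂ) := by
    rw [hsymm, ← inner_conj_symm, h1, Complex.conj_ofReal]
  -- With S the sum in question, the energy of g - y is that of g minus 2S plus S.
  have h4 := hpos (g - y)
  rw [map_sub, inner_sub_left, inner_sub_right, inner_sub_right, h1, h2, h3] at h4
  simp only [Complex.sub_re, Complex.ofReal_re] at h4
  linarith

/-- Parseval for ‖J g‖² and the energy bound above, on finite sums `G` containing `s`. Indices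
outside `s` have t - a_i ≤ 0, so discarding them only increases the right side; `s` may exceed the
sublevel set. -/
theorem sub_le_sum_weakEigenvectors {ι : Type} (e : HilbertBasis ι ℂ H) {a : ι → ℝ}
    {J : V →L[ℂ] H} {P : V →L[ℂ] V} (hea : ∀ i, e i ∈ weakEigenvectors J P (a i))
    (hsymm : ∀ g h, ⟪P g, h⟫_ℂ = ⟪g, P h⟫_ℂ) (hpos : ∀ g, 0 ≤ (⟪P g, g⟫_ℂ).re)
    (g : V) (t : ℝ) (s : Finset ι) (hs : ∀ i, a i < t → i ∈ s) :
    t * ‖J g‖ ^ 2 - (⟪P g, g⟫_ℂ).re ≤ ∑ i ∈ s, (t - a i) * ‖⟪e i, J g⟫_ℂ‖ ^ 2 := by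
  have hsum : HasSum (fun i => ‖⟪e i, J g⟫_ℂ‖ ^ 2) (‖J g‖ ^ 2) := by
    have h := Complex.hasSum_re (e.hasSum_inner_mul_inner (J g) (J g))
    convert! h using 1
    · ext i
      rw [← inner_conj_symm (J g) (e i), Complex.conj_mul', ← Complex.ofReal_pow, Complex.ofReal_re]
    · rw [inner_self_eq_norm_sq_to_K]
      simp [← Complex.ofReal_pow]
  classical
  have hlim : Tendsto (fun G : Finset ι => ∑ i ∈ G, t * ‖⟪e i, J g⟫_ℂ‖ ^ 2) atTop
      (𝓝 (t * ‖J g‖ ^ 2)) := by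
    simpa [HasSum] using! hsum.mul_left t
  refine le_of_tendsto (hlim.sub_const _) ?_
  filter_upwards [eventually_ge_atTop s] with G hG
  have h1 := sum_weakEigenvalue_mul_le e.orthonormal hea hsymm hpos g G
  have h2 : ∑ i ∈ G, (t - a i) * ‖⟪e i, J g⟫_ℂ‖ ^ 2 ≤ ∑ i ∈ s, (t - a i) * ‖⟪e i, J g⟫_ℂ‖ ^ 2 := by
    rw [← Finset.sum_sdiff hG]
    refine add_le_of_nonpos_left (Finset.sum_nonpos fun i hi => ?_)
    have hi := (Finset.mem_sdiff.1 hi).2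
    exact mul_nonpos_of_nonpos_of_nonneg (by linarith [not_lt.1 (mt (hs i) hi)]) (sq_nonneg _)
  simp only [sub_mul, Finset.sum_sub_distrib] at h2
  simp only [sub_mul, Finset.sum_sub_distrib]
  linarith

end Variational
end LogLaplacian

open MeasureTheory Filter Topology Module
open scoped ContDiff ENNReal NNReal ComplexConjugate InnerProductSpace SchwartzMap FourierTransform

namespace LogLaplacian

noncomputable section

/-! ### Plancherel's identity on L²(Ω). -/

section Plancherel

variable {N : ℕ} {Ω : Set (Space N)}

theorem eLpNorm_eq_enorm_of_integral_eq {α β : Type*} [MeasurableSpace α] [MeasurableSpace β]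
    {μ : Measure α} {κ : Measure β} {f : α → ℂ} {g : β → ℂ} (hf : MemLp f 2 μ) (hg : MemLp g 2 κ)
    (h : ∫ x, ‖f x‖ ^ 2 ∂μ = ∫ x, ‖g x‖ ^ 2 ∂κ) : eLpNorm f 2 μ = eLpNorm g 2 κ := by
  rw [integral_norm_sq_eq_eLpNorm_sq hf.1, integral_norm_sq_eq_eLpNorm_sq hg.1] at h
  have := (pow_left_inj₀ ENNReal.toReal_nonneg ENNReal.toReal_nonneg two_ne_zero).1 h
  exact (ENNReal.toReal_eq_toReal_iff' hf.2.ne hg.2.ne).1 this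

theorem eLpNorm_fourier_of_mem_testSubmodule {u : L2 Ω} (hu : u ∈ testSubmodule Ω) :
    eLpNorm (fourier Ω u) 2 (freqMeasure N) = ‖u‖ₑ := by
  obtain ⟨φ, hφ, huφ⟩ := hu
  obtain ⟨g, hg, hgi⟩ := hφ.exists_schwartz
  have h1 : fourier Ω u = g := funext fun ξ => by rw [fourier_congr huφ, hg]
  rw [h1, Lp.enorm_def]
  refine eLpNorm_eq_enorm_of_integral_eq (g.memLp 2 _) (Lp.memLp u) (hgi.trans ?_)
  rw [← setIntegral_eq_integral_of_forall_compl_eq_zero (s := Ω)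
    fun x hx => by simp [hφ.eq_zero hx]]
  refine integral_congr_ae ?_
  filter_upwards [huφ] with x hx
  rw [hx]

theorem mem_closure_testSubmodule (hΩ : IsOpen Ω) (u : L2 Ω) :
    u ∈ closure (testSubmodule Ω : Set (L2 Ω)) := by
  have : u ∈ (testSubmodule Ω).topologicalClosure := by
    rw [testSubmodule_topologicalClosure hΩ]; trivial
  exact this

variable [IsFiniteMeasure (volume.restrict Ω)]

theorem tendsto_fourier {u : ℕ → L2 Ω} {v : L2 Ω} (h : Tendsto u atTop (𝓝 v)) (ξ : Space N) :
    Tendsto (fun n => fourier Ω (u n) ξ) atTop (𝓝 (fourier Ω v ξ)) := by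
  simp only [fourier_eq_inner]
  exact tendsto_const_nhds.inner h

/-- Fatou's lemma along approximating test functions: L² convergence in Ω gives convergence of û at
every frequency. -/
theorem eLpNorm_fourier_le (hΩ : IsOpen Ω) (hb : Bornology.IsBounded Ω) (u : L2 Ω) :
    eLpNorm (fourier Ω u) 2 (freqMeasure N) ≤ ‖u‖ₑ := by
  obtain ⟨v, hv, hvu⟩ := mem_closure_iff_seq_limit.1 (mem_closure_testSubmodule hΩ u)
  have h1 := Lp.eLpNorm_lim_le_liminf_eLpNorm (p := 2) (μ := freqMeasure N)
    (f := fun n => fourier Ω (v n))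
    (fun n => (continuous_fourier hΩ.measurableSet hb (v n)).aestronglyMeasurable) (fourier Ω u)
    (ae_of_all _ fun ξ => tendsto_fourier hvu ξ)
  refine h1.trans_eq ?_
  simp_rw [eLpNorm_fourier_of_mem_testSubmodule (hv _)]
  exact hvu.enorm.liminf_eq

theorem memLp_fourier (hΩ : IsOpen Ω) (hb : Bornology.IsBounded Ω) (u : L2 Ω) :
    MemLp (fourier Ω u) 2 (freqMeasure N) :=
  ⟨(continuous_fourier hΩ.measurableSet hb u).aestronglyMeasurable,
    (eLpNorm_fourier_le hΩ hb u).trans_lt enorm_lt_top⟩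

/-- Plancherel's identity in `L²(Ω)`. -/
theorem eLpNorm_fourier (hΩ : IsOpen Ω) (hb : Bornology.IsBounded Ω) (u : L2 Ω) :
    eLpNorm (fourier Ω u) 2 (freqMeasure N) = ‖u‖ₑ := by
  obtain ⟨v, hv, hvu⟩ := mem_closure_iff_seq_limit.1 (mem_closure_testSubmodule hΩ u)
  refine le_antisymm (eLpNorm_fourier_le hΩ hb u) ?_
  have h1 : ∀ n, ‖v n‖ₑ ≤ eLpNorm (fourier Ω u) 2 (freqMeasure N) + ‖v n - u‖ₑ := fun n => by
    rw [← eLpNorm_fourier_of_mem_testSubmodule (hv n)]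
    have h2 : fourier Ω (v n) = fourier Ω u + fourier Ω (v n - u : L2 Ω) :=
      funext fun ξ => by rw [Pi.add_apply, fourier_sub]; ring
    rw [h2]
    refine (eLpNorm_add_le (memLp_fourier hΩ hb _).1 (memLp_fourier hΩ hb _).1 one_le_two).trans ?_
    gcongr
    exact eLpNorm_fourier_le hΩ hb _
  have h3 : Tendsto (fun n => ‖v n - u‖ₑ) atTop (𝓝 0) := by
    simpa using (hvu.sub_const u).enorm
  refine le_of_tendsto_of_tendsto' hvu.enorm ?_ h1
  simpa using h3.const_add (eLpNorm (fourier Ω u) 2 (freqMeasure N))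

theorem integral_norm_fourier_sq (hΩ : IsOpen Ω) (hb : Bornology.IsBounded Ω) (u : L2 Ω) :
    ∫ ξ, ‖fourier Ω u ξ‖ ^ 2 ∂freqMeasure N = ‖u‖ ^ 2 := by
  rw [integral_norm_sq_eq_eLpNorm_sq (memLp_fourier hΩ hb u).1, eLpNorm_fourier hΩ hb, toReal_enorm]

theorem integrable_norm_fourier_sq (hΩ : IsOpen Ω) (hb : Bornology.IsBounded Ω) (u : L2 Ω) :
    Integrable (fun ξ => ‖fourier Ω u ξ‖ ^ 2) (freqMeasure N) :=
  (memLp_two_iff_integrable_sq_norm (memLp_fourier hΩ hb u).1).1 (memLp_fourier hΩ hb u)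

/-- The graph of the Fourier transform followed by multiplication by a fixed function is closed. -/
theorem ae_eq_mul_fourier_of_tendsto {σ : Space N → ℂ} {u : ℕ → L2 Ω} {v : L2 Ω}
    {g : ℕ → Lp ℂ 2 (freqMeasure N)} {f : Lp ℂ 2 (freqMeasure N)} (hu : Tendsto u atTop (𝓝 v))
    (hg : Tendsto g atTop (𝓝 f))
    (h : ∀ n, g n =ᵐ[freqMeasure N] fun ξ => σ ξ * fourier Ω (u n) ξ) :
    f =ᵐ[freqMeasure N] fun ξ => σ ξ * fourier Ω v ξ := by
  obtain ⟨ns, hns, hae⟩ := (tendstoInMeasure_of_tendsto_Lp hg).exists_seq_tendsto_ae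
  filter_upwards [hae, ae_all_iff.2 h] with ξ h1 h2
  refine tendsto_nhds_unique h1 ?_
  simp_rw [h2]
  exact ((tendsto_fourier hu ξ).comp hns.tendsto_atTop).const_mul (σ ξ)

end Plancherel

/-! ### Splitting the symbol, and comparison with the weight of the norm. -/

section Symbol

variable {N : ℕ}

open Real in
/-- The nonnegative part `(2 log⁺ |ξ|)^m` of the symbol, which agrees with it for `|ξ| ≥ 1`. -/
def posSymbol (m : ℕ) (ξ : Space N) : ℝ := (2 * log⁺ ‖ξ‖) ^ m

/-- The symbol `(2 log |ξ|)^m`. -/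
def symbol (m : ℕ) (ξ : Space N) : ℝ := (2 * Real.log ‖ξ‖) ^ m

/-- The part of the symbol that is supported in the unit ball. -/
def remSymbol (m : ℕ) (ξ : Space N) : ℝ := symbol m ξ - posSymbol m ξ

theorem posSymbol_nonneg (m : ℕ) (ξ : Space N) : 0 ≤ posSymbol m ξ :=
  pow_nonneg (mul_nonneg zero_le_two Real.posLog_nonneg) m

theorem continuous_posSymbol (m : ℕ) : Continuous (posSymbol m : Space N → ℝ) := by
  unfold posSymbol
  exact (continuous_const.mul (Real.continuous_posLog.comp continuous_norm)).pow m

theorem measurable_symbol (m : ℕ) : Measurable (symbol m : Space N → ℝ) := by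
  unfold symbol
  fun_prop

theorem posSymbol_of_one_le {m : ℕ} {ξ : Space N} (hξ : 1 ≤ ‖ξ‖) :
    posSymbol m ξ = (2 * Real.log ‖ξ‖) ^ m := by
  rw [posSymbol, Real.posLog_eq_log (by rwa [abs_norm])]

theorem posSymbol_of_le_one {m : ℕ} (hm : m ≠ 0) {ξ : Space N} (hξ : ‖ξ‖ ≤ 1) :
    posSymbol m ξ = 0 := by
  rw [posSymbol, (Real.posLog_eq_zero_iff _).2 (by rwa [abs_norm]), mul_zero, zero_pow hm]

theorem remSymbol_of_one_le {m : ℕ} {ξ : Space N} (hξ : 1 ≤ ‖ξ‖) : remSymbol m ξ = 0 := by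
  rw [remSymbol, posSymbol_of_one_le hξ, symbol, sub_self]

/-- The bound |log r| ≤ 2m r^(-1/(2m)), raised to the power m. The resulting exponent -1/2 is
integrable at 0 already in dimension one. -/
theorem abs_two_mul_log_pow_le {m : ℕ} (hm : m ≠ 0) {r : ℝ} (hr : 0 < r) (hr1 : r ≤ 1) :
    |(2 * Real.log r) ^ m| ≤ (4 * m) ^ m * r ^ (-(1 / 2) : ℝ) := by
  have hm0 : (0 : ℝ) < m := by positivity
  have h1 := (Real.abs_log_mul_self_rpow_lt r (1 / (2 * m)) hr hr1 (by positivity)).le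
  rw [abs_mul, abs_of_pos (Real.rpow_pos_of_pos hr _), one_div_one_div] at h1
  have h2 : |Real.log r| ≤ 2 * m * r ^ (-(1 / (2 * m)) : ℝ) := by
    rw [Real.rpow_neg hr.le, ← div_eq_mul_inv, le_div_iff₀ (Real.rpow_pos_of_pos hr _)]
    exact h1
  calc |(2 * Real.log r) ^ m| = (2 * |Real.log r|) ^ m := by rw [abs_pow, abs_mul, abs_two]
    _ ≤ (2 * (2 * m * r ^ (-(1 / (2 * m)) : ℝ))) ^ m := by gcongr
    _ = (4 * m) ^ m * (r ^ (-(1 / (2 * m)) : ℝ)) ^ m := by rw [← mul_pow]; ring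
    _ = _ := by
      rw [← Real.rpow_mul_natCast hr.le]
      congr 2
      field_simp

theorem integrable_remSymbol (hN : 1 ≤ N) {m : ℕ} (hm : m ≠ 0) :
    Integrable (remSymbol m : Space N → ℝ) (freqMeasure N) := by
  have : Nonempty (Fin N) := ⟨⟨0, hN⟩⟩
  have hI : IntegrableOn (fun ξ : Space N => (2 * Real.log ‖ξ‖) ^ m) (Metric.ball 0 1)
      (freqMeasure N) := by
    refine (integrableOn_fun_norm_addHaar (freqMeasure N) (f := fun r => (2 * Real.log r) ^ m)).2 ?_
    have hd : IntegrableOn (fun r : ℝ => (4 * m) ^ m * r ^ (-(1 / 2) : ℝ)) (Set.Ioo 0 1) :=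
      ((intervalIntegral.integrableOn_Ioo_rpow_iff one_pos).2 (by norm_num)).const_mul _
    refine hd.mono' (by fun_prop) ?_
    refine (ae_restrict_iff' measurableSet_Ioo).2 (ae_of_all _ fun r hr => ?_)
    rw [smul_eq_mul, norm_mul, Real.norm_eq_abs, Real.norm_eq_abs]
    -- The polar weight r^(N-1) is at most 1 on (0, 1).
    refine (mul_le_of_le_one_left (abs_nonneg _) ?_).trans
      (abs_two_mul_log_pow_le hm hr.1 hr.2.le)
    rw [abs_of_nonneg (pow_nonneg hr.1.le _)]
    exact pow_le_one₀ hr.1.le hr.2.le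
  have h2 : IntegrableOn (remSymbol m : Space N → ℝ) (Metric.ball 0 1) (freqMeasure N) := by
    refine hI.congr_fun (fun ξ hξ => ?_) Metric.isOpen_ball.measurableSet
    rw [remSymbol, posSymbol_of_le_one hm (by simpa using (Metric.mem_ball.1 hξ).le), sub_zero,
      symbol]
  refine (integrableOn_iff_integrable_of_support_subset fun ξ hξ => ?_).1 h2
  by_contra h
  refine hξ (remSymbol_of_one_le ?_)
  simpa using h

theorem log_exp_one_add_le {r : ℝ} (hr : 0 ≤ r) : Real.log (Real.exp 1 + r) ≤ 2 + Real.posLog r := by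
  have h1 : Real.exp 1 + r ≤ Real.exp 2 * max 1 r := by
    have he : Real.exp 2 = Real.exp 1 * Real.exp 1 := by rw [← Real.exp_add]; norm_num
    have h2 : 2 ≤ Real.exp 1 := by linarith [Real.add_one_le_exp 1]
    have h3 : Real.exp 1 + 1 ≤ Real.exp 2 := by rw [he]; nlinarith
    calc Real.exp 1 + r ≤ Real.exp 1 * max 1 r + 1 * max 1 r := by
          gcongr
          · exact le_mul_of_one_le_right (by positivity) (le_max_left _ _)
          · rw [one_mul]; exact le_max_right _ _
      _ = (Real.exp 1 + 1) * max 1 r := by ring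
      _ ≤ _ := by gcongr
  refine (Real.log_le_log (by positivity) h1).trans ?_
  rw [Real.log_mul (by positivity) (by positivity), Real.log_exp, Real.posLog_eq_log_max_one hr]

theorem posLog_le_log_exp_one_add {r : ℝ} (hr : 0 ≤ r) :
    Real.posLog r ≤ Real.log (Real.exp 1 + r) := by
  rw [Real.posLog_eq_log_max_one hr]
  refine Real.log_le_log (by positivity) (max_le ?_ (by linarith [Real.exp_pos 1]))
  linarith [Real.add_one_le_exp 1]

theorem one_le_log_exp_one_add {r : ℝ} (hr : 0 ≤ r) : 1 ≤ Real.log (Real.exp 1 + r) := by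
  rw [Real.le_log_iff_exp_le (by positivity)]; linarith

/-- With `posSymbol_le_log_pow`, this shows that the weights log(e + |ξ|)^m and 1 + `posSymbol` are
comparable. By Plancherel ‖·‖_m is then equivalent to a graph norm. -/
theorem log_pow_le_posSymbol (m : ℕ) (ξ : Space N) :
    Real.log (Real.exp 1 + ‖ξ‖) ^ m ≤ 4 ^ m * (1 + posSymbol m ξ) := by
  have hL : 0 ≤ Real.posLog ‖ξ‖ := Real.posLog_nonneg
  have h0 : 0 ≤ Real.log (Real.exp 1 + ‖ξ‖) := zero_le_one.trans (one_le_log_exp_one_add (norm_nonneg _))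
  calc _ ≤ (2 + Real.posLog ‖ξ‖) ^ m := by gcongr; exact log_exp_one_add_le (norm_nonneg _)
    _ ≤ 2 ^ (m - 1) * (2 ^ m + Real.posLog ‖ξ‖ ^ m) := add_pow_le zero_le_two hL m
    _ ≤ 2 ^ m * (2 ^ m + (2 ^ m * 2 ^ m) * Real.posLog ‖ξ‖ ^ m) := by
      have h2 : (1 : ℝ) ≤ 2 ^ m := one_le_pow₀ one_le_two
      gcongr
      · exact one_le_two
      · omega
      · exact le_mul_of_one_le_left (by positivity) (one_le_mul_of_one_le_of_one_le h2 h2)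
    _ = _ := by
      have : (4 : ℝ) ^ m = 2 ^ m * 2 ^ m := by rw [← mul_pow]; norm_num
      rw [posSymbol, mul_pow, this]; ring

theorem posSymbol_le_log_pow (m : ℕ) (ξ : Space N) :
    1 + posSymbol m ξ ≤ (1 + 2 ^ m) * Real.log (Real.exp 1 + ‖ξ‖) ^ m := by
  have hL : 0 ≤ Real.posLog ‖ξ‖ := Real.posLog_nonneg
  rw [posSymbol, mul_pow, add_mul, one_mul]
  gcongr
  · exact one_le_pow₀ (one_le_log_exp_one_add (norm_nonneg _))
  · exact posLog_le_log_exp_one_add (norm_nonneg _)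

theorem posLog_le_self {r : ℝ} (hr : 0 ≤ r) : Real.posLog r ≤ r :=
  max_le hr (Real.log_le_self hr)

/-- Schwartz functions are square integrable with any polynomial weight. -/
theorem integrable_one_add_norm_pow_mul_sq (g : 𝓢(Space N, ℂ)) (k : ℕ) :
    Integrable (fun ξ => (1 + ‖ξ‖) ^ k * ‖g ξ‖ ^ 2) (freqMeasure N) := by
  obtain ⟨C, hC⟩ : ∃ C, ∀ ξ, ‖g ξ‖ ≤ C := ⟨_, fun ξ => g.norm_le_seminorm ℝ ξ⟩
  have h1 : Integrable (fun ξ => 2 ^ (k - 1) * (1 ^ k * ‖g ξ‖ + ‖ξ‖ ^ k * ‖g ξ‖) * C)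
      (freqMeasure N) :=
    ((((g.integrable.norm).const_mul _).add (g.integrable_pow_mul _ k)).const_mul _).mul_const _
  refine h1.mono' ?_ (ae_of_all _ fun ξ => ?_)
  · exact (((continuous_const.add continuous_norm).pow k).mul
      (g.continuous.norm.pow 2)).aestronglyMeasurable
  · rw [Real.norm_of_nonneg (by positivity), sq, ← mul_assoc]
    refine mul_le_mul ?_ (hC ξ) (norm_nonneg _) (by positivity)
    rw [← add_mul, ← mul_assoc]
    gcongr
    exact add_pow_le zero_le_one (norm_nonneg _) k

theorem posSymbol_le_pow (m : ℕ) (ξ : Space N) : posSymbol m ξ ≤ 2 ^ m * (1 + ‖ξ‖) ^ m := by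
  rw [posSymbol, mul_pow]
  have hL : 0 ≤ Real.posLog ‖ξ‖ := Real.posLog_nonneg
  gcongr
  linarith [posLog_le_self (norm_nonneg ξ)]

theorem integrable_posSymbol_mul_schwartz_sq (g : 𝓢(Space N, ℂ)) (m : ℕ) :
    Integrable (fun ξ => posSymbol m ξ * ‖g ξ‖ ^ 2) (freqMeasure N) := by
  refine ((integrable_one_add_norm_pow_mul_sq g m).const_mul (2 ^ m)).mono' ?_
    (ae_of_all _ fun ξ => ?_)
  · exact ((continuous_posSymbol m).mul (g.continuous.norm.pow 2)).aestronglyMeasurable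
  · rw [Real.norm_of_nonneg (mul_nonneg (posSymbol_nonneg m ξ) (by positivity)), ← mul_assoc]
    gcongr
    exact posSymbol_le_pow m ξ

end Symbol

end
end LogLaplacian

open MeasureTheory Filter Topology Module
open scoped ContDiff ENNReal NNReal ComplexConjugate InnerProductSpace SchwartzMap FourierTransform

namespace LogLaplacian

noncomputable section

/-! ### The form domain as a Hilbert space. -/

section FormSpace

variable {N : ℕ} {Ω : Set (Space N)}

/-- The product of `√(posSymbol)` with the Fourier transform. -/
def weightedFourier (m : ℕ) (Ω : Set (Space N)) (u : Space N → ℂ) (ξ : Space N) : ℂ :=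
  (Real.sqrt (posSymbol m ξ) : ℂ) * fourier Ω u ξ

theorem norm_weightedFourier_sq (m : ℕ) (u : Space N → ℂ) (ξ : Space N) :
    ‖weightedFourier m Ω u ξ‖ ^ 2 = posSymbol m ξ * ‖fourier Ω u ξ‖ ^ 2 := by
  rw [weightedFourier, norm_mul, mul_pow, Complex.norm_of_nonneg (Real.sqrt_nonneg _),
    Real.sq_sqrt (posSymbol_nonneg m ξ)]

theorem weightedFourier_congr {m : ℕ} {u v : Space N → ℂ} (h : u =ᵐ[volume.restrict Ω] v) :
    weightedFourier m Ω u = weightedFourier m Ω v :=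
  funext fun ξ => by rw [weightedFourier, weightedFourier, fourier_congr h]

theorem IsTestFunction.memLp_weightedFourier {φ : Space N → ℂ} (hφ : IsTestFunction Ω φ) (m : ℕ) :
    MemLp (weightedFourier m Ω φ) 2 (freqMeasure N) := by
  obtain ⟨g, hg, -⟩ := hφ.exists_schwartz
  have h1 : weightedFourier m Ω φ = fun ξ => (Real.sqrt (posSymbol m ξ) : ℂ) * g ξ :=
    funext fun ξ => by rw [weightedFourier, hg]
  have h2 : Continuous (weightedFourier m Ω φ) := by
    rw [h1]
    exact (Complex.continuous_ofReal.comp (continuous_posSymbol m).sqrt).mul g.continuous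
  rw [memLp_two_iff_integrable_sq_norm h2.aestronglyMeasurable]
  simp_rw [norm_weightedFourier_sq, hg]
  exact integrable_posSymbol_mul_schwartz_sq g m

/-- The ambient Hilbert space of the graph of `u ↦ √(posSymbol) û`. -/
abbrev GraphSpace (Ω : Set (Space N)) : Type := WithLp 2 (L2 Ω × Lp ℂ 2 (freqMeasure N))

theorem enorm_sq_graphSpace (x : GraphSpace Ω) : ‖x‖ₑ ^ 2 = ‖x.fst‖ₑ ^ 2 + ‖x.snd‖ₑ ^ 2 := by
  simp only [← ofReal_norm, ← ENNReal.ofReal_pow (norm_nonneg _)]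
  rw [← ENNReal.ofReal_add (by positivity) (by positivity), WithLp.prod_norm_sq_eq_of_L2]

theorem lintegral_eq_freqMeasure (f : Space N → ℝ≥0∞) :
    ∫⁻ ξ, f ξ = ENNReal.ofReal ((2 * Real.pi) ^ N) * ∫⁻ ξ, f ξ ∂freqMeasure N := by
  rw [freqMeasure, lintegral_smul_measure, smul_eq_mul, ← mul_assoc,
    ← ENNReal.ofReal_mul (by positivity), mul_inv_cancel₀ (by positivity), ENNReal.ofReal_one,
    one_mul]

theorem normSq_le (m : ℕ) (u : Space N → ℂ) :
    normSq m Ω u ≤ ENNReal.ofReal ((2 * Real.pi) ^ N * 4 ^ m) *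
      ∫⁻ ξ, ENNReal.ofReal ((1 + posSymbol m ξ) * ‖fourier Ω u ξ‖ ^ 2) ∂freqMeasure N := by
  rw [normSq, lintegral_eq_freqMeasure, ENNReal.ofReal_mul (by positivity), mul_assoc,
    ← lintegral_const_mul' (ENNReal.ofReal (4 ^ m)) _ ENNReal.ofReal_ne_top]
  refine mul_le_mul' le_rfl (lintegral_mono fun ξ => ?_)
  rw [← ENNReal.ofReal_mul (by positivity), ← mul_assoc]
  gcongr
  exact log_pow_le_posSymbol m ξ

theorem le_normSq (m : ℕ) (u : Space N → ℂ) :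
    ∫⁻ ξ, ENNReal.ofReal ((1 + posSymbol m ξ) * ‖fourier Ω u ξ‖ ^ 2) ∂freqMeasure N ≤
      ENNReal.ofReal (((2 * Real.pi) ^ N)⁻¹ * (1 + 2 ^ m)) * normSq m Ω u := by
  have h1 : normSq m Ω u = _ := lintegral_eq_freqMeasure _
  rw [h1, ← mul_assoc, ← ENNReal.ofReal_mul (by positivity),
    show ((2 * Real.pi) ^ N)⁻¹ * (1 + 2 ^ m) * (2 * Real.pi) ^ N = 1 + 2 ^ m by field_simp,
    ← lintegral_const_mul' _ _ ENNReal.ofReal_ne_top]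
  gcongr with ξ
  rw [← ENNReal.ofReal_mul (by positivity), ← mul_assoc]
  gcongr
  exact posSymbol_le_log_pow m ξ

theorem fourier_sub_of_ae_eq {u w : L2 Ω} {φ : Space N → ℂ} (h : w =ᵐ[volume.restrict Ω] φ) :
    fourier Ω (fun x => u x - φ x) = fourier Ω (u - w : L2 Ω) := by
  funext ξ
  refine fourier_congr ?_ ξ
  filter_upwards [h, Lp.coeFn_sub u w] with x h1 h2
  rw [h2, Pi.sub_apply, h1]

theorem normSq_sub_of_ae_eq {m : ℕ} {u w : L2 Ω} {φ : Space N → ℂ}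
    (h : w =ᵐ[volume.restrict Ω] φ) :
    normSq m Ω (fun x => u x - φ x) = normSq m Ω (u - w : L2 Ω) := by
  simp only [normSq, fourier_sub_of_ae_eq h]

variable [IsFiniteMeasure (volume.restrict Ω)]

theorem continuous_weightedFourier (m : ℕ) (hΩ : IsOpen Ω) (hb : Bornology.IsBounded Ω) (u : L2 Ω) :
    Continuous (weightedFourier m Ω u) :=
  (Complex.continuous_ofReal.comp (continuous_posSymbol m).sqrt).mul
    (continuous_fourier hΩ.measurableSet hb u)

theorem weightedFourier_add (m : ℕ) (u v : L2 Ω) (ξ : Space N) :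
    weightedFourier m Ω (u + v : L2 Ω) ξ = weightedFourier m Ω u ξ + weightedFourier m Ω v ξ := by
  rw [weightedFourier, fourier_add, mul_add]; rfl

theorem weightedFourier_sub (m : ℕ) (u v : L2 Ω) (ξ : Space N) :
    weightedFourier m Ω (u - v : L2 Ω) ξ = weightedFourier m Ω u ξ - weightedFourier m Ω v ξ := by
  rw [weightedFourier, fourier_sub, mul_sub]; rfl

theorem weightedFourier_smul (m : ℕ) (c : ℂ) (u : L2 Ω) (ξ : Space N) :
    weightedFourier m Ω (c • u : L2 Ω) ξ = c * weightedFourier m Ω u ξ := by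
  rw [weightedFourier, fourier_smul, mul_left_comm]; rfl

/-- The graph of `u ↦ √(posSymbol) û` over the test functions. -/
def graphSubmodule (m : ℕ) (Ω : Set (Space N)) [IsFiniteMeasure (volume.restrict Ω)] :
    Submodule ℂ (GraphSpace Ω) where
  carrier := {x | x.fst ∈ testSubmodule Ω ∧
    x.snd =ᵐ[freqMeasure N] weightedFourier m Ω x.fst}
  add_mem' := by
    rintro x y ⟨hx, hx'⟩ ⟨hy, hy'⟩
    refine ⟨(testSubmodule Ω).add_mem hx hy, ?_⟩
    filter_upwards [hx', hy', Lp.coeFn_add x.snd y.snd] with ξ h1 h2 h3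
    rw [WithLp.add_snd, WithLp.add_fst, h3, Pi.add_apply, h1, h2, weightedFourier_add]
  zero_mem' := by
    refine ⟨(testSubmodule Ω).zero_mem, ?_⟩
    have h0 : ∀ ξ, weightedFourier m Ω ((0 : L2 Ω) : Space N → ℂ) ξ = 0 := fun ξ => by
      rw [weightedFourier, fourier_eq_inner, inner_zero_right, mul_zero]
    filter_upwards [Lp.coeFn_zero ℂ 2 (freqMeasure N)] with ξ h
    rw [WithLp.zero_snd, WithLp.zero_fst, h, h0]; rfl
  smul_mem' := by
    rintro c x ⟨hx, hx'⟩
    refine ⟨(testSubmodule Ω).smul_mem c hx, ?_⟩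
    filter_upwards [hx', Lp.coeFn_smul c x.snd] with ξ h1 h2
    rw [WithLp.smul_snd, WithLp.smul_fst, h2, Pi.smul_apply, h1, weightedFourier_smul, smul_eq_mul]

/-- The form domain with its Hilbert space structure, realized as a closed graph. -/
def formSpace (m : ℕ) (Ω : Set (Space N)) [IsFiniteMeasure (volume.restrict Ω)] :
    Submodule ℂ (GraphSpace Ω) :=
  (graphSubmodule m Ω).topologicalClosure

instance (m : ℕ) : CompleteSpace (formSpace m Ω) :=
  (Submodule.isClosed_topologicalClosure _).completeSpace_coe

instance (m : ℕ) : Inner ℂ (formSpace m Ω) := InnerProductSpace.toInner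

/-- The closure of the graph is again a graph: first components converge in L²(Ω), hence û converges
pointwise, while second components converge almost everywhere along a subsequence. -/
theorem snd_ae_eq_of_mem_formSpace {m : ℕ} {x : GraphSpace Ω} (hx : x ∈ formSpace m Ω) :
    x.snd =ᵐ[freqMeasure N] weightedFourier m Ω x.fst := by
  obtain ⟨y, hy, hyx⟩ := mem_closure_iff_seq_limit.1 hx
  exact ae_eq_mul_fourier_of_tendsto (σ := fun ξ => (Real.sqrt (posSymbol m ξ) : ℂ))
    (((WithLp.fstL 2 ℂ (L2 Ω) (Lp ℂ 2 (freqMeasure N))).continuous.tendsto x).comp hyx)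
    (((WithLp.sndL 2 ℂ (L2 Ω) (Lp ℂ 2 (freqMeasure N))).continuous.tendsto x).comp hyx)
    fun n => (hy n).2

theorem lintegral_one_add_posSymbol (hΩ : IsOpen Ω) (hb : Bornology.IsBounded Ω) (m : ℕ)
    (u : L2 Ω) :
    ∫⁻ ξ, ENNReal.ofReal ((1 + posSymbol m ξ) * ‖fourier Ω u ξ‖ ^ 2) ∂freqMeasure N =
      ‖u‖ₑ ^ 2 + eLpNorm (weightedFourier m Ω u) 2 (freqMeasure N) ^ 2 := by
  rw [← eLpNorm_fourier hΩ hb, ← lintegral_enorm_sq_eq_eLpNorm_sq,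
    ← lintegral_enorm_sq_eq_eLpNorm_sq, ← lintegral_add_left]
  · refine lintegral_congr fun ξ => ?_
    rw [add_mul, one_mul, ENNReal.ofReal_add (by positivity)
      (mul_nonneg (posSymbol_nonneg m ξ) (by positivity)), ← norm_weightedFourier_sq,
      ENNReal.ofReal_pow (norm_nonneg _), ENNReal.ofReal_pow (norm_nonneg _), ofReal_norm,
      ofReal_norm]
  · exact (continuous_fourier hΩ.measurableSet hb u).measurable.enorm.pow_const 2

theorem enorm_sq_of_snd_ae_eq (hΩ : IsOpen Ω) (hb : Bornology.IsBounded Ω) {m : ℕ}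
    {x : GraphSpace Ω} (hx : x.snd =ᵐ[freqMeasure N] weightedFourier m Ω x.fst) :
    ∫⁻ ξ, ENNReal.ofReal ((1 + posSymbol m ξ) * ‖fourier Ω x.fst ξ‖ ^ 2) ∂freqMeasure N =
      ‖x‖ₑ ^ 2 := by
  rw [lintegral_one_add_posSymbol hΩ hb, enorm_sq_graphSpace, Lp.enorm_def x.snd,
    eLpNorm_congr_ae hx]

theorem fst_mem_formDomain (hΩ : IsOpen Ω) (hb : Bornology.IsBounded Ω) {m : ℕ} {x : GraphSpace Ω}
    (hx : x ∈ formSpace m Ω) : x.fst ∈ formDomain m Ω := by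
  intro ε hε
  obtain ⟨y, hy, hyx⟩ := mem_closure_iff_seq_limit.1 hx
  have hlim : Tendsto (fun n => ENNReal.ofReal ((2 * Real.pi) ^ N * 4 ^ m) * ‖x - y n‖ₑ ^ 2) atTop
      (𝓝 0) := by
    have h1 : Tendsto (fun n => ‖x - y n‖ₑ) atTop (𝓝 0) := by
      simpa using (hyx.const_sub x).enorm
    have h2 := ENNReal.Tendsto.const_mul (ENNReal.Tendsto.pow (n := 2) h1)
      (Or.inr (ENNReal.ofReal_ne_top (r := (2 * Real.pi) ^ N * 4 ^ m)))
    simpa using h2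
  obtain ⟨n, hn⟩ := (hlim.eventually_lt_const hε).exists
  obtain ⟨⟨φ, hφ, hyφ⟩, -⟩ := hy n
  refine ⟨φ, hφ, lt_of_le_of_lt ?_ hn⟩
  have hsub : x - y n ∈ formSpace m Ω :=
    (formSpace m Ω).sub_mem hx ((graphSubmodule m Ω).le_topologicalClosure (hy n))
  rw [normSq_sub_of_ae_eq hyφ, ← enorm_sq_of_snd_ae_eq hΩ hb (snd_ae_eq_of_mem_formSpace hsub)]
  exact normSq_le m _

/-- With `fst_mem_formDomain`, this identifies the form domain with the first components of the
closed graph. -/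
theorem exists_mem_formSpace (hΩ : IsOpen Ω) (hb : Bornology.IsBounded Ω) {m : ℕ} {u : L2 Ω}
    (hu : u ∈ formDomain m Ω) : ∃ x ∈ formSpace m Ω, x.fst = u := by
  set C : ℝ≥0∞ := ENNReal.ofReal (((2 * Real.pi) ^ N)⁻¹ * (1 + 2 ^ m)) with hC
  have hC0 : C ≠ 0 := by rw [hC]; simp; positivity
  -- Finite energy of u: it lies at finite distance from a single test function, which has finite
  -- energy.
  have hmem : MemLp (weightedFourier m Ω u) 2 (freqMeasure N) := by
    obtain ⟨φ, hφ, hlt⟩ := hu 1 one_pos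
    set w : L2 Ω := (hφ.memLp (volume.restrict Ω)).toLp φ
    have hw : w =ᵐ[volume.restrict Ω] φ := MemLp.coeFn_toLp _
    have h1 : MemLp (weightedFourier m Ω (u - w : L2 Ω)) 2 (freqMeasure N) := by
      refine ⟨(continuous_weightedFourier m hΩ hb _).aestronglyMeasurable, ?_⟩
      have h2 : eLpNorm (weightedFourier m Ω (u - w : L2 Ω)) 2 (freqMeasure N) ^ 2 < ⊤ := by
        rw [normSq_sub_of_ae_eq hw] at hlt
        refine (le_add_self.trans_eq (lintegral_one_add_posSymbol hΩ hb m (u - w)).symm).trans_lt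
          ((le_normSq m _).trans_lt ?_)
        exact ENNReal.mul_lt_top ENNReal.ofReal_lt_top (hlt.trans ENNReal.one_lt_top)
      exact (ENNReal.pow_lt_top_iff.1 h2).resolve_right two_ne_zero
    have h3 : weightedFourier m Ω u =
        weightedFourier m Ω (u - w : L2 Ω) + weightedFourier m Ω φ := by
      rw [← weightedFourier_congr hw]
      funext ξ
      rw [Pi.add_apply, weightedFourier_sub, sub_add_cancel]
    rw [h3]
    exact h1.add (hφ.memLp_weightedFourier m)
  refine ⟨WithLp.toLp 2 (u, hmem.toLp _), ?_, rfl⟩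
  refine EMetric.mem_closure_iff.2 fun ε hε => ?_
  -- The tolerance ε²/C compensates for the constant in `le_normSq`.
  obtain ⟨φ, hφ, hlt⟩ := hu (ε ^ 2 / C) (ENNReal.div_pos (by positivity) ENNReal.ofReal_ne_top)
  set w : L2 Ω := (hφ.memLp (volume.restrict Ω)).toLp φ
  have hw : w =ᵐ[volume.restrict Ω] φ := MemLp.coeFn_toLp _
  have hg : MemLp (weightedFourier m Ω w) 2 (freqMeasure N) := by
    rw [weightedFourier_congr hw]; exact hφ.memLp_weightedFourier m
  refine ⟨WithLp.toLp 2 (w, hg.toLp _), ⟨hφ.toLp_mem, hg.coeFn_toLp⟩, ?_⟩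
  rw [edist_eq_enorm_sub]
  refine lt_of_not_ge fun hle => (pow_le_pow_left' hle 2).not_gt ?_
  have hsnd : (WithLp.toLp 2 (u, hmem.toLp _) - WithLp.toLp 2 (w, hg.toLp _) : GraphSpace Ω).snd
      =ᵐ[freqMeasure N] weightedFourier m Ω
        (WithLp.toLp 2 (u, hmem.toLp _) - WithLp.toLp 2 (w, hg.toLp _) : GraphSpace Ω).fst := by
    change (hmem.toLp _ - hg.toLp _ : Lp ℂ 2 (freqMeasure N)) =ᵐ[freqMeasure N]
      weightedFourier m Ω (u - w : L2 Ω)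
    filter_upwards [Lp.coeFn_sub (hmem.toLp _) (hg.toLp _), hmem.coeFn_toLp, hg.coeFn_toLp]
      with ξ h1 h2 h3
    rw [h1, Pi.sub_apply, h2, h3, weightedFourier_sub]
  rw [← enorm_sq_of_snd_ae_eq hΩ hb hsnd]
  refine (le_normSq m _).trans_lt ?_
  change C * normSq m Ω (u - w : L2 Ω) < _
  rw [← normSq_sub_of_ae_eq hw, mul_comm]
  exact (ENNReal.lt_div_iff_mul_lt (Or.inl hC0) (Or.inl ENNReal.ofReal_ne_top)).1 hlt

theorem IsTestFunction.mem_formDomain {φ : Space N → ℂ} (hφ : IsTestFunction Ω φ) (m : ℕ) :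
    (hφ.memLp (volume.restrict Ω)).toLp φ ∈ formDomain m Ω := by
  intro ε hε
  refine ⟨φ, hφ, lt_of_eq_of_lt ?_ hε⟩
  have h0 : ∀ ξ, fourier Ω ((0 : L2 Ω) : Space N → ℂ) ξ = 0 := fun ξ => by
    rw [fourier_eq_inner, inner_zero_right]
  rw [normSq_sub_of_ae_eq (hφ.memLp (volume.restrict Ω)).coeFn_toLp, sub_self]
  simp only [normSq, h0]
  simp

end FormSpace

end
end LogLaplacian

open MeasureTheory Filter Topology Module
open scoped ContDiff ENNReal NNReal ComplexConjugate InnerProductSpace SchwartzMap FourierTransform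

namespace LogLaplacian

noncomputable section

/-! ### Coercivity, compact embedding and the eigenbasis. -/

section Operators

variable {N : ℕ} {Ω : Set (Space N)} [IsFiniteMeasure (volume.restrict Ω)]

theorem norm_fourier_mul_le (u v : L2 Ω) (ξ : Space N) :
    ‖conj (fourier Ω u ξ) * fourier Ω v ξ‖ ≤ volume.real Ω * ‖u‖ * ‖v‖ := by
  rw [norm_mul, RCLike.norm_conj, fourier_eq_inner, fourier_eq_inner, ← norm_planeWave_sq ξ, sq]
  calc _ ≤ (‖planeWave Ω ξ‖ * ‖u‖) * (‖planeWave Ω ξ‖ * ‖v‖) := by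
        gcongr <;> exact norm_inner_le_norm _ _
    _ = _ := by ring

theorem integrable_remSymbol_mul (hΩ : IsOpen Ω) (hb : Bornology.IsBounded Ω) (hN : 1 ≤ N) {m : ℕ}
    (hm : m ≠ 0) (u v : L2 Ω) :
    Integrable (fun ξ => (remSymbol m ξ : ℂ) * (conj (fourier Ω u ξ) * fourier Ω v ξ))
      (freqMeasure N) := by
  refine (integrable_remSymbol hN hm).ofReal.mul_bdd (c := volume.real Ω * ‖u‖ * ‖v‖) ?_
    (ae_of_all _ fun ξ => norm_fourier_mul_le u v ξ)
  exact ((Complex.continuous_conj.comp (continuous_fourier hΩ.measurableSet hb u)).mul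
    (continuous_fourier hΩ.measurableSet hb v)).aestronglyMeasurable

/-- A bound for the contribution of low frequencies to the form. -/
def remBound (m : ℕ) (Ω : Set (Space N)) : ℝ :=
  volume.real Ω * ∫ ξ, |remSymbol m ξ| ∂freqMeasure N

theorem norm_integral_remSymbol_le (hN : 1 ≤ N) {m : ℕ} (hm : m ≠ 0) (u v : L2 Ω) :
    ‖∫ ξ, (remSymbol m ξ : ℂ) * (conj (fourier Ω u ξ) * fourier Ω v ξ) ∂freqMeasure N‖ ≤
      remBound m Ω * ‖u‖ * ‖v‖ := by
  refine (norm_integral_le_of_norm_le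
    (((integrable_remSymbol hN hm).abs).mul_const (volume.real Ω * ‖u‖ * ‖v‖))
    (ae_of_all _ fun ξ => ?_)).trans_eq ?_
  · rw [norm_mul, Complex.norm_real, Real.norm_eq_abs]
    gcongr
    exact norm_fourier_mul_le u v ξ
  · rw [integral_mul_const, remBound]; ring

theorem exists_remOperator (hΩ : IsOpen Ω) (hb : Bornology.IsBounded Ω) (hN : 1 ≤ N) {m : ℕ}
    (hm : m ≠ 0) :
    ∃ B : L2 Ω →L[ℂ] L2 Ω, ∀ u v : L2 Ω, ⟪B u, v⟫_ℂ =
      ∫ ξ, (remSymbol m ξ : ℂ) * (conj (fourier Ω u ξ) * fourier Ω v ξ) ∂freqMeasure N := by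
  have hi := fun u v => integrable_remSymbol_mul hΩ hb hN hm (Ω := Ω) u v
  let β : L2 Ω →ₗ⋆[ℂ] L2 Ω →ₗ[ℂ] ℂ := LinearMap.mk₂'ₛₗ (starRingEnd ℂ) (RingHom.id ℂ)
    (fun u v : L2 Ω =>
      ∫ ξ, (remSymbol m ξ : ℂ) * (conj (fourier Ω u ξ) * fourier Ω v ξ) ∂freqMeasure N)
    (fun u u' v => by
      rw [← integral_add (hi u v) (hi u' v)]
      congr 1; funext ξ; rw [fourier_add, map_add]; ring)
    (fun c u v => by
      rw [smul_eq_mul, ← integral_const_mul]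
      congr 1; funext ξ; rw [fourier_smul, map_mul]; ring)
    (fun u v v' => by
      rw [← integral_add (hi u v) (hi u v')]
      congr 1; funext ξ; rw [fourier_add]; ring)
    (fun c u v => by
      rw [RingHom.id_apply, smul_eq_mul, ← integral_const_mul]
      congr 1; funext ξ; rw [fourier_smul]; ring)
  refine ⟨InnerProductSpace.continuousLinearMapOfBilin
    (β.mkContinuous₂ (remBound m Ω) fun u v => norm_integral_remSymbol_le hN hm u v), fun u v => ?_⟩
  rw [InnerProductSpace.continuousLinearMapOfBilin_apply]
  rfl

/-- The inclusion of the form domain into `L²(Ω)`. -/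
def formInclusion (m : ℕ) (Ω : Set (Space N)) [IsFiniteMeasure (volume.restrict Ω)] :
    formSpace m Ω →L[ℂ] L2 Ω :=
  (WithLp.fstL 2 ℂ (L2 Ω) (Lp ℂ 2 (freqMeasure N))).comp (formSpace m Ω).subtypeL

theorem formInclusion_apply {m : ℕ} (x : formSpace m Ω) :
    formInclusion m Ω x = (x : GraphSpace Ω).fst := rfl

theorem posSymbol_mul_ae_eq {m : ℕ} (x y : formSpace m Ω) :
    (fun ξ => ⟪(x : GraphSpace Ω).snd ξ, (y : GraphSpace Ω).snd ξ⟫_ℂ) =ᵐ[freqMeasure N]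
      fun ξ => (posSymbol m ξ : ℂ) *
        (conj (fourier Ω (formInclusion m Ω x) ξ) * fourier Ω (formInclusion m Ω y) ξ) := by
  filter_upwards [snd_ae_eq_of_mem_formSpace x.2, snd_ae_eq_of_mem_formSpace y.2] with ξ h1 h2
  have hs : (Real.sqrt (posSymbol m ξ) : ℂ) * Real.sqrt (posSymbol m ξ) = posSymbol m ξ := by
    rw [← Complex.ofReal_mul, Real.mul_self_sqrt (posSymbol_nonneg m ξ)]
  rw [h1, h2, RCLike.inner_apply, weightedFourier, weightedFourier, map_mul, Complex.conj_ofReal,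
    ← hs, formInclusion_apply, formInclusion_apply]
  ring

theorem integrable_posSymbol_mul {m : ℕ} (x y : formSpace m Ω) :
    Integrable (fun ξ => (posSymbol m ξ : ℂ) *
      (conj (fourier Ω (formInclusion m Ω x) ξ) * fourier Ω (formInclusion m Ω y) ξ))
      (freqMeasure N) :=
  (L2.integrable_inner _ _).congr (posSymbol_mul_ae_eq x y)

theorem symbol_mul_eq (m : ℕ) (a b : ℂ) (ξ : Space N) :
    (((2 * Real.log ‖ξ‖) ^ m : ℝ) : ℂ) * a * b =
      (posSymbol m ξ : ℂ) * (b * a) + (remSymbol m ξ : ℂ) * (b * a) := by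
  rw [remSymbol, symbol]; push_cast; ring

/-- The arguments are swapped because `form` is linear in its first slot, whereas the inner product
is linear in its second. -/
theorem form_formInclusion (hΩ : IsOpen Ω) (hb : Bornology.IsBounded Ω) (hN : 1 ≤ N) {m : ℕ}
    (hm : m ≠ 0) (x y : formSpace m Ω) :
    form m Ω (formInclusion m Ω y) (formInclusion m Ω x) =
      ⟪(x : GraphSpace Ω).snd, (y : GraphSpace Ω).snd⟫_ℂ +
      ∫ ξ, (remSymbol m ξ : ℂ) * (conj (fourier Ω (formInclusion m Ω x) ξ) *
        fourier Ω (formInclusion m Ω y) ξ) ∂freqMeasure N := by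
  rw [form_eq, L2.inner_def, integral_congr_ae (posSymbol_mul_ae_eq x y),
    ← integral_add (integrable_posSymbol_mul x y) (integrable_remSymbol_mul hΩ hb hN hm _ _)]
  exact integral_congr_ae (ae_of_all _ fun ξ => symbol_mul_eq m _ _ ξ)

/-- With B the operator of the low frequency form and c = `remBound`, take P = 1 + J*(c + B)J. The
identity supplies the graph inner product, whose L² part accounts for the 1 in the shift, and c
outweighs any negative part of B. -/
theorem exists_formOperator (hΩ : IsOpen Ω) (hb : Bornology.IsBounded Ω) (hN : 1 ≤ N) {m : ℕ}
    (hm : m ≠ 0) :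
    ∃ P : formSpace m Ω →L[ℂ] formSpace m Ω, (∀ x y, ⟪P x, y⟫_ℂ = ⟪x, P y⟫_ℂ) ∧
      (∀ x, ‖x‖ ^ 2 ≤ (⟪P x, x⟫_ℂ).re) ∧
      ∀ x y, ⟪P x, y⟫_ℂ = form m Ω (formInclusion m Ω y) (formInclusion m Ω x) +
        (1 + remBound m Ω : ℝ) * ⟪formInclusion m Ω x, formInclusion m Ω y⟫_ℂ := by
  obtain ⟨B, hB⟩ := exists_remOperator hΩ hb hN hm
  set J := formInclusion m Ω
  set c := remBound m Ω
  let P : formSpace m Ω →L[ℂ] formSpace m Ω :=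
    ContinuousLinearMap.id ℂ _ + (ContinuousLinearMap.adjoint J ∘L
      (((c : ℂ) • ContinuousLinearMap.id ℂ (L2 Ω)) + B)) ∘L J
  have hP : ∀ x y, ⟪P x, y⟫_ℂ = ⟪x, y⟫_ℂ + (c * ⟪J x, J y⟫_ℂ + ⟪B (J x), J y⟫_ℂ) := by
    intro x y
    change ⟪x + ContinuousLinearMap.adjoint J ((c : ℂ) • J x + B (J x)), y⟫_ℂ = _
    rw [inner_add_left, ContinuousLinearMap.adjoint_inner_left, inner_add_left, inner_smul_left,
      Complex.conj_ofReal]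
  have hBs : ∀ u v : L2 Ω, conj ⟪B u, v⟫_ℂ = ⟪B v, u⟫_ℂ := fun u v => by
    rw [hB, hB, ← integral_conj]
    congr 1; funext ξ
    simp only [map_mul, Complex.conj_ofReal, Complex.conj_conj]
    ring
  refine ⟨P, fun x y => ?_, fun x => ?_, fun x y => ?_⟩
  · rw [← inner_conj_symm x, hP, hP]
    have h0 : conj ⟪y, x⟫_ℂ = ⟪x, y⟫_ℂ := inner_conj_symm _ _
    simp only [map_add, map_mul, hBs, h0, inner_conj_symm, Complex.conj_ofReal]
  · have h0 : ⟪x, x⟫_ℂ = ((‖x‖ ^ 2 : ℝ) : ℂ) := by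
      rw [Complex.ofReal_pow]; exact inner_self_eq_norm_sq_to_K x
    rw [hP, h0, inner_self_eq_norm_sq_to_K]
    have h1 : -(c * ‖J x‖ * ‖J x‖) ≤ (⟪B (J x), J x⟫_ℂ).re := by
      have h2 := norm_integral_remSymbol_le (Ω := Ω) hN hm (J x) (J x)
      rw [← hB] at h2
      exact (abs_le.1 ((Complex.abs_re_le_norm _).trans h2)).1
    simp only [Complex.add_re]
    have h3 : ((c : ℂ) * (‖J x‖ : ℂ) ^ 2).re = c * ‖J x‖ * ‖J x‖ := by
      simp [← Complex.ofReal_pow]; ring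
    rw [Complex.ofReal_re]
    have h4 := h3.symm.le
    simp only [Complex.coe_algebraMap] at h4 ⊢
    linarith
  · rw [hP, hB, form_formInclusion hΩ hb hN hm]
    have h5 : ⟪x, y⟫_ℂ = ⟪J x, J y⟫_ℂ + ⟪(x : GraphSpace Ω).snd, (y : GraphSpace Ω).snd⟫_ℂ := rfl
    rw [h5]; push_cast; ring

/-- Plancherel split at |ξ| = R: a sup bound on the ball, and division by the weight, which is at
least (2 log R)^m, outside it. -/
theorem norm_fst_sq_le (hΩ : IsOpen Ω) (hb : Bornology.IsBounded Ω) {m : ℕ} (x : formSpace m Ω)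
    {R σ : ℝ} (hR : 1 < R)
    (hσ : ∀ ξ : Space N, ‖ξ‖ ≤ R → ‖fourier Ω (formInclusion m Ω x) ξ‖ ≤ σ) :
    ‖formInclusion m Ω x‖ ^ 2 ≤ (freqMeasure N).real (Metric.closedBall 0 R) * σ ^ 2 +
      ((2 * Real.log R) ^ m)⁻¹ * ‖x‖ ^ 2 := by
  have hA : 0 < (2 * Real.log R) ^ m := by have := Real.log_pos hR; positivity
  have hW : Integrable (fun ξ => posSymbol m ξ * ‖fourier Ω (formInclusion m Ω x) ξ‖ ^ 2)
      (freqMeasure N) := by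
    refine (((Lp.memLp (x : GraphSpace Ω).snd).integrable_norm_pow two_ne_zero).congr ?_)
    filter_upwards [snd_ae_eq_of_mem_formSpace x.2] with ξ h1
    rw [h1, norm_weightedFourier_sq]; rfl
  have hWx : ∫ ξ, posSymbol m ξ * ‖fourier Ω (formInclusion m Ω x) ξ‖ ^ 2 ∂freqMeasure N ≤
      ‖x‖ ^ 2 := by
    have h1 : ‖x‖ ^ 2 = ‖formInclusion m Ω x‖ ^ 2 + ‖(x : GraphSpace Ω).snd‖ ^ 2 :=
      WithLp.prod_norm_sq_eq_of_L2 _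
    have h2 : ‖(x : GraphSpace Ω).snd‖ ^ 2 =
        ∫ ξ, posSymbol m ξ * ‖fourier Ω (formInclusion m Ω x) ξ‖ ^ 2 ∂freqMeasure N := by
      rw [norm_sq_eq_integral]
      refine integral_congr_ae ?_
      filter_upwards [snd_ae_eq_of_mem_formSpace x.2] with ξ h1
      rw [h1, norm_weightedFourier_sq]; rfl
    rw [h1, ← h2]
    exact le_add_of_nonneg_left (sq_nonneg _)
  have hind : Integrable ((Metric.closedBall (0 : Space N) R).indicator fun _ => σ ^ 2)
      (freqMeasure N) :=
    (integrable_indicator_iff Metric.isClosed_closedBall.measurableSet).2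
      (integrableOn_const measure_closedBall_lt_top.ne)
  rw [← integral_norm_fourier_sq hΩ hb]
  calc _ ≤ ∫ ξ, ((Metric.closedBall (0 : Space N) R).indicator (fun _ => σ ^ 2) ξ +
        ((2 * Real.log R) ^ m)⁻¹ * (posSymbol m ξ * ‖fourier Ω (formInclusion m Ω x) ξ‖ ^ 2))
        ∂freqMeasure N := by
        refine integral_mono (integrable_norm_fourier_sq hΩ hb _) (hind.add (hW.const_mul _))
          fun ξ => ?_
        have hW0 := posSymbol_nonneg m ξ
        by_cases hξ : ‖ξ‖ ≤ R
        · have : ξ ∈ Metric.closedBall (0 : Space N) R := by simpa using hξ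
          simp only [Set.indicator_of_mem this]
          refine le_add_of_le_of_nonneg ?_ (by positivity)
          exact pow_le_pow_left₀ (norm_nonneg _) (hσ ξ hξ) 2
        · have hnot : ξ ∉ Metric.closedBall (0 : Space N) R := by simpa using hξ
          have hξ' := not_le.1 hξ
          simp only [Set.indicator_of_notMem hnot, zero_add]
          rw [← mul_assoc]
          refine le_mul_of_one_le_left (by positivity) ?_
          rw [inv_mul_eq_div, one_le_div hA, posSymbol_of_one_le (hR.le.trans hξ'.le)]
          have := Real.log_pos hR
          gcongr
    _ ≤ _ := by
        rw [integral_add hind (hW.const_mul _), integral_const_mul,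
          integral_indicator Metric.isClosed_closedBall.measurableSet, setIntegral_const, smul_eq_mul]
        gcongr

/-- On the unit ball of the form domain, high frequencies are uniformly small. Low ones are
controlled by the values of û on a finite net, since û is equicontinuous, and these values range
over a bounded subset of a finite-dimensional space. -/
theorem isCompactOperator_formInclusion (hΩ : IsOpen Ω) (hb : Bornology.IsBounded Ω) {m : ℕ}
    (hm : m ≠ 0) : IsCompactOperator (formInclusion m Ω) := by
  refine (isCompactOperator_iff_isCompact_closure_image_closedBall
    (formInclusion m Ω).toLinearMap (r := 1) one_pos).2 ?_
  refine (TotallyBounded.closure ?_).isCompact_of_isClosed isClosed_closure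
  refine Metric.totallyBounded_of_finite_discretization fun ε hε => ?_
  obtain ⟨K, hK0, hK⟩ := exists_norm_planeWave_sub_le (Ω := Ω) hΩ.measurableSet hb
  -- The factor 4 bounds ‖x - y‖² for x, y in the unit ball.
  obtain ⟨R, hR1, hR⟩ : ∃ R : ℝ, 1 < R ∧ ((2 * Real.log R) ^ m)⁻¹ * 4 < ε ^ 2 / 2 := by
    have h1 : Tendsto (fun R : ℝ => ((2 * Real.log R) ^ m)⁻¹ * 4) atTop (𝓝 (0 * 4)) :=
      (((tendsto_pow_atTop hm).comp
        (Real.tendsto_log_atTop.const_mul_atTop two_pos)).inv_tendsto_atTop).mul_const 4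
    rw [zero_mul] at h1
    obtain ⟨R, h2, h3⟩ := ((h1.eventually_lt_const (by positivity : 0 < ε ^ 2 / 2)).and
      (eventually_gt_atTop 1)).exists
    exact ⟨R, h3, h2⟩
  set M := (freqMeasure N).real (Metric.closedBall (0 : Space N) R)
  -- The bound 4η is 2η from two vectors of values lying in a common η-ball, plus 2η from passing to
  -- the nearest net point.
  obtain ⟨η, hη0, hη⟩ : ∃ η : ℝ, 0 < η ∧ M * (4 * η) ^ 2 < ε ^ 2 / 2 := by
    have h1 : Tendsto (fun η : ℝ => M * (4 * η) ^ 2) (𝓝[>] 0) (𝓝 (M * (4 * 0) ^ 2)) :=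
      ((continuous_const.mul ((continuous_const.mul continuous_id).pow 2)).tendsto 0).mono_left
        nhdsWithin_le_nhds
    have h2 := h1.eventually_lt_const (u := ε ^ 2 / 2) (by simp; positivity)
    obtain ⟨η, h3, h4⟩ := (h2.and self_mem_nhdsWithin).exists
    exact ⟨η, h4, h3⟩
  obtain ⟨t, htf, ht⟩ := Metric.totallyBounded_iff.1
    (isCompact_closedBall (0 : Space N) R).totallyBounded (η / (K + 1)) (by positivity)
  have : Fintype t := htf.fintype
  let L : L2 Ω → (t → ℂ) := fun u ξ => fourier Ω u ξ
  have hLb : TotallyBounded (L '' (formInclusion m Ω '' Metric.closedBall 0 1)) := by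
    refine (isCompact_closedBall (0 : t → ℂ)
      (Real.sqrt (volume.real Ω))).totallyBounded.subset ?_
    rintro _ ⟨_, ⟨x, hx, rfl⟩, rfl⟩
    rw [mem_closedBall_zero_iff] at hx ⊢
    refine (pi_norm_le_iff_of_nonneg (Real.sqrt_nonneg _)).2 fun ξ => ?_
    refine Real.le_sqrt_of_sq_le ((norm_fourier_sq_le _ _).trans ?_)
    refine mul_le_of_le_one_right measureReal_nonneg (pow_le_one₀ (norm_nonneg _) ?_)
    exact (WithLp.norm_fst_le _ (x : GraphSpace Ω)).trans hx
  obtain ⟨s, hsf, hs⟩ := Metric.totallyBounded_iff.1 hLb η hη0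
  have hF : ∀ u : (formInclusion m Ω '' Metric.closedBall 0 1 : Set (L2 Ω)),
      ∃ y : s, L u ∈ Metric.ball (y : t → ℂ) η := fun u => by
    have := hs (Set.mem_image_of_mem L u.2)
    simpa using this
  choose F hF using hF
  refine ⟨s, hsf.fintype, F, ?_⟩
  rintro ⟨_, x, hx, rfl⟩ ⟨_, y, hy, rfl⟩ hxy
  have hd2 : ‖x - y‖ ≤ 2 := by
    rw [mem_closedBall_zero_iff] at hx hy
    exact (norm_sub_le x y).trans (by linarith)
  have hLd : ∀ ξ : t, ‖fourier Ω (formInclusion m Ω (x - y)) ξ‖ ≤ 2 * η := fun ξ => by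
    have h1 := hF ⟨formInclusion m Ω x, x, hx, rfl⟩
    have h2 := hF ⟨formInclusion m Ω y, y, hy, rfl⟩
    rw [show F ⟨formInclusion m Ω y, y, hy, rfl⟩ = F ⟨formInclusion m Ω x, x, hx, rfl⟩ from
      hxy.symm] at h2
    have h3 := (dist_triangle_right _ _ _).trans (add_le_add h1.le h2.le)
    rw [map_sub, fourier_sub, ← dist_eq_norm, two_mul]
    exact (dist_le_pi_dist (L (formInclusion m Ω x)) (L (formInclusion m Ω y)) ξ).trans h3
  have hsup : ∀ ξ : Space N, ‖ξ‖ ≤ R → ‖fourier Ω (formInclusion m Ω (x - y)) ξ‖ ≤ 4 * η := by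
    intro ξ hξ
    obtain ⟨ζ, hζt, hζ⟩ := Set.mem_iUnion₂.1 (ht (mem_closedBall_zero_iff.2 hξ))
    rw [Metric.mem_ball, dist_eq_norm, lt_div_iff₀ (by positivity)] at hζ
    have h1 := hLd ⟨ζ, hζt⟩
    have h2 : ‖fourier Ω (formInclusion m Ω (x - y)) ξ - fourier Ω (formInclusion m Ω (x - y)) ζ‖ ≤
        2 * η := by
      rw [fourier_eq_inner, fourier_eq_inner, ← inner_sub_left]
      refine (norm_inner_le_norm _ _).trans ?_
      have h3 : ‖formInclusion m Ω (x - y)‖ ≤ 2 :=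
        (WithLp.norm_fst_le _ ((x - y : formSpace m Ω) : GraphSpace Ω)).trans hd2
      have h4 : ‖planeWave Ω ξ - planeWave Ω ζ‖ ≤ η := by
        refine (hK ξ ζ).trans ?_
        nlinarith [norm_nonneg (ξ - ζ)]
      nlinarith [norm_nonneg (planeWave Ω ξ - planeWave Ω ζ), norm_nonneg (formInclusion m Ω (x - y))]
    have h5 := norm_le_norm_add_norm_sub' (fourier Ω (formInclusion m Ω (x - y)) ξ)
      (fourier Ω (formInclusion m Ω (x - y)) ζ)
    linarith
  have hmain := norm_fst_sq_le hΩ hb (x - y) hR1 hsup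
  have hA : 0 ≤ ((2 * Real.log R) ^ m)⁻¹ := by have := Real.log_pos hR1; positivity
  have h6 : ‖formInclusion m Ω (x - y)‖ ^ 2 < ε ^ 2 := by
    have h7 : ((2 * Real.log R) ^ m)⁻¹ * ‖x - y‖ ^ 2 ≤ ((2 * Real.log R) ^ m)⁻¹ * 4 := by
      refine mul_le_mul_of_nonneg_left ?_ hA
      nlinarith [norm_nonneg (x - y)]
    linarith
  have h8 := lt_of_pow_lt_pow_left₀ 2 hε.le h6
  rw [map_sub] at h8
  rwa [dist_eq_norm]

/-- The two weak equations are complex conjugates of each other, because of the order of the slots;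
the shift by c moves every eigenvalue by c. -/
theorem eigenfunctions_eq_weakEigenvectors (hΩ : IsOpen Ω) (hb : Bornology.IsBounded Ω) {m : ℕ}
    {P : formSpace m Ω →L[ℂ] formSpace m Ω} {c : ℝ}
    (hP : ∀ x y, ⟪P x, y⟫_ℂ = form m Ω (formInclusion m Ω y) (formInclusion m Ω x) +
        c * ⟪formInclusion m Ω x, formInclusion m Ω y⟫_ℂ) (a : ℝ) :
    eigenfunctions m Ω a = weakEigenvectors (formInclusion m Ω) P (a + c) := by
  have hconj : ∀ u v : L2 Ω, conj (form m Ω u v) = form m Ω v u := fun u v => by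
    rw [form_eq, form_eq, ← integral_conj]
    congr 1; funext ξ
    simp only [map_mul, Complex.conj_ofReal, Complex.conj_conj]
    ring
  have hinner : ∀ u v : L2 Ω, ∫ x in Ω, u x * conj (v x) = ⟪v, u⟫_ℂ := fun u v => by
    rw [L2.inner_def]; rfl
  have key : ∀ u v : L2 Ω, (form m Ω u v = a * ∫ x in Ω, u x * conj (v x)) ↔
      form m Ω v u + c * ⟪u, v⟫_ℂ = ((a + c : ℝ) : ℂ) * ⟪u, v⟫_ℂ := fun u v => by
    rw [hinner, ← hconj v u, ← inner_conj_symm v u, ← Complex.conj_ofReal a, ← map_mul,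
      (RingHom.injective (starRingEnd ℂ)).eq_iff, Complex.ofReal_add, add_mul, add_left_inj]
  ext u
  constructor
  · rintro ⟨hu, h⟩
    obtain ⟨x, hx, rfl⟩ := exists_mem_formSpace hΩ hb hu
    refine ⟨⟨x, hx⟩, rfl, fun y => ?_⟩
    rw [hP]
    exact (key _ _).1 (h _ (fst_mem_formDomain hΩ hb y.2))
  · rintro ⟨x, rfl, h⟩
    refine ⟨fst_mem_formDomain hΩ hb x.2, fun v hv => ?_⟩
    obtain ⟨y, hy, rfl⟩ := exists_mem_formSpace hΩ hb hv
    have h1 := h ⟨y, hy⟩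
    rw [hP] at h1
    exact (key _ _).2 h1

/-- The spectral decomposition of the form: an orthonormal basis of eigenfunctions, together with
the variational principle for partial sums. -/
theorem exists_hilbertBasis_eigenfunctions (hΩ : IsOpen Ω) (hb : Bornology.IsBounded Ω)
    (hN : 1 ≤ N) {m : ℕ} (hm : m ≠ 0) :
    ∃ (ι : Type) (e : HilbertBasis ι ℂ (L2 Ω)) (a : ι → ℝ),
      (∀ i, e i ∈ eigenfunctions m Ω (a i)) ∧
      (∀ t : ℝ, Cardinal.mk {i // a i = t} = multiplicity m Ω t) ∧
      ∀ u ∈ formDomain m Ω, ∀ (t : ℝ) (s : Finset ι), (∀ i, a i < t → i ∈ s) →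
        t * ‖u‖ ^ 2 - (form m Ω u u).re ≤ ∑ i ∈ s, (t - a i) * ‖⟪e i, u⟫_ℂ‖ ^ 2 := by
  obtain ⟨P, hPs, hPp, hP⟩ := exists_formOperator hΩ hb hN (m := m) hm
  have hker : ∀ f : L2 Ω, (∀ x, ⟪formInclusion m Ω x, f⟫_ℂ = 0) → f = 0 := by
    refine fun f hf => eq_zero_of_forall_inner_testSubmodule hΩ f fun u hu => ?_
    obtain ⟨φ, hφ, hu⟩ := hu
    obtain ⟨x, hx, hxu⟩ := exists_mem_formSpace hΩ hb (hφ.mem_formDomain m)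
    have h1 := hf ⟨x, hx⟩
    rw [formInclusion_apply, hxu] at h1
    have h2 : u = (hφ.memLp (volume.restrict Ω)).toLp φ :=
      Lp.ext (hu.trans (MemLp.coeFn_toLp _).symm)
    rwa [h2]
  obtain ⟨ι, e, a, he, ha⟩ := exists_hilbertBasis_weakEigenvectors (formInclusion m Ω) P
    (isCompactOperator_formInclusion hΩ hb hm) hker hPs hPp
  refine ⟨ι, e, fun i => a i - (1 + remBound m Ω), fun i => ?_, fun t => ?_,
    fun u hu t s hs => ?_⟩
  · rw [eigenfunctions_eq_weakEigenvectors hΩ hb hP, sub_add_cancel]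
    exact he i
  · rw [multiplicity, eigenfunctions_eq_weakEigenvectors hΩ hb hP, ← ha]
    simp only [sub_eq_iff_eq_add]
  · obtain ⟨x, hx, rfl⟩ := exists_mem_formSpace hΩ hb hu
    have h1 := sub_le_sum_weakEigenvectors e he hPs (fun g => (sq_nonneg _).trans (hPp g)) ⟨x, hx⟩
      (t + (1 + remBound m Ω)) s (fun i hi => hs i (by linarith))
    rw [hP, inner_self_eq_norm_sq_to_K] at h1
    have h3 : ((1 + remBound m Ω : ℝ) * ((‖formInclusion m Ω ⟨x, hx⟩‖ : ℝ) : ℂ) ^ 2).re =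
        (1 + remBound m Ω) * ‖formInclusion m Ω ⟨x, hx⟩‖ ^ 2 := by
      rw [← Complex.ofReal_pow, ← Complex.ofReal_mul, Complex.ofReal_re]
    simp only [Complex.add_re, Complex.coe_algebraMap] at h1
    rw [h3, formInclusion_apply] at h1
    have h4 : ∀ i, t - (a i - (1 + remBound m Ω)) = t + (1 + remBound m Ω) - a i := fun i => by ring
    simp only [h4]
    refine le_trans (le_of_eq ?_) h1
    ring

end Operators

end
end LogLaplacian

open MeasureTheory Filter Topology Module
open scoped ContDiff ENNReal NNReal ComplexConjugate InnerProductSpace SchwartzMap FourierTransform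

namespace LogLaplacian

noncomputable section

/-! ### Upper and lower bounds for Riesz means. -/

section RieszBounds

variable {N : ℕ} {Ω : Set (Space N)}

/-- For odd m the symbol tends to -∞ at the origin, so the integrand is unbounded there. It is
dominated by its version with `posSymbol`, which is continuous with compact support, plus
|`remSymbol`|. -/
theorem integrable_max_zero_sub_symbol (hN : 1 ≤ N) {m : ℕ} (hm : m ≠ 0) (t : ℝ) :
    Integrable (fun ξ : Space N => max 0 (t - symbol m ξ)) (freqMeasure N) := by
  have h1 : Integrable (fun ξ : Space N => max 0 (t - posSymbol m ξ)) (freqMeasure N) := by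
    refine Continuous.integrable_of_hasCompactSupport
      (continuous_const.max (continuous_const.sub (continuous_posSymbol m))) ?_
    have hlim : Tendsto (fun r : ℝ => (2 * Real.posLog r) ^ m) atTop atTop :=
      (tendsto_pow_atTop hm).comp ((tendsto_atTop_mono (fun r => le_max_right 0 (Real.log r))
        Real.tendsto_log_atTop).const_mul_atTop two_pos)
    obtain ⟨R, hR⟩ := eventually_atTop.1 (hlim.eventually_ge_atTop t)
    refine HasCompactSupport.of_support_subset_isCompact (isCompact_closedBall (0 : Space N) R)
      fun ξ hξ => ?_
    by_contra h
    rw [mem_closedBall_zero_iff, not_le] at h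
    exact hξ (max_eq_left (sub_nonpos.2 (hR _ h.le)))
  refine (h1.add (integrable_remSymbol hN hm).abs).mono' ?_ (ae_of_all _ fun ξ => ?_)
  · exact (measurable_const.max (measurable_const.sub (measurable_symbol m))).aestronglyMeasurable
  · rw [Real.norm_of_nonneg (le_max_left _ _), Pi.add_apply]
    refine max_le (add_nonneg (le_max_left _ _) (abs_nonneg _)) ?_
    have h2 := le_max_right 0 (t - posSymbol m ξ)
    have h3 := neg_abs_le (remSymbol m ξ)
    rw [remSymbol] at h3 ⊢
    linarith

theorem pow_succ_le_add_mul {a x : ℝ} (ha : 0 ≤ a) (hax : a ≤ x) (n : ℕ) :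
    x ^ (n + 1) ≤ a ^ (n + 1) + (n + 1) * (x - a) * x ^ n := by
  induction n with
  | zero => simp
  | succ n ih =>
    have hx : 0 ≤ x := ha.trans hax
    have h1 : a ^ (n + 1) ≤ x ^ (n + 1) := pow_le_pow_left₀ ha hax _
    have h2 := mul_le_mul_of_nonneg_left ih hx
    have h3 := mul_le_mul_of_nonneg_left h1 (sub_nonneg.2 hax)
    rw [pow_succ x (n + 1), pow_succ a (n + 1)]
    push_cast
    have h4 : x * ((n + 1) * (x - a) * x ^ n) = (n + 1) * (x - a) * x ^ (n + 1) := by ring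
    nlinarith

/-- Since log|η + ξ| ≤ log|ξ| + |η|/|ξ| when the right side is used with log⁺, the mean value bound
`pow_succ_le_add_mul` makes the increase small for large ξ. The polynomial in η is later absorbed by
the decay of the cutoff's Fourier transform. -/
theorem posSymbol_add_le (m : ℕ) {ξ : Space N} (hξ : 1 ≤ ‖ξ‖) (η : Space N) :
    posSymbol (m + 1) (η + ξ) ≤ (2 * Real.log ‖ξ‖) ^ (m + 1) +
      (m + 1) * 2 ^ (m + 1) * ((1 + 2 * Real.log ‖ξ‖) ^ m / ‖ξ‖) * (1 + ‖η‖) ^ (m + 1) := by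
  set a := 2 * Real.log ‖ξ‖
  have ha : 0 ≤ a := mul_nonneg zero_le_two (Real.log_nonneg hξ)
  have hξ0 : 0 < ‖ξ‖ := one_pos.trans_le hξ
  set b := 2 * (‖η‖ / ‖ξ‖)
  have hb : 0 ≤ b := by positivity
  have hbη : b ≤ 2 * ‖η‖ := by
    have : ‖η‖ / ‖ξ‖ ≤ ‖η‖ := div_le_self (norm_nonneg _) hξ
    simp only [b]; linarith
  have hlog : Real.posLog ‖η + ξ‖ ≤ Real.log ‖ξ‖ + ‖η‖ / ‖ξ‖ := by
    have h1 : ‖η + ξ‖ ≤ ‖ξ‖ * (1 + ‖η‖ / ‖ξ‖) := by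
      rw [mul_add, mul_one, mul_div_cancel₀ _ hξ0.ne', add_comm]
      exact norm_add_le ξ η
    have h2 : 1 ≤ ‖ξ‖ * (1 + ‖η‖ / ‖ξ‖) :=
      one_le_mul_of_one_le_of_one_le hξ (le_add_of_nonneg_right (by positivity))
    rw [Real.posLog_eq_log_max_one (norm_nonneg _)]
    refine (Real.log_le_log (by positivity) (max_le h2 h1)).trans ?_
    rw [Real.log_mul hξ0.ne' (by positivity)]
    have := Real.log_le_sub_one_of_pos (show 0 < 1 + ‖η‖ / ‖ξ‖ by positivity)
    linarith
  have h3 : posSymbol (m + 1) (η + ξ) ≤ (a + b) ^ (m + 1) := by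
    rw [posSymbol]
    have := Real.posLog_nonneg (x := ‖η + ξ‖)
    gcongr
    simp only [a, b]; linarith
  refine h3.trans ((pow_succ_le_add_mul ha (le_add_of_nonneg_right hb) m).trans ?_)
  rw [add_sub_cancel_left]
  have h4 : a + b ≤ 2 * ((1 + a) * (1 + ‖η‖)) := by
    nlinarith [mul_nonneg ha (norm_nonneg η), norm_nonneg η]
  calc a ^ (m + 1) + (m + 1) * b * (a + b) ^ m
      ≤ a ^ (m + 1) + (m + 1) * (2 * ((1 + ‖η‖) / ‖ξ‖)) * (2 * ((1 + a) * (1 + ‖η‖))) ^ m := by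
        simp only [b]
        gcongr
        linarith
    _ = _ := by
        rw [mul_pow 2 ((1 + a) * (1 + ‖η‖)), mul_pow (1 + a), pow_succ (1 + ‖η‖), pow_succ (2 : ℝ)]
        field_simp

theorem form_self_of_mem_eigenfunctions {m : ℕ} {u : L2 Ω} {a : ℝ} (hu : u ∈ eigenfunctions m Ω a) :
    (form m Ω u u).re = a * ‖u‖ ^ 2 := by
  have h1 : ∫ x in Ω, u x * conj (u x) = ⟪u, u⟫_ℂ := by
    rw [L2.inner_def]; rfl
  rw [hu.2 u hu.1, h1, inner_self_eq_norm_sq_to_K]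
  simp [← Complex.ofReal_pow]

/-- A plane wave cut off by a test function. -/
def cutWave (φ : Space N → ℝ) (ξ : Space N) (x : Space N) : ℂ :=
  φ x * Complex.exp (Complex.I * ((inner ℝ x ξ : ℝ) : ℂ))

theorem isTestFunction_cutWave {φ : Space N → ℝ} (hφ : IsTestFunction Ω fun x => (φ x : ℂ))
    (ξ : Space N) : IsTestFunction Ω (cutWave φ ξ) := by
  refine ⟨hφ.1.mul ?_, hφ.2.1.mul_right, (closure_mono (Function.support_mul_subset_left _ _)).trans
    hφ.2.2⟩
  have h1 : ContDiff ℝ ∞ fun x : Space N => ((inner ℝ x ξ : ℝ) : ℂ) :=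
    Complex.ofRealCLM.contDiff.comp (contDiff_id.inner ℝ contDiff_const)
  exact (contDiff_const.mul h1).cexp

theorem fourier_cutWave (φ : Space N → ℝ) (ξ η : Space N) :
    fourier Ω (cutWave φ ξ) η = fourier Ω (fun x => (φ x : ℂ)) (η - ξ) := by
  refine integral_congr_ae (ae_of_all _ fun x => ?_)
  simp only [cutWave]
  rw [mul_left_comm, ← Complex.exp_add, mul_comm, inner_sub_right]
  congr 2
  push_cast; ring

variable [IsFiniteMeasure (volume.restrict Ω)]

theorem integrable_posSymbol_mul_norm_sq (hΩ : IsOpen Ω) (hb : Bornology.IsBounded Ω) {m : ℕ}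
    {u : L2 Ω} (hu : u ∈ formDomain m Ω) :
    Integrable (fun ξ => posSymbol m ξ * ‖fourier Ω u ξ‖ ^ 2) (freqMeasure N) := by
  obtain ⟨x, hx, rfl⟩ := exists_mem_formSpace hΩ hb hu
  refine ((integrable_posSymbol_mul ⟨x, hx⟩ ⟨x, hx⟩).re).congr (ae_of_all _ fun ξ => ?_)
  simp only [Complex.conj_mul', formInclusion_apply]
  rw [← Complex.ofReal_pow, ← Complex.ofReal_mul]
  exact Complex.ofReal_re _

theorem integrable_remSymbol_mul_norm_sq (hΩ : IsOpen Ω) (hb : Bornology.IsBounded Ω)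
    (hN : 1 ≤ N) {m : ℕ} (hm : m ≠ 0) (u : L2 Ω) :
    Integrable (fun ξ => remSymbol m ξ * ‖fourier Ω u ξ‖ ^ 2) (freqMeasure N) := by
  refine ((integrable_remSymbol_mul hΩ hb hN hm u u).re).congr (ae_of_all _ fun ξ => ?_)
  simp only [Complex.conj_mul']
  rw [← Complex.ofReal_pow, ← Complex.ofReal_mul]
  exact Complex.ofReal_re _

theorem form_self_re (hΩ : IsOpen Ω) (hb : Bornology.IsBounded Ω) (hN : 1 ≤ N) {m : ℕ}
    (hm : m ≠ 0) {u : L2 Ω} (hu : u ∈ formDomain m Ω) :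
    (form m Ω u u).re = ∫ ξ, posSymbol m ξ * ‖fourier Ω u ξ‖ ^ 2 ∂freqMeasure N +
      ∫ ξ, remSymbol m ξ * ‖fourier Ω u ξ‖ ^ 2 ∂freqMeasure N := by
  rw [← integral_add (integrable_posSymbol_mul_norm_sq hΩ hb hu)
    (integrable_remSymbol_mul_norm_sq hΩ hb hN hm u), form_eq]
  have h1 : ∀ ξ, (((2 * Real.log ‖ξ‖) ^ m : ℝ) : ℂ) * fourier Ω u ξ * conj (fourier Ω u ξ) =
      ((posSymbol m ξ * ‖fourier Ω u ξ‖ ^ 2 + remSymbol m ξ * ‖fourier Ω u ξ‖ ^ 2 : ℝ) : ℂ) :=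
    fun ξ => by
      rw [symbol_mul_eq, Complex.conj_mul']; push_cast; ring
  simp_rw [h1]
  rw [integral_complex_ofReal, Complex.ofReal_re]

/-- Bessel's inequality for the plane wave of frequency ξ. -/
theorem sum_norm_fourier_sq_le {ι : Type} {e : ι → L2 Ω} (he : Orthonormal ℂ e) (s : Finset ι)
    (ξ : Space N) : ∑ i ∈ s, ‖fourier Ω (e i) ξ‖ ^ 2 ≤ volume.real Ω := by
  rw [← norm_planeWave_sq ξ]
  refine le_trans (le_of_eq ?_) (he.sum_inner_products_le (s := s) (planeWave Ω ξ))
  refine Finset.sum_congr rfl fun i _ => ?_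
  rw [fourier_eq_inner, norm_inner_symm]

/-- The Berezin–Li–Yau bound. -/
theorem sum_sub_le (hΩ : IsOpen Ω) (hb : Bornology.IsBounded Ω) (hN : 1 ≤ N) {m : ℕ}
    (hm : m ≠ 0) {ι : Type} {e : ι → L2 Ω} (he : Orthonormal ℂ e) {a : ι → ℝ}
    (hea : ∀ i, e i ∈ eigenfunctions m Ω (a i)) (t : ℝ) (s : Finset ι) :
    ∑ i ∈ s, (t - a i) ≤ volume.real Ω * ∫ ξ, max 0 (t - symbol m ξ) ∂freqMeasure N := by
  have hmax := integrable_max_zero_sub_symbol hN hm t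
  have hint : ∀ i, Integrable (fun ξ => max 0 (t - symbol m ξ) * ‖fourier Ω (e i) ξ‖ ^ 2)
      (freqMeasure N) := fun i => by
    refine hmax.mul_bdd (c := volume.real Ω * ‖e i‖ ^ 2)
      ((continuous_fourier hΩ.measurableSet hb _).norm.pow 2).aestronglyMeasurable
      (ae_of_all _ fun ξ => ?_)
    rw [Real.norm_of_nonneg (by positivity)]
    exact norm_fourier_sq_le _ _
  -- Because e_i is normalized, t - a_i is exactly the integral of (t - symbol)|ê_i|².
  have h1 : ∀ i, t - a i ≤ ∫ ξ, max 0 (t - symbol m ξ) * ‖fourier Ω (e i) ξ‖ ^ 2 ∂freqMeasure N := by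
    intro i
    have hp := integrable_posSymbol_mul_norm_sq hΩ hb (hea i).1
    have hr := integrable_remSymbol_mul_norm_sq hΩ hb hN hm (e i)
    have hf := (integrable_norm_fourier_sq hΩ hb (e i)).const_mul t
    have h2 := form_self_of_mem_eigenfunctions (hea i)
    have h3 := integral_norm_fourier_sq hΩ hb (e i)
    rw [he.norm_eq_one i, one_pow] at h3
    rw [he.norm_eq_one i, one_pow, mul_one, form_self_re hΩ hb hN hm (hea i).1] at h2
    have hpr : Integrable (fun ξ => posSymbol m ξ * ‖fourier Ω (e i) ξ‖ ^ 2 +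
        remSymbol m ξ * ‖fourier Ω (e i) ξ‖ ^ 2) (freqMeasure N) := hp.add hr
    have h5 : t - a i = ∫ ξ, (t * ‖fourier Ω (e i) ξ‖ ^ 2 -
        (posSymbol m ξ * ‖fourier Ω (e i) ξ‖ ^ 2 + remSymbol m ξ * ‖fourier Ω (e i) ξ‖ ^ 2))
        ∂freqMeasure N := by
      rw [integral_sub hf hpr, integral_const_mul, integral_add hp hr, h2, h3, mul_one]
    rw [h5]
    refine integral_mono (hf.sub hpr) (hint i) fun ξ => ?_
    have h4 := mul_le_mul_of_nonneg_right (le_max_right 0 (t - symbol m ξ))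
      (sq_nonneg ‖fourier Ω (e i) ξ‖)
    refine le_trans (le_of_eq ?_) h4
    simp only [remSymbol]
    ring
  calc ∑ i ∈ s, (t - a i)
      ≤ ∑ i ∈ s, ∫ ξ, max 0 (t - symbol m ξ) * ‖fourier Ω (e i) ξ‖ ^ 2 ∂freqMeasure N :=
        Finset.sum_le_sum fun i _ => h1 i
    _ = ∫ ξ, ∑ i ∈ s, max 0 (t - symbol m ξ) * ‖fourier Ω (e i) ξ‖ ^ 2 ∂freqMeasure N :=
        (integral_finsetSum _ fun i _ => hint i).symm
    _ ≤ ∫ ξ, max 0 (t - symbol m ξ) * volume.real Ω ∂freqMeasure N := by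
        refine integral_mono (integrable_finsetSum _ fun i _ => hint i) (hmax.mul_const _)
          fun ξ => ?_
        simp only [← Finset.mul_sum]
        exact mul_le_mul_of_nonneg_left (sum_norm_fourier_sq_le he s ξ) (le_max_left _ _)
    _ = _ := by rw [integral_mul_const, mul_comm]

/-- Modulation translates the Fourier transform, so the energy is the symbol averaged around ξ. The
low frequency part contributes only a bounded error, and C does not depend on ξ. -/
theorem exists_form_cutWave_le (hΩ : IsOpen Ω) (hb : Bornology.IsBounded Ω) (hN : 1 ≤ N) (m : ℕ)
    {φ : Space N → ℝ} (hφ : IsTestFunction Ω fun x => (φ x : ℂ)) :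
    ∃ C : ℝ, 0 ≤ C ∧ ∀ ξ : Space N, 1 ≤ ‖ξ‖ → ∀ w : L2 Ω, w =ᵐ[volume.restrict Ω] cutWave φ ξ →
      (form (m + 1) Ω w w).re ≤ (2 * Real.log ‖ξ‖) ^ (m + 1) * (∫ x, φ x ^ 2) +
        C * (1 + (1 + 2 * Real.log ‖ξ‖) ^ m / ‖ξ‖) := by
  have hm1 : m + 1 ≠ 0 := m.succ_ne_zero
  obtain ⟨g, hg, hgi⟩ := hφ.exists_schwartz
  obtain ⟨M, hM⟩ : ∃ M, ∀ ξ, ‖g ξ‖ ≤ M := ⟨_, fun ξ => g.norm_le_seminorm ℝ ξ⟩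
  have hM0 : 0 ≤ M := (norm_nonneg _).trans (hM 0)
  set C₁ : ℝ := ∫ η, (1 + ‖η‖) ^ (m + 1) * ‖g η‖ ^ 2 ∂freqMeasure N
  set C₂ : ℝ := ∫ η, |remSymbol (m + 1) η| ∂freqMeasure N
  have hC₁ : 0 ≤ C₁ := integral_nonneg fun η => by positivity
  have hC₂ : 0 ≤ C₂ := integral_nonneg fun η => abs_nonneg _
  refine ⟨(m + 1) * 2 ^ (m + 1) * C₁ + C₂ * M ^ 2, by positivity, fun ξ hξ w hw => ?_⟩
  have hL : 0 ≤ Real.log ‖ξ‖ := Real.log_nonneg hξ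
  set q := (1 + 2 * Real.log ‖ξ‖) ^ m / ‖ξ‖
  have hq : 0 ≤ q := by positivity
  have hwg : ∀ η, fourier Ω w η = g (η - ξ) := fun η => by
    rw [fourier_congr hw, fourier_cutWave, hg]
  have hwd : w ∈ formDomain (m + 1) Ω := by
    have h1 := isTestFunction_cutWave hφ ξ
    have h2 : w = (h1.memLp (volume.restrict Ω)).toLp (cutWave φ ξ) :=
      Lp.ext (hw.trans (MemLp.coeFn_toLp _).symm)
    rw [h2]; exact h1.mem_formDomain _
  rw [form_self_re hΩ hb hN hm1 hwd]
  have hpos : ∫ η, posSymbol (m + 1) η * ‖fourier Ω w η‖ ^ 2 ∂freqMeasure N ≤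
      (2 * Real.log ‖ξ‖) ^ (m + 1) * (∫ x, φ x ^ 2) + (m + 1) * 2 ^ (m + 1) * q * C₁ := by
    have h1 : ∫ η, posSymbol (m + 1) η * ‖fourier Ω w η‖ ^ 2 ∂freqMeasure N =
        ∫ η, posSymbol (m + 1) (η + ξ) * ‖g η‖ ^ 2 ∂freqMeasure N := by
      rw [← integral_add_right_eq_self _ ξ]
      simp_rw [hwg, add_sub_cancel_right]
    have h2 : Integrable (fun η => posSymbol (m + 1) (η + ξ) * ‖g η‖ ^ 2) (freqMeasure N) := by
      have h3 := (integrable_posSymbol_mul_norm_sq hΩ hb hwd).comp_add_right ξ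
      simpa only [hwg, add_sub_cancel_right] using h3
    have h3 : ∫ x, φ x ^ 2 = ∫ η, ‖g η‖ ^ 2 ∂freqMeasure N := by
      rw [hgi]; simp
    have h4 : Integrable (fun η => ‖g η‖ ^ 2) (freqMeasure N) := by
      simpa using integrable_one_add_norm_pow_mul_sq g 0
    have h5 := integrable_one_add_norm_pow_mul_sq g (m + 1)
    rw [h1, h3, ← integral_const_mul, ← integral_const_mul,
      ← integral_add (h4.const_mul _) (h5.const_mul _)]
    refine integral_mono h2 ((h4.const_mul _).add (h5.const_mul _)) fun η => ?_
    refine (mul_le_mul_of_nonneg_right (posSymbol_add_le m hξ η) (sq_nonneg _)).trans_eq ?_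
    simp only [q]
    ring
  have hrem : ∫ η, remSymbol (m + 1) η * ‖fourier Ω w η‖ ^ 2 ∂freqMeasure N ≤ C₂ * M ^ 2 := by
    have hr := (integrable_remSymbol hN hm1).abs.mul_const (M ^ 2)
    refine (integral_mono (integrable_remSymbol_mul_norm_sq hΩ hb hN hm1 w) hr
      fun η => ?_).trans_eq (integral_mul_const _ _)
    rw [hwg]
    refine mul_le_mul (le_abs_self _) ?_ (sq_nonneg _) (abs_nonneg _)
    exact pow_le_pow_left₀ (norm_nonneg _) (hM _) 2
  clear_value C₁ C₂ q
  have h6 : 0 ≤ (m + 1) * 2 ^ (m + 1) * C₁ := by positivity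
  have h7 : 0 ≤ C₂ * M ^ 2 * q := by positivity
  have h8 : ((m + 1) * 2 ^ (m + 1) * C₁ + C₂ * M ^ 2) * (1 + q) =
      (m + 1) * 2 ^ (m + 1) * C₁ + (m + 1) * 2 ^ (m + 1) * q * C₁ + C₂ * M ^ 2 +
        C₂ * M ^ 2 * q := by ring
  rw [h8]
  linarith

/-- The lower bound for Riesz means obtained by testing with cut-off plane waves. -/
theorem setIntegral_le_sum_sub (hΩ : IsOpen Ω) (hb : Bornology.IsBounded Ω) {m : ℕ} {ι : Type}
    {e : ι → L2 Ω} (he : Orthonormal ℂ e) {a : ι → ℝ}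
    (hvar : ∀ u ∈ formDomain m Ω, ∀ (t : ℝ) (s : Finset ι), (∀ i, a i < t → i ∈ s) →
        t * ‖u‖ ^ 2 - (form m Ω u u).re ≤ ∑ i ∈ s, (t - a i) * ‖⟪e i, u⟫_ℂ‖ ^ 2)
    {φ : Space N → ℝ} (hφ : IsTestFunction Ω fun x => (φ x : ℂ)) (hφ1 : ∀ x, |φ x| ≤ 1)
    {t : ℝ} {s : Finset ι} (hs : ∀ i, i ∈ s ↔ a i < t) {A : Set (Space N)} (hA : MeasurableSet A)
    {h : Space N → ℝ} (hh : IntegrableOn h A (freqMeasure N))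
    (hle : ∀ ξ ∈ A, ∀ w : L2 Ω, w =ᵐ[volume.restrict Ω] cutWave φ ξ →
      h ξ ≤ t * (∫ x, φ x ^ 2) - (form m Ω w w).re) :
    ∫ ξ in A, h ξ ∂freqMeasure N ≤ ∑ i ∈ s, (t - a i) := by
  -- The cutoff is moved from the wave to e_i: the coefficient of the cut-off wave has the modulus
  -- of the Fourier transform of φ e_i, so integrating over ξ is Plancherel for a function of norm
  -- at most 1.
  have hmul : ∀ i, MemLp (fun x => (φ x : ℂ) * e i x) 2 (volume.restrict Ω) := fun i => by
    refine (Lp.memLp (e i)).of_le (hφ.1.continuous.aestronglyMeasurable.mul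
      (Lp.aestronglyMeasurable _)) (ae_of_all _ fun x => ?_)
    rw [norm_mul, Complex.norm_real]
    exact mul_le_of_le_one_left (norm_nonneg _) (hφ1 x)
  let v : ι → L2 Ω := fun i => (hmul i).toLp _
  have hv1 : ∀ i, ‖v i‖ ≤ 1 := fun i => by
    rw [← he.norm_eq_one i]
    refine Lp.norm_le_norm_of_ae_le ?_
    filter_upwards [(hmul i).coeFn_toLp] with x hx
    rw [hx, norm_mul, Complex.norm_real]
    exact mul_le_of_le_one_left (norm_nonneg _) (hφ1 x)
  have hw : ∀ ξ, MemLp (cutWave φ ξ) 2 (volume.restrict Ω) := fun ξ =>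
    (isTestFunction_cutWave hφ ξ).memLp _
  have hinner : ∀ i ξ, ‖⟪e i, (hw ξ).toLp _⟫_ℂ‖ = ‖fourier Ω (v i) ξ‖ := fun i ξ => by
    rw [fourier_congr (hmul i).coeFn_toLp, norm_inner_symm, L2.inner_def, fourier]
    congr 1
    refine integral_congr_ae ?_
    filter_upwards [(hw ξ).coeFn_toLp] with x hx
    rw [hx, RCLike.inner_apply, cutWave, map_mul, ← Complex.exp_conj]
    simp only [Complex.conj_ofReal, map_mul, Complex.conj_I, neg_mul]
    ring
  have hnorm : ∀ ξ, ‖(hw ξ).toLp _‖ ^ 2 = ∫ x, φ x ^ 2 := fun ξ => by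
    rw [norm_sq_eq_integral, ← setIntegral_eq_integral_of_forall_compl_eq_zero (s := Ω)
      (f := fun x => φ x ^ 2)]
    · refine integral_congr_ae ?_
      filter_upwards [(hw ξ).coeFn_toLp] with x hx
      rw [hx, cutWave, norm_mul, norm_cexp_I_mul_ofReal, mul_one, Complex.norm_real,
        Real.norm_eq_abs, sq_abs]
    · intro x hx
      have h0 := hφ.eq_zero hx
      simp only [Complex.ofReal_eq_zero] at h0
      simp [h0]
  have hint : ∀ i, Integrable (fun ξ => (t - a i) * ‖fourier Ω (v i) ξ‖ ^ 2) (freqMeasure N) :=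
    fun i => (integrable_norm_fourier_sq hΩ hb _).const_mul _
  calc ∫ ξ in A, h ξ ∂freqMeasure N
      ≤ ∫ ξ in A, ∑ i ∈ s, (t - a i) * ‖fourier Ω (v i) ξ‖ ^ 2 ∂freqMeasure N := by
        refine setIntegral_mono_on hh (integrable_finsetSum _ fun i _ => hint i).integrableOn hA
          fun ξ hξ => ?_
        have h1 := hvar _ ((isTestFunction_cutWave hφ ξ).mem_formDomain m) t s
          fun i hi => (hs i).2 hi
        rw [hnorm] at h1
        simp_rw [hinner] at h1
        exact (hle ξ hξ _ (hw ξ).coeFn_toLp).trans h1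
    _ ≤ ∫ ξ, ∑ i ∈ s, (t - a i) * ‖fourier Ω (v i) ξ‖ ^ 2 ∂freqMeasure N := by
        -- Enlarging A to the whole space is allowed because t - a_i > 0 on `s`; here `s` has to be
        -- exactly the sublevel set.
        refine setIntegral_le_integral (integrable_finsetSum _ fun i _ => hint i)
          (ae_of_all _ fun ξ => ?_)
        exact Finset.sum_nonneg fun i hi =>
          mul_nonneg (sub_nonneg.2 ((hs i).1 hi).le) (sq_nonneg _)
    _ = ∑ i ∈ s, (t - a i) * ‖v i‖ ^ 2 := by
        rw [integral_finsetSum _ fun i _ => hint i]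
        refine Finset.sum_congr rfl fun i _ => ?_
        rw [integral_const_mul, integral_norm_fourier_sq hΩ hb]
    _ ≤ ∑ i ∈ s, (t - a i) := by
        refine Finset.sum_le_sum fun i hi => ?_
        exact mul_le_of_le_one_right (sub_nonneg.2 ((hs i).1 hi).le)
          (pow_le_one₀ (norm_nonneg _) (hv1 i))

end RieszBounds

end
end LogLaplacian

open MeasureTheory Filter Topology Module
open scoped ContDiff ENNReal NNReal ComplexConjugate InnerProductSpace SchwartzMap FourierTransform

namespace LogLaplacian

noncomputable section

/-! ### Polar coordinates on spherical shells. -/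

section RadialIntegrals

variable {N : ℕ}

theorem T_eq (N : ℕ) : T N = N * (freqMeasure N).real (Metric.ball 0 1) := by
  rw [T, sphereArea, Measure.toSphere_real_apply_univ, finrank_euclideanSpace, Fintype.card_fin,
    freqMeasure, measureReal_ennreal_smul_apply, ENNReal.toReal_ofReal (by positivity)]
  field_simp

/-- The closed spherical shell with radii `a` and `b`. -/
def shell (N : ℕ) (a b : ℝ) : Set (Space N) := {ξ | a ≤ ‖ξ‖ ∧ ‖ξ‖ ≤ b}

theorem measurableSet_shell (a b : ℝ) : MeasurableSet (shell N a b) :=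
  ((isClosed_le continuous_const continuous_norm).inter
    (isClosed_le continuous_norm continuous_const)).measurableSet

theorem shell_subset_closedBall (a b : ℝ) : shell N a b ⊆ Metric.closedBall 0 b := fun ξ hξ => by
  simpa using hξ.2

theorem isCompact_shell (a b : ℝ) : IsCompact (shell N a b) :=
  (isCompact_closedBall 0 b).of_isClosed_subset
    ((isClosed_le continuous_const continuous_norm).inter
      (isClosed_le continuous_norm continuous_const)) (shell_subset_closedBall a b)

theorem setIntegral_shell (hN : 1 ≤ N) {a b : ℝ} (ha : 0 < a) (hab : a ≤ b) (f : ℝ → ℝ) :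
    ∫ ξ in shell N a b, f ‖ξ‖ ∂freqMeasure N = T N * ∫ r in a..b, f r * r ^ (N - 1) := by
  have : Nonempty (Fin N) := ⟨⟨0, hN⟩⟩
  have h1 : ∀ ξ : Space N, (shell N a b).indicator (fun ξ => f ‖ξ‖) ξ =
      (Set.Icc a b).indicator f ‖ξ‖ := fun ξ => by
    by_cases h : ξ ∈ shell N a b
    · rw [Set.indicator_of_mem h, Set.indicator_of_mem (show ‖ξ‖ ∈ Set.Icc a b from h)]
    · rw [Set.indicator_of_notMem h, Set.indicator_of_notMem (show ‖ξ‖ ∉ Set.Icc a b from h)]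
  rw [← integral_indicator (measurableSet_shell a b)]
  simp_rw [h1]
  rw [integral_fun_norm_addHaar, finrank_euclideanSpace, Fintype.card_fin, T_eq,
    intervalIntegral.integral_of_le hab, ← integral_Icc_eq_integral_Ioc, nsmul_eq_mul, smul_eq_mul,
    ← mul_assoc]
  congr 1
  have h2 : ∀ r : ℝ, r ^ (N - 1) • (Set.Icc a b).indicator f r =
      (Set.Icc a b).indicator (fun r => f r * r ^ (N - 1)) r := fun r => by
    by_cases h : r ∈ Set.Icc a b
    · rw [Set.indicator_of_mem h, Set.indicator_of_mem h, smul_eq_mul, mul_comm]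
    · rw [Set.indicator_of_notMem h, Set.indicator_of_notMem h, smul_zero]
  simp_rw [h2]
  have h3 : Set.Icc a b ∩ Set.Ioi 0 = Set.Icc a b := Set.inter_eq_left.2 fun r hr => ha.trans_le hr.1
  rw [integral_indicator measurableSet_Icc, Measure.restrict_restrict measurableSet_Icc, h3]

theorem measureReal_closedBall {R : ℝ} (hR : 0 ≤ R) :
    (freqMeasure N).real (Metric.closedBall 0 R) =
      R ^ N * (freqMeasure N).real (Metric.ball 0 1) := by
  rw [Measure.addHaar_real_closedBall _ _ hR, finrank_euclideanSpace, Fintype.card_fin]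

end RadialIntegrals

/-! ### The radial logarithmic integral. -/

section LogIntegral

variable {N : ℕ}

/-- A primitive, up to lower order terms, of `(σ - (2 log r)^(k+2)) r^(N-1)`. -/
theorem hasDerivAt_primitive (hN : 1 ≤ N) (k : ℕ) (σ : ℝ) {r : ℝ} (hr : 0 < r) :
    HasDerivAt (fun r : ℝ => (σ - (2 * Real.log r) ^ (k + 2)) * r ^ N / N +
        2 * (k + 2) / N ^ 2 * ((2 * Real.log r) ^ (k + 1) * r ^ N))
      ((σ - (2 * Real.log r) ^ (k + 2)) * r ^ (N - 1) +
        4 * (k + 2) * (k + 1) / N ^ 2 * ((2 * Real.log r) ^ k * r ^ (N - 1))) r := by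
  have hN0 : (N : ℝ) ≠ 0 := by positivity
  have hl : HasDerivAt (fun r : ℝ => 2 * Real.log r) (2 * r⁻¹) r :=
    (Real.hasDerivAt_log hr.ne').const_mul 2
  have hp := hasDerivAt_pow N r
  have h1 := (((hl.pow (k + 2)).const_sub σ).mul hp).div_const (N : ℝ)
  have h2 := ((hl.pow (k + 1)).mul hp).const_mul (2 * ((k : ℝ) + 2) / N ^ 2)
  refine (h1.add h2).congr_deriv ?_
  obtain ⟨n, rfl⟩ : ∃ n, N = n + 1 := ⟨N - 1, by omega⟩
  simp only [Pi.pow_apply, Nat.add_sub_cancel, show k + 2 - 1 = k + 1 from rfl]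
  have hr' : r ^ (n + 1) = r ^ n * r := pow_succ r n
  rw [hr']
  push_cast at hN0 ⊢
  field_simp
  ring

theorem continuousOn_log_pow_mul (j : ℕ) {b : ℝ} (σ : ℝ) :
    ContinuousOn (fun r : ℝ => (σ - (2 * Real.log r) ^ j) * r ^ (N - 1)) (Set.Icc 1 b) := by
  have hl : ContinuousOn Real.log (Set.Icc 1 b) :=
    Real.continuousOn_log.mono fun r hr => (one_pos.trans_le hr.1).ne'
  fun_prop

/-- At the upper endpoint 2 log r = s, so the first term of the primitive vanishes and the second is
the main term. The leftover integral of (2 log r)^k r^(N-1) lies between 0 and s^k e^(Ns/2)/N, a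
factor s below the main term. -/
theorem integral_log_pow_bounds (hN : 1 ≤ N) (k : ℕ) {s : ℝ} (hs : 0 ≤ s) :
    ∫ r in (1 : ℝ)..Real.exp (s / 2), (s ^ (k + 2) - (2 * Real.log r) ^ (k + 2)) * r ^ (N - 1) ≤
        2 * (k + 2) / N ^ 2 * (s ^ (k + 1) * Real.exp (s / 2) ^ N) ∧
      2 * (k + 2) / N ^ 2 * (s ^ (k + 1) * Real.exp (s / 2) ^ N) - s ^ (k + 2) / N -
        4 * (k + 2) * (k + 1) / N ^ 2 * (s ^ k * (Real.exp (s / 2) ^ N / N)) ≤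
      ∫ r in (1 : ℝ)..Real.exp (s / 2),
        (s ^ (k + 2) - (2 * Real.log r) ^ (k + 2)) * r ^ (N - 1) := by
  have hN0 : (0 : ℝ) < N := by positivity
  set X := Real.exp (s / 2)
  have hX : 1 ≤ X := Real.one_le_exp (by positivity)
  have hlX : 2 * Real.log X = s := by simp only [X, Real.log_exp]; ring
  have hu : Set.uIcc 1 X = Set.Icc 1 X := Set.uIcc_of_le hX
  have hi1 : IntervalIntegrable
      (fun r : ℝ => (s ^ (k + 2) - (2 * Real.log r) ^ (k + 2)) * r ^ (N - 1)) volume 1 X :=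
    ContinuousOn.intervalIntegrable (by rw [hu]; exact continuousOn_log_pow_mul _ _)
  have hi2 : IntervalIntegrable (fun r : ℝ => (2 * Real.log r) ^ k * r ^ (N - 1)) volume 1 X := by
    have := (continuousOn_log_pow_mul (N := N) k (b := X) 0).neg
    refine ContinuousOn.intervalIntegrable ?_
    rw [hu]
    refine this.congr fun r _ => ?_
    simp
  have hftc := intervalIntegral.integral_eq_sub_of_hasDerivAt
    (fun r hr => hasDerivAt_primitive hN k (s ^ (k + 2)) (r := r)
      (by rw [hu] at hr; exact one_pos.trans_le hr.1))
    (hi1.add (hi2.const_mul (4 * (k + 2) * (k + 1) / N ^ 2)))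
  rw [intervalIntegral.integral_add hi1 (hi2.const_mul _), intervalIntegral.integral_const_mul, hlX,
    Real.log_one] at hftc
  have hE0 : 0 ≤ ∫ r in (1 : ℝ)..X, (2 * Real.log r) ^ k * r ^ (N - 1) := by
    refine intervalIntegral.integral_nonneg hX fun r hr => ?_
    have := Real.log_nonneg hr.1
    have := one_pos.trans_le hr.1
    positivity
  have hE1 : ∫ r in (1 : ℝ)..X, (2 * Real.log r) ^ k * r ^ (N - 1) ≤ s ^ k * (X ^ N / N) := by
    have hi3 : IntervalIntegrable (fun r : ℝ => s ^ k * r ^ (N - 1)) volume 1 X :=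
      (by fun_prop : Continuous fun r : ℝ => s ^ k * r ^ (N - 1)).intervalIntegrable _ _
    refine (intervalIntegral.integral_mono_on hX hi2 hi3 fun r hr => ?_).trans ?_
    · have h0 := Real.log_nonneg hr.1
      have h1 := one_pos.trans_le hr.1
      have h2 : 2 * Real.log r ≤ s := by
        rw [← hlX]
        have := Real.log_le_log h1 hr.2
        linarith
      gcongr
    · rw [intervalIntegral.integral_const_mul, integral_pow, Nat.sub_add_cancel hN, Nat.cast_sub hN,
        Nat.cast_one, sub_add_cancel, one_pow]
      gcongr
      linarith
  have hc : 0 ≤ 4 * ((k : ℝ) + 2) * (k + 1) / N ^ 2 := by positivity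
  have h1 := mul_nonneg hc hE0
  have h2 := mul_le_mul_of_nonneg_left hE1 hc
  have h3 : (s ^ (k + 2) - s ^ (k + 2)) * X ^ N / (N : ℝ) = 0 := by simp
  have h4 : (s ^ (k + 2) - (2 * 0) ^ (k + 2)) * 1 ^ N / (N : ℝ) = s ^ (k + 2) / N := by simp
  have h5 : 2 * ((k : ℝ) + 2) / N ^ 2 * ((2 * 0) ^ (k + 1) * 1 ^ N) = 0 := by simp
  rw [h3, h4, h5] at hftc
  have h6 : 0 ≤ s ^ (k + 2) / (N : ℝ) := by positivity
  constructor <;> linarith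

end LogIntegral

/-! ### Leading order of the phase space integral. -/

section Limits

theorem exp_half_pow (N : ℕ) (s : ℝ) : Real.exp (s / 2) ^ N = Real.exp (N / 2 * s) := by
  rw [← Real.exp_nat_mul]; congr 1; ring

theorem tendsto_pow_mul_exp_neg {N : ℕ} (hN : 1 ≤ N) (j : ℕ) :
    Tendsto (fun s : ℝ => s ^ j * Real.exp (-((N : ℝ) / 2 * s))) atTop (𝓝 0) := by
  have hN0 : (0 : ℝ) < N / 2 := by positivity
  have h1 := (Real.tendsto_pow_mul_exp_neg_atTop_nhds_zero j).comp
    (tendsto_id.const_mul_atTop hN0)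
  have h2 := h1.const_mul ((N / 2 : ℝ) ^ j)⁻¹
  rw [mul_zero] at h2
  refine h2.congr fun s => ?_
  simp only [Function.comp_apply, id, mul_pow]
  field_simp

/-- The leading order of the phase space integral over the shell `1 ≤ |ξ| ≤ e^{s/2}`. -/
theorem tendsto_shell_integral {N : ℕ} (hN : 1 ≤ N) (k : ℕ) :
    Tendsto (fun s : ℝ => (∫ ξ in shell N 1 (Real.exp (s / 2)),
        (s ^ (k + 2) - (2 * Real.log ‖ξ‖) ^ (k + 2)) ∂freqMeasure N) /
          (s ^ (k + 1) * Real.exp (N / 2 * s))) atTop (𝓝 (2 * (k + 2) / N ^ 2 * T N)) := by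
  have hN0 : (0 : ℝ) < N := by positivity
  have hT : 0 ≤ T N := by rw [T_eq]; positivity
  have heq : ∀ s : ℝ, 0 ≤ s → ∫ ξ in shell N 1 (Real.exp (s / 2)),
        (s ^ (k + 2) - (2 * Real.log ‖ξ‖) ^ (k + 2)) ∂freqMeasure N = T N *
      ∫ r in (1 : ℝ)..Real.exp (s / 2),
        (s ^ (k + 2) - (2 * Real.log r) ^ (k + 2)) * r ^ (N - 1) := fun s hs =>
    setIntegral_shell hN one_pos (Real.one_le_exp (by positivity))
      fun r => s ^ (k + 2) - (2 * Real.log r) ^ (k + 2)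
  have hlow : Tendsto (fun s : ℝ => T N * (2 * (k + 2) / N ^ 2 -
      s ^ 1 * Real.exp (-((N : ℝ) / 2 * s)) / N - 4 * (k + 2) * (k + 1) / N ^ 3 * s⁻¹)) atTop
      (𝓝 (T N * (2 * (k + 2) / N ^ 2 - 0 / N - 4 * (k + 2) * (k + 1) / N ^ 3 * 0))) :=
    ((((tendsto_pow_mul_exp_neg hN 1).div_const _).const_sub _).sub
      (tendsto_inv_atTop_zero.const_mul _)).const_mul _
  rw [zero_div, mul_zero, sub_zero, sub_zero, mul_comm (T N)] at hlow
  refine tendsto_of_tendsto_of_tendsto_of_le_of_le' hlow tendsto_const_nhds ?_ ?_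
  · filter_upwards [eventually_gt_atTop 0] with s hs
    have h1 := (integral_log_pow_bounds hN k hs.le).2
    rw [exp_half_pow] at h1
    rw [heq s hs.le, le_div_iff₀ (by positivity)]
    refine le_trans (le_of_eq ?_) (mul_le_mul_of_nonneg_left h1 hT)
    rw [Real.exp_neg]
    field_simp
    ring
  · filter_upwards [eventually_gt_atTop 0] with s hs
    have h1 := (integral_log_pow_bounds hN k hs.le).1
    rw [exp_half_pow] at h1
    rw [heq s hs.le, div_le_iff₀ (by positivity)]
    refine (mul_le_mul_of_nonneg_left h1 hT).trans_eq ?_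
    ring

end Limits

end
end LogLaplacian

open MeasureTheory Filter Topology Module
open scoped ContDiff ENNReal NNReal ComplexConjugate InnerProductSpace SchwartzMap FourierTransform

namespace LogLaplacian


noncomputable section

/-! ### Reduction of phase space integrals to shells. -/

section PhaseSpaceBounds

variable {N : ℕ}

theorem T_pos {N : ℕ} (hN : 1 ≤ N) : 0 < T N := by
  have hN0 : (0 : ℝ) < N := by positivity
  rw [T_eq]
  exact mul_pos hN0 (ENNReal.toReal_pos (Metric.measure_ball_pos _ _ one_pos).ne'
    measure_ball_lt_top.ne)

theorem continuousOn_shell (m : ℕ) (σ : ℝ) {a b : ℝ} (ha : 0 < a) :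
    ContinuousOn (fun ξ : Space N => σ - (2 * Real.log ‖ξ‖) ^ m) (shell N a b) := by
  have hl : ContinuousOn (fun ξ : Space N => Real.log ‖ξ‖) (shell N a b) :=
    continuous_norm.continuousOn.log fun ξ hξ => (ha.trans_le hξ.1).ne'
  fun_prop

theorem integrableOn_shell (m : ℕ) (σ : ℝ) {a b : ℝ} (ha : 0 < a) :
    IntegrableOn (fun ξ : Space N => σ - (2 * Real.log ‖ξ‖) ^ m) (shell N a b) (freqMeasure N) :=
  (continuousOn_shell m σ ha).integrableOn_compact (isCompact_shell a b)

theorem two_mul_log_le {s r : ℝ} (hr : 0 < r) (h : r ≤ Real.exp (s / 2)) : 2 * Real.log r ≤ s := by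
  have := Real.log_le_log hr h
  rw [Real.log_exp] at this
  linarith

/-- The integrand is at most s^m + |`remSymbol`| on the unit ball and vanishes beyond radius
e^(s/2), where the symbol exceeds s^m. -/
theorem integral_max_zero_sub_symbol_le (hN : 1 ≤ N) {m : ℕ} (hm : m ≠ 0) {s : ℝ} (hs : 0 ≤ s) :
    ∫ ξ : Space N, max 0 (s ^ m - symbol m ξ) ∂freqMeasure N ≤
      ∫ ξ in shell N 1 (Real.exp (s / 2)), (s ^ m - (2 * Real.log ‖ξ‖) ^ m) ∂freqMeasure N +
        s ^ m * (freqMeasure N).real (Metric.closedBall 0 1) +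
        ∫ ξ : Space N, |remSymbol m ξ| ∂freqMeasure N := by
  have hS := measurableSet_shell (N := N) 1 (Real.exp (s / 2))
  have hB : MeasurableSet (Metric.closedBall (0 : Space N) 1) := Metric.isClosed_closedBall.measurableSet
  have h1 : Integrable ((shell N 1 (Real.exp (s / 2))).indicator
      fun ξ => s ^ m - (2 * Real.log ‖ξ‖) ^ m) (freqMeasure N) :=
    (integrable_indicator_iff hS).2 (integrableOn_shell m _ one_pos)
  have h2 : Integrable ((Metric.closedBall (0 : Space N) 1).indicator fun _ => s ^ m)
      (freqMeasure N) :=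
    (integrable_indicator_iff hB).2 (integrableOn_const measure_closedBall_lt_top.ne)
  have h3 : Integrable (fun ξ : Space N => |remSymbol m ξ|) (freqMeasure N) :=
    (integrable_remSymbol hN hm).abs
  have h12 : Integrable (fun ξ => (shell N 1 (Real.exp (s / 2))).indicator
      (fun ξ => s ^ m - (2 * Real.log ‖ξ‖) ^ m) ξ +
      (Metric.closedBall (0 : Space N) 1).indicator (fun _ => s ^ m) ξ) (freqMeasure N) := h1.add h2
  refine (integral_mono (integrable_max_zero_sub_symbol hN hm _) (h12.add h3) fun ξ => ?_).trans_eq ?_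
  · have hs0 : 0 ≤ s ^ m := by positivity
    have hB0 : 0 ≤ (Metric.closedBall (0 : Space N) 1).indicator (fun _ => s ^ m) ξ :=
      Set.indicator_nonneg (fun _ _ => hs0) _
    have hsymb : symbol m ξ = posSymbol m ξ + remSymbol m ξ := by
      rw [remSymbol, add_sub_cancel]
    have hr := neg_abs_le (remSymbol m ξ)
    have hr0 := abs_nonneg (remSymbol m ξ)
    simp only [Pi.add_apply]
    rcases lt_or_ge ‖ξ‖ 1 with h | h
    · rw [Set.indicator_of_mem (show ξ ∈ Metric.closedBall (0 : Space N) 1 by simpa using h.le),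
        Set.indicator_of_notMem (fun hξ => h.not_ge hξ.1), hsymb, posSymbol_of_le_one hm h.le]
      exact max_le (by linarith) (by linarith)
    · have h0 : 0 < ‖ξ‖ := one_pos.trans_le h
      have hl := Real.log_nonneg h
      rcases le_or_gt ‖ξ‖ (Real.exp (s / 2)) with h' | h'
      · rw [Set.indicator_of_mem (show ξ ∈ shell N 1 (Real.exp (s / 2)) from ⟨h, h'⟩)]
        have : (2 * Real.log ‖ξ‖) ^ m ≤ s ^ m := by
          have := two_mul_log_le h0 h'
          gcongr
        exact max_le (by linarith) (by rw [symbol]; linarith)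
      · rw [Set.indicator_of_notMem (fun hξ => h'.not_ge hξ.2)]
        have : s ^ m ≤ symbol m ξ := by
          have := Real.log_le_log (Real.exp_pos _) h'.le
          rw [Real.log_exp] at this
          rw [symbol]
          gcongr
          linarith
        exact max_le (by linarith) (by linarith)
  · have h4 := integral_add h12 h3
    have h5 := integral_add h1 h2
    rw [integral_indicator hS] at h5
    rw [integral_indicator hB, setIntegral_const, smul_eq_mul, mul_comm] at h5
    rw [← h5]
    exact h4

/-- The inner radius s is a compromise. Discarding |ξ| < s costs only a polynomial in s, while for
|ξ| ≥ s the error term of `exists_form_cutWave_le` is one power of s below the main order s^(m-1).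
-/
theorem sub_le_setIntegral_shell (m : ℕ) {s : ℝ} (hs : 1 ≤ s) :
    ∫ ξ in shell N 1 (Real.exp (s / 2)), (s ^ m - (2 * Real.log ‖ξ‖) ^ m) ∂freqMeasure N -
        s ^ m * (freqMeasure N).real (Metric.closedBall 0 s) ≤
      ∫ ξ in shell N s (Real.exp (s / 2)), (s ^ m - (2 * Real.log ‖ξ‖) ^ m) ∂freqMeasure N := by
  have hs0 : 0 < s := one_pos.trans_le hs
  have hsub : shell N s (Real.exp (s / 2)) ⊆ shell N 1 (Real.exp (s / 2)) := fun ξ hξ =>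
    ⟨hs.trans hξ.1, hξ.2⟩
  have hi := integrableOn_shell (N := N) m (s ^ m) (b := Real.exp (s / 2)) one_pos
  have h1 := setIntegral_sdiff (measurableSet_shell (N := N) s (Real.exp (s / 2))) hi hsub
  have hD : MeasurableSet (shell N 1 (Real.exp (s / 2)) \ shell N s (Real.exp (s / 2))) :=
    (measurableSet_shell _ _).diff (measurableSet_shell _ _)
  have hDs : shell N 1 (Real.exp (s / 2)) \ shell N s (Real.exp (s / 2)) ⊆
      Metric.closedBall 0 s := fun ξ hξ => by
    rw [mem_closedBall_zero_iff]
    by_contra h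
    exact hξ.2 ⟨(not_le.1 h).le, hξ.1.2⟩
  have hDf : freqMeasure N (shell N 1 (Real.exp (s / 2)) \ shell N s (Real.exp (s / 2))) ≠ ⊤ :=
    measure_ne_top_of_subset hDs measure_closedBall_lt_top.ne
  have h2 : ∫ ξ in shell N 1 (Real.exp (s / 2)) \ shell N s (Real.exp (s / 2)),
      (s ^ m - (2 * Real.log ‖ξ‖) ^ m) ∂freqMeasure N ≤
      s ^ m * (freqMeasure N).real (Metric.closedBall 0 s) := by
    refine (setIntegral_mono_on (hi.mono_set Set.sdiff_subset)
      (integrableOn_const (C := s ^ m) hDf) hD fun ξ hξ => ?_).trans ?_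
    · have := Real.log_nonneg hξ.1.1
      have : 0 ≤ (2 * Real.log ‖ξ‖) ^ m := by positivity
      linarith
    · rw [setIntegral_const, smul_eq_mul, mul_comm]
      exact mul_le_mul_of_nonneg_left
        (measureReal_mono hDs measure_closedBall_lt_top.ne) (by positivity)
  linarith

end PhaseSpaceBounds

/-! ### Cutoffs nearly exhausting Ω. -/

section Cutoff

variable {N : ℕ} {Ω : Set (Space N)}

theorem exists_cutoff (hΩ : IsOpen Ω) (hb : Bornology.IsBounded Ω) {δ : ℝ} (hδ : δ < volume.real Ω) :
    ∃ φ : Space N → ℝ, IsTestFunction Ω (fun x => (φ x : ℂ)) ∧ (∀ x, |φ x| ≤ 1) ∧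
      δ < ∫ x, φ x ^ 2 := by
  have hfin : volume Ω ≠ ⊤ := hb.measure_lt_top.ne
  obtain ⟨K, hKΩ, hK, hδK⟩ : ∃ K ⊆ Ω, IsCompact K ∧ δ < volume.real K := by
    rcases lt_or_ge δ 0 with h | h
    · exact ⟨∅, Set.empty_subset _, isCompact_empty, by simpa using h⟩
    obtain ⟨K, hKΩ, hK, hlt⟩ := hΩ.exists_lt_isCompact (μ := volume) (r := ENNReal.ofReal δ)
      ((ENNReal.ofReal_lt_iff_lt_toReal h hfin).2 hδ)
    exact ⟨K, hKΩ, hK, (ENNReal.ofReal_lt_iff_lt_toReal h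
      (measure_ne_top_of_subset hKΩ hfin)).1 hlt⟩
  obtain ⟨K', hK', hKK', hK'Ω⟩ := exists_compact_between hK hΩ hKΩ
  obtain ⟨f, hcd, hf0, hf1, hf⟩ : ∃ f : Space N → ℝ, ContDiff ℝ ∞ f ∧ (∀ x, x ∉ interior K' → f x = 0) ∧
      (∀ x ∈ K, f x = 1) ∧ ∀ x, f x ∈ Set.Icc (0 : ℝ) 1 := by
    obtain ⟨f, hf0, hf1, hf⟩ := exists_contMDiffMap_zero_one_of_isClosed
      (n := (⊤ : ℕ∞)) (modelWithCornersSelf ℝ (Space N)) (s := (interior K')ᶜ) (t := K)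
      isOpen_interior.isClosed_compl hK.isClosed (Set.disjoint_left.2 fun x hx hxK => hx (hKK' hxK))
    exact ⟨f, contMDiff_iff_contDiff.1 f.contMDiff, fun x hx => hf0 hx, fun x hx => hf1 hx, hf⟩
  have hsupp : tsupport f ⊆ K' := by
    refine closure_minimal (fun x hx => ?_) hK'.isClosed
    by_contra h
    exact hx (hf0 x fun h' => h (interior_subset h'))
  have hcs : HasCompactSupport f := hK'.of_isClosed_subset (isClosed_tsupport _) hsupp
  have hsq : Integrable fun x => f x ^ 2 := by
    have h1 : HasCompactSupport fun x => f x * f x := hcs.mul_right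
    simp_rw [sq]
    exact (hcd.continuous.mul hcd.continuous).integrable_of_hasCompactSupport h1
  have hts : tsupport (fun x => ((f x : ℝ) : ℂ)) ⊆ tsupport f :=
    closure_mono fun x hx h => hx (by simp [h])
  refine ⟨f, ⟨Complex.ofRealCLM.contDiff.comp hcd,
    hK'.of_isClosed_subset (isClosed_tsupport _) (hts.trans hsupp), hts.trans (hsupp.trans hK'Ω)⟩,
    fun x => abs_le.2 ⟨by linarith [(hf x).1], (hf x).2⟩, hδK.trans_le ?_⟩
  have h1 : ∫ x in K, f x ^ 2 = volume.real K := by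
    rw [setIntegral_congr_fun (g := fun _ => (1 : ℝ)) hK.isClosed.measurableSet
      fun x hx => by simp [hf1 x hx]]
    simp
  rw [← h1]
  exact setIntegral_le_integral hsq (ae_of_all _ fun x => sq_nonneg _)

end Cutoff

end
end LogLaplacian

open MeasureTheory Filter Topology Module
open scoped ContDiff ENNReal NNReal ComplexConjugate InnerProductSpace SchwartzMap FourierTransform

namespace LogLaplacian


noncomputable section

/-! ### Riesz means and the counting function. -/

section RieszMeans

variable {ι : Type} {a : ι → ℝ}

theorem tsum_max_eq_sum {t : ℝ} {s : Finset ι} (hs : ∀ i, a i < t → i ∈ s) :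
    ∑' i, max 0 (t - a i) = ∑ i ∈ s, max 0 (t - a i) :=
  tsum_eq_sum fun i hi => max_eq_left (by linarith [not_lt.1 fun h => hi (hs i h)])

theorem sum_sub_eq_tsum_max {t : ℝ} {s : Finset ι} (hs : ∀ i, i ∈ s ↔ a i < t) :
    ∑ i ∈ s, (t - a i) = ∑' i, max 0 (t - a i) := by
  rw [tsum_max_eq_sum fun i => (hs i).2]
  exact Finset.sum_congr rfl fun i hi => (max_eq_right (by linarith [(hs i).1 hi])).symm

/-- The Riesz mean is convex and piecewise linear in t, with slope the counting function, which is
monotone. -/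
theorem ncard_mul_le (hfin : ∀ t, {i | a i < t}.Finite) {t₁ t₂ : ℝ} (h : t₁ ≤ t₂) :
    (Set.ncard {i | a i < t₁} : ℝ) * (t₂ - t₁) ≤
        ∑' i, max 0 (t₂ - a i) - ∑' i, max 0 (t₁ - a i) ∧
      ∑' i, max 0 (t₂ - a i) - ∑' i, max 0 (t₁ - a i) ≤
        (Set.ncard {i | a i < t₂} : ℝ) * (t₂ - t₁) := by
  rw [tsum_max_eq_sum (s := (hfin t₂).toFinset) fun i hi => by simpa using hi,
    tsum_max_eq_sum (s := (hfin t₂).toFinset) fun i hi => by simpa using hi.trans_le h,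
    ← Finset.sum_sub_distrib]
  constructor
  · rw [Set.ncard_eq_toFinset_card _ (hfin t₁), ← nsmul_eq_mul, ← Finset.sum_const]
    refine (Finset.sum_le_sum fun i hi => ?_).trans
      (Finset.sum_le_sum_of_subset_of_nonneg (fun i hi => ?_) fun i _ _ => ?_)
    · have : a i < t₁ := by simpa using hi
      rw [max_eq_right (by linarith), max_eq_right (by linarith)]
      linarith
    · have : a i < t₁ := by simpa using hi
      simpa using this.trans_le h
    · exact sub_nonneg.2 (max_le_max le_rfl (by linarith))
  · rw [Set.ncard_eq_toFinset_card _ (hfin t₂), ← nsmul_eq_mul, ← Finset.sum_const]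
    refine Finset.sum_le_sum fun i hi => ?_
    have : a i < t₂ := by simpa using hi
    rw [max_eq_right (by linarith : 0 ≤ t₂ - a i)]
    linarith [le_max_right 0 (t₁ - a i)]

end RieszMeans

/-! ### The Tauberian step. -/

section Tauberian

/-- Bernoulli's inequality at δ/s. Negative δ is needed for the lower half of the Tauberian
argument. -/
theorem pow_add_mul_le {s δ : ℝ} (hs : 0 < s) (hδ : 0 ≤ s + δ) (k : ℕ) :
    s ^ (k + 2) + (k + 2) * δ * s ^ (k + 1) ≤ (s + δ) ^ (k + 2) := by
  have h := one_add_mul_le_pow (a := δ / s) (by rw [le_div_iff₀ hs]; linarith) (k + 2)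
  have h2 := mul_le_mul_of_nonneg_left h (pow_pos hs (k + 2)).le
  rw [← mul_pow, show s * (1 + δ / s) = s + δ by field_simp] at h2
  refine le_trans (le_of_eq ?_) h2
  push_cast
  field_simp
  ring

variable {ι : Type} {a : ι → ℝ} {c L : ℝ} {k : ℕ}

/-- Growth of the Riesz means determines the growth of the counting function. -/
theorem tendsto_ncard_of_tendsto_tsum (hfin : ∀ t, {i | a i < t}.Finite)
    (hR : Tendsto (fun s : ℝ => (∑' i, max 0 (s ^ (k + 2) - a i)) /
      (s ^ (k + 1) * Real.exp (c * s))) atTop (𝓝 L)) :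
    Tendsto (fun s : ℝ => Real.exp (-(c * s)) * (Set.ncard {i | a i < s ^ (k + 2)} : ℝ)) atTop
      (𝓝 (L * c / (k + 2))) := by
  set R : ℝ → ℝ := fun t => ∑' i, max 0 (t - a i)
  set F : ℝ → ℝ := fun s => R (s ^ (k + 2)) / (s ^ (k + 1) * Real.exp (c * s)) with hF
  set n : ℝ → ℝ := fun t => (Set.ncard {i | a i < t} : ℝ)
  -- For δ ≠ 0 and s, s + δ > 0, this is e^(-cs) times the difference quotient of R between s^(k+2)
  -- and (s+δ)^(k+2), over the linearized increment (k+2) δ s^(k+1). It is written through F so that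
  -- its limit in s can be read off; then δ → 0 differentiates e^(cδ) at 0.
  set G : ℝ → ℝ → ℝ := fun δ s =>
    (F (s + δ) * ((1 + δ * s⁻¹) ^ (k + 1) * Real.exp (c * δ)) - F s) / ((k + 2) * δ) with hG
  have hGlim : ∀ δ, Tendsto (G δ) atTop
      (𝓝 ((L * ((1 + δ * 0) ^ (k + 1) * Real.exp (c * δ)) - L) / ((k + 2) * δ))) := fun δ =>
    (((hR.comp (tendsto_atTop_add_const_right atTop δ tendsto_id)).mul
      ((((tendsto_inv_atTop_zero.const_mul δ).const_add 1).pow (k + 1)).mul_const _)).sub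
      hR).div_const _
  have hc : Tendsto (fun δ : ℝ => (L * ((1 + δ * 0) ^ (k + 1) * Real.exp (c * δ)) - L) /
      ((k + 2) * δ)) (𝓝[≠] 0) (𝓝 (L * c / (k + 2))) := by
    have h1 : HasDerivAt (fun δ : ℝ => Real.exp (c * δ)) c 0 := by
      simpa using ((hasDerivAt_id (0 : ℝ)).const_mul c).exp
    have h2 := (h1.tendsto_slope.const_mul L).div_const ((k : ℝ) + 2)
    refine h2.congr fun δ => ?_
    simp only [slope_def_field, mul_zero, Real.exp_zero, sub_zero, add_zero, one_pow, one_mul]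
    rw [← mul_div_assoc, div_div, mul_sub, mul_one, mul_comm δ]
  have hGeq : ∀ δ s : ℝ, δ ≠ 0 → 0 < s → 0 < s + δ → G δ s = Real.exp (-(c * s)) *
      ((R ((s + δ) ^ (k + 2)) - R (s ^ (k + 2))) / ((k + 2) * δ * s ^ (k + 1))) := by
    intro δ s hδ hs hsδ
    have h1 : 1 + δ * s⁻¹ = (s + δ) / s := by field_simp
    have h2 : Real.exp (c * (s + δ)) = Real.exp (c * s) * Real.exp (c * δ) := by
      rw [← Real.exp_add]; ring_nf
    simp only [hG, hF]
    rw [h1, h2, Real.exp_neg, div_pow]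
    field_simp
  rw [tendsto_order]
  constructor
  -- Backward increments δ < 0 bound the counting function from below; forward ones, in the other
  -- half, from above.
  · intro b hb
    have h1 := (hc.mono_left (nhdsLT_le_nhdsNE 0)).eventually (lt_mem_nhds hb)
    obtain ⟨δ, hδb, hδ⟩ := (h1.and self_mem_nhdsWithin).exists
    filter_upwards [(hGlim δ).eventually (lt_mem_nhds hδb), eventually_gt_atTop 0,
      eventually_gt_atTop (-δ)] with s hs hs0 hsδ
    have hδ' : δ < 0 := hδ
    have hsδ' : 0 < s + δ := by linarith
    refine hs.trans_le ?_
    rw [hGeq δ s hδ'.ne hs0 hsδ']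
    refine mul_le_mul_of_nonneg_left ?_ (Real.exp_pos _).le
    have hle : (s + δ) ^ (k + 2) ≤ s ^ (k + 2) := by gcongr; linarith
    have h2 := (ncard_mul_le hfin hle).2
    have h3 := mul_le_mul_of_nonneg_left (pow_add_mul_le hs0 hsδ'.le k)
      (show 0 ≤ n (s ^ (k + 2)) from Nat.cast_nonneg _)
    have hneg : ((k : ℝ) + 2) * δ * s ^ (k + 1) < 0 :=
      mul_neg_of_neg_of_pos (mul_neg_of_pos_of_neg (by positivity) hδ') (by positivity)
    rw [div_le_iff_of_neg hneg]
    simp only [R, n] at h3 ⊢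
    linarith
  · intro b hb
    have h1 := (hc.mono_left (nhdsGT_le_nhdsNE 0)).eventually (gt_mem_nhds hb)
    obtain ⟨δ, hδb, hδ⟩ := (h1.and self_mem_nhdsWithin).exists
    filter_upwards [(hGlim δ).eventually (gt_mem_nhds hδb), eventually_gt_atTop 0] with s hs hs0
    have hδ' : 0 < δ := hδ
    have hsδ' : 0 < s + δ := by linarith
    refine lt_of_le_of_lt ?_ hs
    rw [hGeq δ s hδ'.ne' hs0 hsδ']
    refine mul_le_mul_of_nonneg_left ?_ (Real.exp_pos _).le
    have hle : s ^ (k + 2) ≤ (s + δ) ^ (k + 2) := by gcongr; linarith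
    have h2 := (ncard_mul_le hfin hle).1
    have h3 := mul_le_mul_of_nonneg_left (pow_add_mul_le hs0 hsδ'.le k)
      (show 0 ≤ n (s ^ (k + 2)) from Nat.cast_nonneg _)
    have hpos : 0 < ((k : ℝ) + 2) * δ * s ^ (k + 1) := by positivity
    rw [le_div_iff₀ hpos]
    simp only [R, n] at h3 ⊢
    linarith

end Tauberian

/-! ### Listing eigenvalues in increasing order. -/

section Enumeration

variable {ι : Type} {a : ι → ℝ}

theorem tendsto_atTop_of_finite_sublevels {lam : ℕ → ℝ} (hfin : ∀ t, {k | lam k < t}.Finite) :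
    Tendsto lam atTop atTop := by
  rw [← Nat.cofinite_eq_atTop]
  refine tendsto_atTop.2 fun t => ?_
  rw [eventually_cofinite]
  simpa only [not_le] using hfin t

/-- A function with finite sublevel sets on an infinite type can be listed in increasing order. -/
theorem exists_equiv_monotone [Infinite ι] (hfin : ∀ t, {i | a i < t}.Finite) :
    ∃ σ : ℕ ≃ ι, Monotone (a ∘ σ) := by
  have hcount : Countable ι := by
    have : (Set.univ : Set ι) = ⋃ n : ℕ, {i | a i < n} := by
      refine (Set.iUnion_eq_univ_iff.2 fun i => ?_).symm
      exact exists_nat_gt (a i)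
    rw [← Set.countable_univ_iff, this]
    exact Set.countable_iUnion fun n => (hfin n).countable
  obtain ⟨c, hc⟩ := hcount.exists_injective_nat
  -- An injection into ℕ breaks ties between equal eigenvalues. The number of strict predecessors
  -- then embeds ι in ℕ, and its infinite range is enumerated in increasing order.
  let f : ι → ℝ ×ₗ ℕ := fun i => toLex (a i, c i)
  have hf : Function.Injective f := fun i j h => hc (by simpa [f] using congrArg (fun p => (ofLex p).2) h)
  have hfa : ∀ i j, f i ≤ f j → a i ≤ a j := fun i j h => by
    rcases Prod.Lex.le_iff.1 h with h | h
    · exact h.le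
    · exact h.1.le
  have hsub : ∀ j, {i | f i < f j}.Finite := fun j =>
    (hfin (a j + 1)).subset fun i hi => by
      have := hfa i j (le_of_lt hi)
      simp only [Set.mem_ofPred_eq]; linarith
  let r : ι → ℕ := fun j => Set.ncard {i | f i < f j}
  have hr : ∀ i j, f i < f j → r i < r j := fun i j h =>
    Set.ncard_lt_ncard ⟨fun l hl => lt_trans hl h, fun hsup => lt_irrefl (f i) (hsup h)⟩ (hsub j)
  have hrinj : Function.Injective r := fun i j h => by
    rcases lt_trichotomy (f i) (f j) with h' | h' | h'
    · exact absurd h (hr i j h').ne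
    · exact hf h'
    · exact absurd h (hr j i h').ne'
  have hinf : Infinite (Set.range r) := (Set.infinite_range_of_injective hrinj).to_subtype
  classical
  let σ : ℕ ≃ ι := (Nat.Subtype.orderIsoOfNat (Set.range r)).toEquiv.trans
    (Equiv.ofInjective r hrinj).symm
  have hσ : ∀ n, r (σ n) = Nat.Subtype.orderIsoOfNat (Set.range r) n := fun n => by
    simp only [σ, Equiv.trans_apply]
    exact Equiv.apply_ofInjective_symm hrinj _
  refine ⟨σ, fun p q hpq => hfa _ _ (le_of_not_gt fun h => ?_)⟩
  have h1 := hr _ _ h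
  rw [hσ, hσ] at h1
  exact h1.not_ge ((Nat.Subtype.orderIsoOfNat (Set.range r)).monotone hpq)

/-- Gluing bijections of the fibres transports counting functions and Riesz means from the spectral
index set to an arbitrary eigenvalue sequence. -/
theorem exists_equiv_of_mk_fiber_eq {κ : Type} {b : κ → ℝ}
    (h : ∀ t, Cardinal.mk {j // b j = t} = Cardinal.mk {i // a i = t}) :
    ∃ σ : κ ≃ ι, ∀ j, a (σ j) = b j := by
  have E : ∀ t, {j // b j = t} ≃ {i // a i = t} := fun t => (Cardinal.eq.1 (h t)).some
  refine ⟨(Equiv.sigmaFiberEquiv b).symm.trans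
    ((Equiv.sigmaCongrRight E).trans (Equiv.sigmaFiberEquiv a)), fun j => ?_⟩
  exact (E (b j) ⟨j, rfl⟩).2

end Enumeration

end
end LogLaplacian

open MeasureTheory Filter Topology Module
open scoped ContDiff ENNReal NNReal ComplexConjugate InnerProductSpace SchwartzMap FourierTransform

namespace LogLaplacian


noncomputable section

/-! ### Assembling the Weyl law. -/

variable {N : ℕ} {Ω : Set (Space N)} [IsFiniteMeasure (volume.restrict Ω)]

/-- The Berezin–Li–Yau bound at t + 1: each eigenvalue below t contributes at least 1 to a bounded
sum. -/
theorem finite_sublevel (hΩ : IsOpen Ω) (hb : Bornology.IsBounded Ω) (hN : 1 ≤ N) {m : ℕ}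
    (hm : m ≠ 0) {ι : Type} {e : ι → L2 Ω} (he : Orthonormal ℂ e) {a : ι → ℝ}
    (hea : ∀ i, e i ∈ eigenfunctions m Ω (a i)) (t : ℝ) : {i | a i < t}.Finite := by
  by_contra h
  obtain ⟨n, hn⟩ := exists_nat_gt
    (volume.real Ω * ∫ ξ, max 0 (t + 1 - symbol m ξ) ∂freqMeasure N)
  obtain ⟨s, hs, hcard⟩ := Set.Infinite.exists_subset_card_eq h n
  have h1 := sum_sub_le hΩ hb hN hm he hea (t + 1) s
  have h2 : (n : ℝ) ≤ ∑ i ∈ s, (t + 1 - a i) := by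
    rw [← hcard, ← nsmul_one, ← Finset.sum_const]
    refine Finset.sum_le_sum fun i hi => ?_
    have : a i < t := hs hi
    linarith
  linarith

theorem tendsto_tsum_div (hΩ : IsOpen Ω) (hb : Bornology.IsBounded Ω) (hN : 1 ≤ N) (k : ℕ)
    {ι : Type} {e : ι → L2 Ω} (he : Orthonormal ℂ e) {a : ι → ℝ}
    (hea : ∀ i, e i ∈ eigenfunctions (k + 2) Ω (a i))
    (hvar : ∀ u ∈ formDomain (k + 2) Ω, ∀ (t : ℝ) (s : Finset ι), (∀ i, a i < t → i ∈ s) →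
        t * ‖u‖ ^ 2 - (form (k + 2) Ω u u).re ≤ ∑ i ∈ s, (t - a i) * ‖⟪e i, u⟫_ℂ‖ ^ 2) :
    Tendsto (fun s : ℝ => (∑' i, max 0 (s ^ (k + 2) - a i)) /
      (s ^ (k + 1) * Real.exp (N / 2 * s))) atTop
      (𝓝 (2 * (k + 2) / N ^ 2 * T N * volume.real Ω)) := by
  have hN0 : (0 : ℝ) < N := by positivity
  have hm : k + 2 ≠ 0 := by omega
  have hfin := finite_sublevel hΩ hb hN hm he hea
  have hI := tendsto_shell_integral hN k
  set L : ℝ := 2 * (k + 2) / N ^ 2 * T N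
  have hL : 0 < L := mul_pos (by positivity) (T_pos hN)
  set I : ℝ → ℝ := fun s => ∫ ξ in shell N 1 (Real.exp (s / 2)),
    (s ^ (k + 2) - (2 * Real.log ‖ξ‖) ^ (k + 2)) ∂freqMeasure N
  set ν : ℝ := (freqMeasure N).real (Metric.ball 0 1)
  have hexp := tendsto_pow_mul_exp_neg hN
  have hsum : ∀ t, ∑' i, max 0 (t - a i) = ∑ i ∈ (hfin t).toFinset, (t - a i) := fun t =>
    (sum_sub_eq_tsum_max fun i => by simp).symm
  rw [tendsto_order]
  constructor
  · intro b hlt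
    -- The cutoff is chosen so that L ∫ φ² still exceeds b; all errors then vanish as s → ∞.
    obtain ⟨φ, hφ, hφ1, hδ⟩ := exists_cutoff hΩ hb
      (show b / L < volume.real Ω from (div_lt_iff₀' hL).2 hlt)
    set Φ := ∫ x, φ x ^ 2
    have hΦ : 0 ≤ Φ := integral_nonneg fun x => sq_nonneg _
    obtain ⟨C, hC, hform⟩ := exists_form_cutWave_le hΩ hb hN (k + 1) hφ
    have hlow : Tendsto (fun s : ℝ => Φ * (I s / (s ^ (k + 1) * Real.exp (N / 2 * s)) -
        s ^ (N + 1) * Real.exp (-((N : ℝ) / 2 * s)) * ν) -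
        C * (s⁻¹ ^ (k + 1) + (s⁻¹ + 1) ^ (k + 1) * s⁻¹) * ν) atTop
        (𝓝 (Φ * (L - 0 * ν) - C * (0 ^ (k + 1) + (0 + 1) ^ (k + 1) * 0) * ν)) :=
      ((hI.sub ((hexp (N + 1)).mul_const ν)).const_mul Φ).sub
        ((((tendsto_inv_atTop_zero.pow (k + 1)).add
          (((tendsto_inv_atTop_zero.add_const 1).pow (k + 1)).mul
            tendsto_inv_atTop_zero)).const_mul C).mul_const ν)
    have hb' : b < Φ * (L - 0 * ν) - C * (0 ^ (k + 1) + (0 + 1) ^ (k + 1) * 0) * ν := by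
      simpa using (div_lt_iff₀ hL).1 hδ
    filter_upwards [hlow.eventually (lt_mem_nhds hb'), eventually_ge_atTop 1] with s hs hs1
    refine hs.trans_le ?_
    have hs0 : 0 < s := one_pos.trans_le hs1
    -- A uniform energy error on the shell s ≤ |ξ| ≤ e^(s/2), where 2 log|ξ| ≤ s.
    set K : ℝ := C * (1 + (1 + s) ^ (k + 1) / s)
    have hK : 0 ≤ K := by positivity
    have hi : IntegrableOn (fun ξ : Space N => Φ * (s ^ (k + 2) - (2 * Real.log ‖ξ‖) ^ (k + 2)))
        (shell N s (Real.exp (s / 2))) (freqMeasure N) :=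
      (integrableOn_shell (k + 2) _ hs0).const_mul _
    have hA : freqMeasure N (shell N s (Real.exp (s / 2))) ≠ ⊤ :=
      (isCompact_shell _ _).measure_ne_top
    have hKi : IntegrableOn (fun _ : Space N => K) (shell N s (Real.exp (s / 2))) (freqMeasure N) :=
      integrableOn_const hA
    have h1 := setIntegral_le_sum_sub hΩ hb he hvar hφ hφ1 (t := s ^ (k + 2))
      (s := (hfin (s ^ (k + 2))).toFinset) (fun i => by simp)
      (measurableSet_shell s (Real.exp (s / 2))) (hi.sub hKi) fun ξ hξ w hw => by
        have hξ1 := hs1.trans hξ.1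
        have hξ0 : 0 < ‖ξ‖ := one_pos.trans_le hξ1
        have h2 := hform ξ hξ1 w hw
        have h3 : C * (1 + (1 + 2 * Real.log ‖ξ‖) ^ (k + 1) / ‖ξ‖) ≤ K := by
          have := two_mul_log_le hξ0 hξ.2
          have := Real.log_nonneg hξ1
          have := hξ.1
          simp only [K]
          gcongr
        simp only [Pi.sub_apply]
        linarith
    rw [integral_sub' hi hKi, integral_const_mul, setIntegral_const, smul_eq_mul, ← hsum] at h1
    have h2 := sub_le_setIntegral_shell (N := N) (k + 2) hs1
    rw [measureReal_closedBall hs0.le] at h2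
    have h3 : (freqMeasure N).real (shell N s (Real.exp (s / 2))) ≤ Real.exp (N / 2 * s) * ν := by
      rw [← exp_half_pow, ← measureReal_closedBall (Real.exp_pos _).le]
      exact measureReal_mono (shell_subset_closedBall _ _) measure_closedBall_lt_top.ne
    have h4 := mul_le_mul_of_nonneg_left h2 hΦ
    have h5 := mul_le_mul_of_nonneg_right h3 hK
    rw [le_div_iff₀ (by positivity)]
    refine le_trans (le_of_eq ?_) ((sub_le_sub h4 h5).trans h1)
    simp only [K, I, ν]
    rw [Real.exp_neg, show s⁻¹ + 1 = (1 + s) / s by field_simp, div_pow, inv_pow]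
    field_simp
    ring
  · intro b hlt
    set B : ℝ := ∫ ξ : Space N, |remSymbol (k + 2) ξ| ∂freqMeasure N
    have hup : Tendsto (fun s : ℝ => volume.real Ω *
        (I s / (s ^ (k + 1) * Real.exp (N / 2 * s)) +
        s ^ 1 * Real.exp (-((N : ℝ) / 2 * s)) * ν +
        s⁻¹ ^ (k + 1) * (s ^ 0 * Real.exp (-((N : ℝ) / 2 * s))) * B)) atTop
        (𝓝 (volume.real Ω * (L + 0 * ν + 0 ^ (k + 1) * 0 * B))) :=
      ((hI.add ((hexp 1).mul_const ν)).add
        (((tendsto_inv_atTop_zero.pow (k + 1)).mul (hexp 0)).mul_const B)).const_mul _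
    have hb' : volume.real Ω * (L + 0 * ν + 0 ^ (k + 1) * 0 * B) < b := by
      simpa [mul_comm] using hlt
    filter_upwards [hup.eventually (gt_mem_nhds hb'), eventually_gt_atTop 0] with s hs hs0
    refine lt_of_le_of_lt ?_ hs
    have h1 := sum_sub_le hΩ hb hN hm he hea (s ^ (k + 2)) (hfin (s ^ (k + 2))).toFinset
    rw [← hsum] at h1
    have h2 := integral_max_zero_sub_symbol_le hN hm hs0.le
    rw [measureReal_closedBall zero_le_one, one_pow, one_mul] at h2
    rw [div_le_iff₀ (by positivity)]
    refine h1.trans ((mul_le_mul_of_nonneg_left h2 measureReal_nonneg).trans_eq ?_)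
    rw [Real.exp_neg, inv_pow]
    simp only [I, ν, B]
    field_simp
    ring

theorem tendsto_rpow_inv (m : ℕ) (hm : m ≠ 0) :
    Tendsto (fun t : ℝ => t ^ (1 / (m : ℝ))) atTop atTop :=
  tendsto_rpow_atTop (by positivity)

theorem rpow_inv_pow {t : ℝ} (ht : 0 ≤ t) {m : ℕ} (hm : m ≠ 0) : (t ^ (1 / (m : ℝ))) ^ m = t := by
  rw [one_div, Real.rpow_inv_natCast_pow ht hm]

/-- A finite index set would bound the counting function and force the normalized limit to be 0, but
that limit is positive. -/
theorem tendsto_ncard_and_infinite (hN : 1 ≤ N) (k : ℕ) {V : ℝ} (hV : 0 < V) {ι : Type} {a : ι → ℝ}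
    (hfin : ∀ t, {i | a i < t}.Finite)
    (hR : Tendsto (fun s : ℝ => (∑' i, max 0 (s ^ (k + 2) - a i)) /
      (s ^ (k + 1) * Real.exp (N / 2 * s))) atTop
      (𝓝 (2 * (k + 2) / N ^ 2 * T N * V))) :
    Tendsto (fun s : ℝ => Real.exp (-((N : ℝ) / 2 * s)) * (Set.ncard {i | a i < s ^ (k + 2)} : ℝ))
      atTop (𝓝 (T N * V / N)) ∧ Infinite ι := by
  have hN0 : (0 : ℝ) < N := by positivity
  have h := tendsto_ncard_of_tendsto_tsum hfin hR
  have heq : 2 * ((k : ℝ) + 2) / N ^ 2 * T N * V * (N / 2) / (k + 2) =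
      T N * V / N := by field_simp
  rw [heq] at h
  refine ⟨h, not_finite_iff_infinite.1 fun hι => ?_⟩
  have hz : Tendsto (fun s : ℝ => Real.exp (-((N : ℝ) / 2 * s)) *
      (Set.ncard {i | a i < s ^ (k + 2)} : ℝ)) atTop (𝓝 0) := by
    have h1 := (tendsto_pow_mul_exp_neg hN 0).mul_const (Nat.card ι : ℝ)
    simp only [pow_zero, one_mul, zero_mul] at h1
    refine squeeze_zero (fun s => by positivity) (fun s => ?_) h1
    gcongr
    rw [← Set.ncard_univ]
    exact Set.ncard_le_ncard (Set.subset_univ _)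
  have := tendsto_nhds_unique h hz
  have : 0 < T N * V / N := by have := T_pos hN; positivity
  linarith

theorem weyl_law (hΩ : IsOpen Ω) (hb : Bornology.IsBounded Ω) (hN : 1 ≤ N) (k : ℕ)
    (hpos : 0 < volume.real Ω) :
    (∃ lam : ℕ → ℝ, IsEigenvalueSequence (k + 2) Ω lam) ∧
    ∀ lam : ℕ → ℝ, IsEigenvalueSequence (k + 2) Ω lam →
      Tendsto lam atTop atTop ∧
      Tendsto (fun t : ℝ => Real.exp (-((N : ℝ) / 2) * t ^ (1 / ((k + 2 : ℕ) : ℝ))) *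
          (countingFunction lam t : ℝ)) atTop (𝓝 (T N * volume.real Ω / (N : ℝ))) ∧
      Tendsto (fun t : ℝ => t ^ (-((((k + 2 : ℕ) : ℝ) - 1) / ((k + 2 : ℕ) : ℝ))) *
          Real.exp (-((N : ℝ) / 2) * t ^ (1 / ((k + 2 : ℕ) : ℝ))) * rieszMean lam t) atTop
        (𝓝 (2 * ((k + 2 : ℕ) : ℝ) / (N : ℝ) ^ 2 * T N * volume.real Ω)) := by
  have hm : k + 2 ≠ 0 := by omega
  obtain ⟨ι, e, a, hea, hcard, hvar⟩ := exists_hilbertBasis_eigenfunctions hΩ hb hN hm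
  have hfin := finite_sublevel hΩ hb hN hm e.orthonormal hea
  have hR := tendsto_tsum_div hΩ hb hN k e.orthonormal hea hvar
  obtain ⟨hn, hinf⟩ := tendsto_ncard_and_infinite hN k hpos hfin hR
  refine ⟨?_, fun lam hlam => ?_⟩
  · obtain ⟨σ, hσ⟩ := exists_equiv_monotone hfin
    refine ⟨a ∘ σ, hσ, fun μ => ?_⟩
    rw [← hcard]
    exact Cardinal.mk_congr (σ.subtypeEquiv fun _ => Iff.rfl)
  obtain ⟨σ, hσ⟩ := exists_equiv_of_mk_fiber_eq fun t => (hlam.2 t).trans (hcard t).symm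
  have hset : ∀ t, {j | lam j < t} = σ ⁻¹' {i | a i < t} := fun t => by
    ext j
    simp [hσ]
  have hcount : ∀ t, countingFunction lam t = Set.ncard {i | a i < t} := fun t => by
    rw [countingFunction, hset]
    exact Nat.card_congr (σ.subtypeEquiv fun _ => Iff.rfl)
  have hriesz : ∀ t, rieszMean lam t = ∑' i, max 0 (t - a i) := fun t => by
    rw [rieszMean, ← σ.tsum_eq]
    simp_rw [hσ]
  have hroot := tendsto_rpow_inv (k + 2) hm
  refine ⟨tendsto_atTop_of_finite_sublevels fun t => ?_, ?_, ?_⟩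
  · rw [hset]
    exact (hfin t).preimage σ.injective.injOn
  -- Substitution s = t^(1/m), which turns the limits in s into limits in t.
  · refine (hn.comp hroot).congr' ?_
    filter_upwards [eventually_ge_atTop 0] with t ht
    rw [Function.comp_apply, rpow_inv_pow ht hm, hcount, neg_mul]
  · rw [show 2 * ((k + 2 : ℕ) : ℝ) = 2 * (k + 2) by push_cast; ring]
    refine (hR.comp hroot).congr' ?_
    filter_upwards [eventually_gt_atTop 0] with t ht
    rw [Function.comp_apply, rpow_inv_pow ht.le hm, hriesz, neg_mul, Real.exp_neg,
      Real.rpow_neg ht.le, ← Real.rpow_natCast, ← Real.rpow_mul ht.le,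
      show 1 / ((k + 2 : ℕ) : ℝ) * ((k + 1 : ℕ) : ℝ) =
        (((k + 2 : ℕ) : ℝ) - 1) / ((k + 2 : ℕ) : ℝ) by push_cast; ring]
    rw [← mul_inv, div_eq_inv_mul]

end

end LogLaplacian

theorem theorem1p1 (N m : ℕ) (hN : 1 ≤ N) (hm : 2 ≤ m)
    (Ω : Set (EuclideanSpace ℝ (Fin N))) (hopen : IsOpen Ω) (hconn : IsConnected Ω)
    (hbdd : Bornology.IsBounded Ω)
    (hLip : 2 ≤ N → LogLaplacian.HasLipschitzBoundary Ω) :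
    (∃ lam : ℕ → ℝ, LogLaplacian.IsEigenvalueSequence m Ω lam) ∧
    ∀ lam : ℕ → ℝ, LogLaplacian.IsEigenvalueSequence m Ω lam →
      Filter.Tendsto lam Filter.atTop Filter.atTop ∧
      Filter.Tendsto
        (fun t : ℝ => Real.exp (-((N : ℝ) / 2) * t ^ (1 / (m : ℝ))) *
          (LogLaplacian.countingFunction lam t : ℝ))
        Filter.atTop
        (nhds (LogLaplacian.T N * MeasureTheory.volume.real Ω / (N : ℝ))) ∧
      Filter.Tendsto
        (fun t : ℝ => t ^ (-(((m : ℝ) - 1) / (m : ℝ))) *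
          Real.exp (-((N : ℝ) / 2) * t ^ (1 / (m : ℝ))) *
          LogLaplacian.rieszMean lam t)
        Filter.atTop
        (nhds (2 * (m : ℝ) / (N : ℝ) ^ 2 * LogLaplacian.T N * MeasureTheory.volume.real Ω)) := by
  have hfm : IsFiniteMeasure (MeasureTheory.volume.restrict Ω) :=
    MeasureTheory.isFiniteMeasure_restrict.2 hbdd.measure_lt_top.ne
  have hpos : 0 < MeasureTheory.volume.real Ω := ENNReal.toReal_pos
    (hopen.measure_pos MeasureTheory.volume hconn.nonempty).ne' hbdd.measure_lt_top.ne
  obtain ⟨k, rfl⟩ := Nat.exists_eq_add_of_le' hm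
  exact LogLaplacian.weyl_law hopen hbdd hN k hpos
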